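/- **Setting.** For $i=1,2$ let $A_i,B_i\in\mathbb C[z]$, $B_i\neq 0$, $d_i=\deg A_i\ge q_i+1$, $q_i=\deg B_i$, be reduced (every common zero of $A_i$ and $B_i$ is a simple zero of $B_i$), let $V_i'=(A_i+B_i')/B_i$, and let $e^{-V_i}$ be a holomorphic branch, on an open set $D_i$ without zeros of $B_i$, of the weight with logarithmic derivative $-V_i'$. The common zeros of $B_i$ and $A_i+B_i'$ are the *hard edges*. Let $\Gamma_{x,\mu}\subset D_1$ ($1\le\mu\le d_1$) and $\Gamma_{y,\nu}\subset D_2$ ($1\le \nu\le d_2$) be admissible contours for $e^{-V_1}$, $e^{-V_2}$: $C^1$-parametrized paths (corners may be parametrized with vanishing velocity), with arc length of at most polynomial growth, that are closed loops in $D_i$, or each of whose two ends either goes to infinity in a sector in which $\Re V_i\to+\infty$ (so that $e^{-V_i(z)}=O(e^{-\delta|z|^{d_i-q_i+1}})$ for some $\delta>0$), or goes to a zero $b$ of $B_i$ of multiplicity $m+1\ge2$ in a sector in which $\Re V_i\to+\infty$ (so that $e^{-V_i(z)}=O(e^{-\delta|z-b|^{-m}})$ for some $\delta>0$), or goes to a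 simple zero of $B_i$ at which $V_i'$ has residue in $\{0,-1,-2,\dots\}$ (residue $0$: a hard edge). Let $\varkappa_{\mu\nu}\in\mathbb C$ and $$\mathcal L(f|g)=\sum_{\mu=1}^{d_1}\sum_{\nu=1}^{d_2}\varkappa_{\mu\nu}\int_{\Gamma_{x,\mu}}\int_{\Gamma_{y,\nu}}f(x)g(y)\,e^{xy-V_1(x)-V_2(y)}\,dy\,dx ,\qquad \widehat{\mathcal L}(p|s)=\mathcal L(p|B_2s).$$ If $d_1=q_1+1$ and $d_2=q_2+1$, assume that all the moments converge absolutely for those $\mu,\nu$ with $\varkappa_{\mu\nu}\ne0$. Assume that $\mathcal L$ and $\widehat{\mathcal L}$ have biorthogonal polynomials, i.e. there are polynomials $p_n,s_n$ of degree $n$ with equal leading coefficients and $\mathcal L(p_n|s_m)=\delta_{nm}$, and $\widehat p_n,\widehat s_n$ of degree $n$ with $\widehat{\mathcal L}(\widehat p_n|\widehat s_m)=\delta_{nm}$, where $\widehat p_n$ has the same leading coefficient as $p_n$. Put $\widehat p_k=0$ for $k<0$. Define $\widehat A_{kn}=\mathcal L(p_k\,|\,A_2\widehat s_n-B_2\widehat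 s_n')$, and $\widehat L_{kn}=\mathcal L(p_k|B_2\widehat s_n)$ for $k>n$, $\widehat L_{kn}=0$ for $k\le n$; $P_{jk}=\mathcal L(p_j|y\,s_k)$; $$\phi^{(0)}_m(x)=e^{V_1(x)}\mathcal L\Big(\tfrac1{x-\xi}\Big|s_m(y)\Big),\quad \phi^{(\nu)}_m(x)=\int_{\Gamma_{y,\nu}}e^{xy-V_2(y)}s_m(y)\,dy\ (1\le\nu\le d_2),\quad \phi_m^{(\mu,\varkappa)}=\sum_{\nu}\varkappa_{\mu\nu}\phi^{(\nu)}_m .$$ For $n\ge1$ let $\underline{\boldsymbol\Phi}_n(x)$ be the $(d_2+1)\times(d_2+1)$ matrix with rows $[\phi^{(r)}_{n-1},\dots,\phi^{(r)}_{n+d_2-1}]$, $r=0,\dots,d_2$. With indices $a,b=0,\dots,d_2$ define: * the dual ladder matrix $\underline{\mathbf a}_n(x)$, with entries $\delta_{b,a+1}+\delta_{b0}\,\dfrac{x(\delta_{a0}+\widehat L_{n+a,n})-\widehat A_{n+a,n}}{\widehat A_{n-1,n}}$; * $\widehat{\mathbb A}(x)$, the block of the commutator $[\widehat A-x\widehat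 L,\Pi_n]$ with rows $n-1,\dots,n+d_2-1$ and columns $n-d_2,\dots,n$, where $\Pi_n=\mathrm{diag}(1,\dots,1,0,0,\dots)$ with $n$ ones, and entries with a negative column index are $0$; * the boundary matrix $\mathcal E(x)_{ab}=\sum_\mu\Big[\dfrac{\widehat p_{n-d_2+a}(\rho)e^{-V_1(\rho)}\phi^{(\mu,\varkappa)}_{n-1+b}(\rho)}{x-\rho}\Big]_{\rho\in\partial\Gamma_{x,\mu}}$, final minus initial value, taken as limits along the contour, where only hard-edge ends contribute; * $W_{ab}(x)=\mathcal L\Big(\widehat p_{n-d_2+a}(\rho)\dfrac{V_1'(\rho)-V_1'(x)}{\rho-x}\Big|s_{n-1+b}(y)\Big)$; * $M_n(x)$, with row $0$ equal to $(V_1'(x),0,\dots,0)$ and row $a\ge1$ equal to $(P_{n-1+a,\,n-1},\dots,P_{n-1+a,\,n+d_2-1})$ (here $P_{jk}=0$ for $j>k+1$); and $$R_n(x)=M_n(x)+\underline{\mathbf a}_n(x)^{-1}\,\mathrm{diag}\big(P_{n+d_2,n-1},\dots,P_{n+d_2,n+d_2-1}\big)+\widehat{\mathbb A}(x)\,\mathcal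 E(x)-\widehat{\mathbb A}(x)\,W(x).$$ **Theorem.** Let $n\ge1$. The matrix $\underline{\mathbf a}_n(x)$ is invertible for every $x\in\mathbb C$. For all $x\in D_1$ outside the closure of $\bigcup_\mu\Gamma_{x,\mu}$ one has $\underline{\boldsymbol\Phi}_n(x)=\underline{\boldsymbol\Phi}_{n+1}(x)\,\underline{\mathbf a}_n(x)$, and $\underline{\boldsymbol\Phi}_n$ is differentiable at $x$ with $$\underline{\boldsymbol\Phi}_n'(x)=\underline{\boldsymbol\Phi}_n(x)\,R_n(x).$$ If the functions $x\mapsto\int_{\Gamma_{y,\nu}}e^{xy-V_2(y)}dy$, $\nu=1,\dots,d_2$, are linearly independent, then $\underline{\boldsymbol\Phi}_n(x)$ is invertible for all these $x$, so that $\underline{\boldsymbol\Phi}_n^{-1}\underline{\boldsymbol\Phi}_n'=R_n$. The coefficient is rational: there is a matrix $N$ of polynomials with $B_1(x)R_n(x)=N(x)$ for all $x$ outside the zeros of $B_1$ and the closure of $\bigcup_\mu\Gamma_{x,\mu}$. Moreover, if a strictly lower triangular $M$ and a lower Hessenberg $B$ (semi-infinite matrices) satisfy $y\big(s_i+\sum_{k<i}M_{ik}s_k\big)=\sum_{k\le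 i+1}B_{ik}s_k$ for all $i$, then $(1+M)P^t=B$, i.e. $P=((1+M)^{-1}B)^t$. -/

import Mathlib

open Polynomial Filter Topology MeasureTheory

noncomputable section

namespace SemiBOP

/-- The rational function `(A + B') / B`, i.e. the derivative of the potential `V`
attached to the pair of polynomials `(A, B)`. -/
def potDeriv (A B : ℂ[X]) (z : ℂ) : ℂ := (A.eval z + B.derivative.eval z) / B.eval z

/-- `A` and `B` are reduced: every common zero is a simple zero of `B`. -/
def Reduced (A B : ℂ[X]) : Prop :=
  ∀ c : ℂ, A.eval c = 0 → B.eval c = 0 → B.rootMultiplicity c = 1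

/-- The hard edges: the common zeros of `B` and `A + B'`
(zeros of `B` at which `V'` is regular). -/
def hardEdges (A B : ℂ[X]) : Finset ℂ :=
  B.roots.toFinset.filter fun c => (A + B.derivative).eval c = 0

/-- `W` is a holomorphic branch of `exp (-V)` on the open set `D`, on which `V'` has no poles:
`W` has no zeros on `D` and `W' = -V' W`.  (`D` plays the role of the complex plane without the
zeros of `B` and without the cuts.) -/
structure IsWeight (A B : ℂ[X]) (D : Set ℂ) (W : ℂ → ℂ) : Prop where
  isOpen : IsOpen D
  eval_ne_zero : ∀ z ∈ D, B.eval z ≠ 0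
  ne_zero : ∀ z ∈ D, W z ≠ 0
  hasDerivAt : ∀ z ∈ D, HasDerivAt W (-(potDeriv A B z) * W z) z

/-- The end of the path `γ` along the filter `l` (`atBot` or `atTop`) is an admissible end for the
weight `W = exp (-V)`.  There are three possibilities.
* `γ` goes to infinity inside a sector in which `Re V → +∞`.  Since `V' ~ v z ^ d` at infinity, with
  `d = deg A - deg B`, this means that `W` decays like `exp (-δ |z| ^ (d + 1))`.
* `γ` goes to a multiple zero `b` of `B` (an essential singularity of `W`) inside a sector
  in which `Re V → +∞`.  If `m + 1` is the multiplicity of `b`, then `V` has a pole of order `m`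
  at `b`, and this means that `W` decays like `exp (-δ / |z - b| ^ m)`.
* `γ` goes to a simple zero `c` of `B` at which `W` behaves like `(z - c) ^ k`, `k = 0, 1, 2, …`,
  i.e. `V'` has residue `-k` at `c`; for `k = 0` the point `c` is a hard edge. -/
def IsAdmissibleEnd (A B : ℂ[X]) (W : ℂ → ℂ) (γ : ℝ → ℂ) (l : Filter ℝ) : Prop :=
  (Tendsto (fun t => ‖γ t‖) l atTop ∧ ∃ δ : ℝ, 0 < δ ∧
      (fun t => W (γ t)) =O[l]
        fun t => Real.exp (-δ * ‖γ t‖ ^ (A.natDegree - B.natDegree + 1))) ∨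
  (∃ b : ℂ, 2 ≤ B.rootMultiplicity b ∧ Tendsto γ l (𝓝 b) ∧ ∃ δ : ℝ, 0 < δ ∧
      (fun t => W (γ t)) =O[l]
        fun t => Real.exp (-δ / ‖γ t - b‖ ^ (B.rootMultiplicity b - 1))) ∨
  (∃ c : ℂ, B.rootMultiplicity c = 1 ∧ Tendsto γ l (𝓝 c) ∧ ∃ k : ℕ,
      (A + B.derivative).eval c = -(k : ℂ) * B.derivative.eval c)

/-- Admissible contours for the weight `W = exp (-V)` on `D`, parametrized by the real line
(corners may be parametrized with vanishing velocity): `C¹` paths in `D`, whose arc length grows at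
most polynomially, which are either closed loops in `D` (such as a small circle around
a pole of `W`) or have an admissible end on both sides (lassos, petals, stems, the rays that issue
from a hard edge or from a zero of `W`, paths joining two sectors at infinity, segments between
two hard edges). -/
structure IsAdmissible (A B : ℂ[X]) (D : Set ℂ) (W : ℂ → ℂ) (γ : ℝ → ℂ) : Prop where
  contDiff : ContDiff ℝ 1 γ
  mem : ∀ t, γ t ∈ D
  length : ∃ N : ℕ, Integrable fun t => ‖deriv γ t‖ / (1 + ‖γ t‖) ^ N
  ends : (∃ z ∈ D, Tendsto γ atBot (𝓝 z) ∧ Tendsto γ atTop (𝓝 z)) ∨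
    (IsAdmissibleEnd A B W γ atBot ∧ IsAdmissibleEnd A B W γ atTop)

/-- The data attached to one of the two variables: a reduced pair of polynomials `(A, B)` with
`deg A ≥ deg B + 1`, a branch `W` of `exp (-V)`, `V' = (A + B') / B`, on an open set `D`, and
`deg A` admissible contours in `D`. -/
structure ContourSystem where
  A : ℂ[X]
  B : ℂ[X]
  B_ne_zero : B ≠ 0
  degree_le : B.natDegree + 1 ≤ A.natDegree
  reduced : Reduced A B
  D : Set ℂ
  W : ℂ → ℂ
  isWeight : IsWeight A B D W
  Γ : Fin A.natDegree → ℝ → ℂ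
  admissible : ∀ ν, IsAdmissible A B D W (Γ ν)

namespace ContourSystem

/-- The number `d = deg A` of contours. -/
abbrev d (X : ContourSystem) : ℕ := X.A.natDegree

/-- The derivative `V' = (A + B') / B` of the potential. -/
def dV (X : ContourSystem) (z : ℂ) : ℂ := potDeriv X.A X.B z

/-- The weighted contour integral `∫_{Γ_ν} g(z) exp (-V(z)) dz`. -/
def integral (X : ContourSystem) (ν : Fin X.d) (g : ℂ → ℂ) : ℂ :=
  ∫ t : ℝ, g (X.Γ ν t) * X.W (X.Γ ν t) * deriv (X.Γ ν) t

/-- The union of the contours together with their finite end points. -/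
def support (X : ContourSystem) : Set ℂ := closure (⋃ ν, Set.range (X.Γ ν))

end ContourSystem

section Functional

variable (X Y : ContourSystem) (κ : Fin X.d → Fin Y.d → ℂ)

/-- The density `exp (x y - V₁(x) - V₂(y)) dx dy` on `Γ_{x,μ} × Γ_{y,ν}`, pulled back to `ℝ × ℝ`. -/
def density (μ : Fin X.d) (ν : Fin Y.d) (q : ℝ × ℝ) : ℂ :=
  Complex.exp (X.Γ μ q.1 * Y.Γ ν q.2) *
    (X.W (X.Γ μ q.1) * deriv (X.Γ μ) q.1) * (Y.W (Y.Γ ν q.2) * deriv (Y.Γ ν) q.2)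

/-- All the bimoments converge absolutely on the pairs of contours with nonzero coefficient. -/
def MomentsConverge : Prop :=
  ∀ μ ν, κ μ ν ≠ 0 → ∀ i j : ℕ,
    Integrable fun q : ℝ × ℝ => X.Γ μ q.1 ^ i * Y.Γ ν q.2 ^ j * density X Y μ ν q

/-- The double integral
`∑_{μ,ν} κ_{μν} ∫_{Γ_{x,μ}} ∫_{Γ_{y,ν}} f(x) g(y) exp (x y - V₁(x) - V₂(y)) dx dy`,
for functions `f` and `g`. -/
def pairing (f g : ℂ → ℂ) : ℂ :=
  ∑ μ, ∑ ν, κ μ ν * ∫ q : ℝ × ℝ, f (X.Γ μ q.1) * g (Y.Γ ν q.2) * density X Y μ ν q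

/-- The bilinear moment functional `𝓛(p | s)`. -/
def bimoment (p s : ℂ[X]) : ℂ := pairing X Y κ (fun x => p.eval x) (fun y => s.eval y)

/-- The associated functional `𝓛̂(p | s) = 𝓛(p | B₂ s)`. -/
def bimomentHat (p s : ℂ[X]) : ℂ := bimoment X Y κ p (Y.B * s)

end Functional

/-- `p` and `s` are sequences of biorthonormal polynomials for the functional `L`:
`deg p_n = deg s_n = n` and `L(p_n | s_m) = δ_{nm}`. -/
structure IsBiorthonormal (L : ℂ[X] → ℂ[X] → ℂ) (p s : ℕ → ℂ[X]) : Prop where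
  degree_left : ∀ n, (p n).degree = n
  degree_right : ∀ n, (s n).degree = n
  orthonormal : ∀ n m, L (p n) (s m) = if n = m then 1 else 0

/-- A functional with chosen biorthogonal polynomials.
* `p n = π_n / √h_n`, `s n = σ_n / √h_n`, with `π_n`, `σ_n` the monic biorthogonal polynomials
  of `𝓛` (`p n` and `s n` have the same leading coefficient `1 / √h_n`);
* `ph n`, `sh n` are the biorthonormal polynomials of `𝓛̂`, normalized so that `ph n` has the same
  leading coefficient as `p n`. -/
structure BOPs (X Y : ContourSystem) (κ : Fin X.d → Fin Y.d → ℂ) where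
  p : ℕ → ℂ[X]
  s : ℕ → ℂ[X]
  ph : ℕ → ℂ[X]
  sh : ℕ → ℂ[X]
  biorth : IsBiorthonormal (bimoment X Y κ) p s
  leadingCoeff_eq : ∀ n, (p n).leadingCoeff = (s n).leadingCoeff
  biorthHat : IsBiorthonormal (bimomentHat X Y κ) ph sh
  leadingCoeffHat_eq : ∀ n, (ph n).leadingCoeff = (p n).leadingCoeff

namespace BOPs

variable {X Y : ContourSystem} {κ : Fin X.d → Fin Y.d → ℂ} (𝔅 : BOPs X Y κ)

/-- `P_{jk} = 𝓛(p_j | y s_k)`. -/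
def P (j k : ℕ) : ℂ := bimoment X Y κ (𝔅.p j) (Polynomial.X * 𝔅.s k)

/-- The strictly lower triangular matrix `L̂`, `L̂_{kn} = ℓ̂_{k-n}(k)` for `n < k`: the
coefficient of `s_k` in the expansion `B₂ ŝ_n = s_n + ∑_{j ≥ 1} ℓ̂_j(n+j) s_{n+j}`. -/
def Lhat (k n : ℕ) : ℂ := if n < k then bimoment X Y κ (𝔅.p k) (Y.B * 𝔅.sh n) else 0

/-- The lower Hessenberg matrix `Â`, `Â_{kn} = α̂_{k-n}(k)`: the coefficient of `s_k` in
`-(∂_y - V₂') (B₂ ŝ_n) = A₂ ŝ_n - B₂ ŝ_n' = ∑_{j ≥ -1} α̂_j(n+j) s_{n+j}`. -/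
def Ahat (k n : ℕ) : ℂ :=
  bimoment X Y κ (𝔅.p k) (Y.A * 𝔅.sh n - Y.B * (𝔅.sh n).derivative)

/-- The dual wave functions of the second kind (row `0`):
`e^{V₁(x)} ∫∫_κ e^{ξ y - V₁(ξ)} s_m(y) e^{-V₂(y)} / (x - ξ) dξ dy`. -/
def phiZero (m : ℕ) (x : ℂ) : ℂ :=
  (X.W x)⁻¹ * pairing X Y κ (fun ξ => (x - ξ)⁻¹) (fun y => (𝔅.s m).eval y)

/-- The Fourier-Laplace transforms (rows `1, …, d₂`): `∫_{Γ_{y,ν}} e^{x y} s_m(y) e^{-V₂(y)} dy`. -/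
def phi (ν : Fin Y.d) (m : ℕ) (x : ℂ) : ℂ :=
  Y.integral ν fun y => Complex.exp (x * y) * (𝔅.s m).eval y

/-- `∑_ν κ_{μν} ∫_{Γ_{y,ν}} e^{x y} s_m(y) e^{-V₂(y)} dy`. -/
def phiKappa (μ : Fin X.d) (m : ℕ) (x : ℂ) : ℂ := ∑ ν, κ μ ν * 𝔅.phi ν m x

/-- The dual fundamental system of size `d₂ + 1`: the rows are the windows
`[φ_{n-1}, …, φ_{n+d₂-1}]` of the dual wave vectors (used for `n ≥ 1`). -/
def Phi (n : ℕ) (x : ℂ) : Matrix (Fin (Y.d + 1)) (Fin (Y.d + 1)) ℂ :=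
  Matrix.of fun r b => Fin.cases (𝔅.phiZero (n - 1 + b) x) (fun ν => 𝔅.phi ν (n - 1 + b) x) r

/-- The entrywise derivative of the dual fundamental system. -/
def dPhi (n : ℕ) (x : ℂ) : Matrix (Fin (Y.d + 1)) (Fin (Y.d + 1)) ℂ :=
  Matrix.of fun r b => deriv (fun z => 𝔅.Phi n z r b) x

/-- The dual ladder matrix `a_n(x)`, for which `Φ_n = Φ_{n+1} a_n`: the upper shift plus a first
column with entries `(x ℓ̂_a(n+a) - α̂_a(n+a)) / α̂_{-1}(n-1)`, `a = 0, …, d₂`, `ℓ̂_0 = 1`. -/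
def ladder (n : ℕ) (x : ℂ) : Matrix (Fin (Y.d + 1)) (Fin (Y.d + 1)) ℂ :=
  Matrix.of fun a b =>
    (if (b : ℕ) = a + 1 then 1 else 0) +
      if (b : ℕ) = 0 then
        (x * (if (a : ℕ) = 0 then 1 else 𝔅.Lhat (n + a) n) - 𝔅.Ahat (n + a) n) / 𝔅.Ahat (n - 1) n
      else 0

/-- The Christoffel-Darboux matrix: the block of the commutator `[Â - x L̂, Π_n]` with rows
`n - 1, …, n + d₂ - 1` and columns `n - d₂, …, n`, where `Π_n` is the projector on the first `n`
basis vectors.  Columns with a negative index vanish. -/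
def cdMatrix (n : ℕ) (x : ℂ) : Matrix (Fin (Y.d + 1)) (Fin (Y.d + 1)) ℂ :=
  Matrix.of fun a b =>
    if n + b < Y.d then 0 else
      (𝔅.Ahat (n - 1 + a) (n + b - Y.d) - x * 𝔅.Lhat (n - 1 + a) (n + b - Y.d)) *
        ((if n + b - Y.d < n then 1 else 0) - (if n - 1 + (a : ℕ) < n then 1 else 0))

/-- The window `p̂_{n-d₂}, …, p̂_n`, with `p̂_k = 0` for negative `k`. -/
def hatWindow (n : ℕ) (a : Fin (Y.d + 1)) : ℂ[X] :=
  if n + a < Y.d then 0 else 𝔅.ph (n + a - Y.d)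

/-- The value of `p̂_{n-d₂+a}(ρ) e^{-V₁(ρ)} φ^{(κ)}_{n-1+b}(ρ) / (x - ρ)` at the end of the contour
`Γ_{x,μ}` along `l`; it is the limit along the contour, and vanishes unless that end is
a hard edge. -/
def endValue (n : ℕ) (x : ℂ) (μ : Fin X.d) (l : Filter ℝ) (a b : Fin (Y.d + 1)) : ℂ :=
  open Classical in
  ∑ c ∈ hardEdges X.A X.B,
    if Tendsto (X.Γ μ) l (𝓝 c) then
      (𝔅.hatWindow n a).eval c * limUnder l (fun t => X.W (X.Γ μ t)) *
        𝔅.phiKappa μ (n - 1 + b) c / (x - c)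
    else 0

/-- The hard-edge boundary terms `[Ψ̂_n(ρ) Φ_n^{(κ)}(ρ) / (x - ρ)]_{ρ ∈ ∂_x κ}`. -/
def boundary (n : ℕ) (x : ℂ) : Matrix (Fin (Y.d + 1)) (Fin (Y.d + 1)) ℂ :=
  Matrix.of fun a b => ∑ μ, (𝔅.endValue n x μ atTop a b - 𝔅.endValue n x μ atBot a b)

/-- `W_{ab}(x) = 𝓛(p̂_{n-d₂+a}(ρ) (V₁'(ρ) - V₁'(x)) / (ρ - x) | s_{n-1+b}(y))`. -/
def potMatrix (n : ℕ) (x : ℂ) : Matrix (Fin (Y.d + 1)) (Fin (Y.d + 1)) ℂ :=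
  Matrix.of fun a b =>
    pairing X Y κ (fun ρ => (𝔅.hatWindow n a).eval ρ * ((X.dV ρ - X.dV x) / (ρ - x)))
      (fun y => (𝔅.s (n - 1 + b)).eval y)

/-- The matrix with first row `(V₁'(x), 0, …, 0)` and with the rows
`(P_{j,n-1}, …, P_{j,n+d₂-1})`, `j = n, …, n + d₂ - 1`, below it. -/
def leadMatrix (n : ℕ) (x : ℂ) : Matrix (Fin (Y.d + 1)) (Fin (Y.d + 1)) ℂ :=
  Matrix.of fun a b =>
    if (a : ℕ) = 0 then (if (b : ℕ) = 0 then X.dV x else 0) else 𝔅.P (n - 1 + a) (n - 1 + b)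

/-- The coefficient matrix of the differential equation. -/
def coeffMatrix (n : ℕ) (x : ℂ) : Matrix (Fin (Y.d + 1)) (Fin (Y.d + 1)) ℂ :=
  𝔅.leadMatrix n x +
    (𝔅.ladder n x)⁻¹ * Matrix.diagonal (fun b : Fin (Y.d + 1) => 𝔅.P (n + Y.d) (n - 1 + b)) +
    𝔅.cdMatrix n x * 𝔅.boundary n x - 𝔅.cdMatrix n x * 𝔅.potMatrix n x

end BOPs

end SemiBOP

end

noncomputable section

namespace SemiBOP

/-! ### Hard edges and the reduced denominator -/

/-! All rows of the fundamental system are values Λ(s_m) of linear functionals Λ of the second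
polynomial. Integration by parts in y gives Λ(A₂t - B₂t') = xΛ(B₂t) for the Fourier-Laplace
transforms: the factor B₂ removes the boundary terms at the finite ends. For the Cauchy-type
functional, ξ/(x-ξ) = x/(x-ξ) - 1 adds the term -ε𝓛(1|B₂t) with ε = e^{V₁(x)}. `IsRow` keeps ε as a
parameter, so one computation serves every row.

Applied to t = ŝ_l, this is a recurrence for the numbers Λ(s_k) with the banded matrix Â - xL̂. The
same matrix, acting on the p̂_l, gives (ξ-x)p_k. Its two outer diagonals are nonzero and free of x,
hence the ladder matrix is invertible for every x. Evaluating the commutator with Π_n from both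
sides gives `christoffel_darboux`: the window of Λ times the block 𝔸 times the window of the p̂
equals -ε + (x-ξ)K(ξ), where K = ∑_{j<n} Λ(s_j)p_j.

Differentiating a transform in x means applying it to y s_m; for the Cauchy row a correction
proportional to ε appears. Expand y s_m = ∑_j P_{jm}s_j. The terms with j ≥ n lie in the window, or
one place beyond it, where the inverse ladder reaches. The terms with j < n add up to 𝓛(K|y s_m),
which integration by parts in x turns into hard-edge terms plus 𝓛(KV₁'|s_m). Splitting V₁'(ρ) into
V₁'(x) and the difference, and replacing (x-ρ)K(ρ) by Christoffel-Darboux, produces 𝔸ℰ - 𝔸W and the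
entry V₁'(x). This is `row_X_mul`; its terms in ε are exactly the correction in
`hasDerivAt_cauchyRow`.

The analytic difficulty is that V₁' can have poles at ends of contours. After cancelling the hard
edges, V₁' = Q/S, and the weight divided by S stays bounded at every finite end. This leads to the
class `Tempered`, whose members pair absolutely with polynomials by `integrable_mul_density`.

A left null vector of the system is a functional vanishing on a window, hence on all s_k by the
ladder. Then its ε vanishes, and the remaining combination of transforms has zero Taylor series at
x, against linear independence. Rationality holds because S(x)(V₁'(ρ)-V₁'(x))/(ρ-x) is polynomial in
x. -/

/-- The monic polynomial whose simple roots are the hard edges. -/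
def hardPart (A B : ℂ[X]) : ℂ[X] := ∏ c ∈ hardEdges A B, (X - C c)

/-- The denominator of `V'` after cancelling the hard edges. -/
def softDen (A B : ℂ[X]) : ℂ[X] := B / hardPart A B

/-- The numerator of `V'` after cancelling the hard edges. -/
def softNum (A B : ℂ[X]) : ℂ[X] := (A + B.derivative) / hardPart A B

theorem mem_hardEdges {A B : ℂ[X]} (hB : B ≠ 0) {c : ℂ} :
    c ∈ hardEdges A B ↔ B.eval c = 0 ∧ (A + B.derivative).eval c = 0 := by
  simp [hardEdges, hB]

theorem hardPart_ne_zero (A B : ℂ[X]) : hardPart A B ≠ 0 :=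
  Finset.prod_ne_zero_iff.2 fun c _ => X_sub_C_ne_zero c

theorem hardPart_dvd {A B F : ℂ[X]} (h : ∀ c ∈ hardEdges A B, F.eval c = 0) :
    hardPart A B ∣ F :=
  Finset.prod_dvd_of_coprime
    (fun _ _ _ _ hab => pairwise_coprime_X_sub_C Function.injective_id hab)
    fun c hc => dvd_iff_isRoot.2 (h c hc)

theorem hardPart_mul_softDen {A B : ℂ[X]} (hB : B ≠ 0) : hardPart A B * softDen A B = B :=
  EuclideanDomain.mul_div_cancel' (hardPart_ne_zero A B)
    (hardPart_dvd fun _ hc => ((mem_hardEdges hB).1 hc).1)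

theorem hardPart_mul_softNum {A B : ℂ[X]} (hB : B ≠ 0) :
    hardPart A B * softNum A B = A + B.derivative :=
  EuclideanDomain.mul_div_cancel' (hardPart_ne_zero A B)
    (hardPart_dvd fun _ hc => ((mem_hardEdges hB).1 hc).2)

theorem softDen_ne_zero {A B : ℂ[X]} (hB : B ≠ 0) : softDen A B ≠ 0 := by
  intro h
  have := hardPart_mul_softDen (A := A) hB
  rw [h, mul_zero] at this
  exact hB this.symm

theorem softDen_eval_ne_zero {A B : ℂ[X]} (hB : B ≠ 0) {z : ℂ} (hz : B.eval z ≠ 0) :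
    (softDen A B).eval z ≠ 0 := by
  intro h
  apply hz
  rw [← hardPart_mul_softDen (A := A) hB, eval_mul, h, mul_zero]

theorem hardPart_eval_ne_zero {A B : ℂ[X]} (hB : B ≠ 0) {z : ℂ} (hz : B.eval z ≠ 0) :
    (hardPart A B).eval z ≠ 0 := by
  intro h
  apply hz
  rw [← hardPart_mul_softDen (A := A) hB, eval_mul, h, zero_mul]

theorem potDeriv_eq {A B : ℂ[X]} (hB : B ≠ 0) {z : ℂ} (hz : B.eval z ≠ 0) :
    potDeriv A B z = (softNum A B).eval z / (softDen A B).eval z := by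
  have h1 := hardPart_eval_ne_zero (A := A) hB hz
  rw [potDeriv, ← eval_add, ← hardPart_mul_softNum (A := A) hB, eval_mul]
  nth_rewrite 3 [← hardPart_mul_softDen (A := A) hB]
  rw [eval_mul, mul_div_mul_left _ _ h1]

theorem rootMultiplicity_eq_add {A B : ℂ[X]} (hB : B ≠ 0) (c : ℂ) :
    B.rootMultiplicity c =
      (hardPart A B).rootMultiplicity c + (softDen A B).rootMultiplicity c := by
  conv_lhs => rw [← hardPart_mul_softDen (A := A) hB]
  exact rootMultiplicity_mul (by rwa [hardPart_mul_softDen hB])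

/-- For k = 0 the point is a hard edge, so `hardPart` uses up the whole multiplicity 1; for k ≥ 1
that multiplicity is already at most k. Hence a weight of order (z - c)^k can be divided by
`softDen`. -/
theorem softDen_rootMultiplicity_le {A B : ℂ[X]} (hB : B ≠ 0) {c : ℂ}
    (hc : B.rootMultiplicity c = 1) {k : ℕ}
    (hk : (A + B.derivative).eval c = -(k : ℂ) * B.derivative.eval c) :
    (softDen A B).rootMultiplicity c ≤ k := by
  have h := rootMultiplicity_eq_add (A := A) hB c
  rcases Nat.eq_zero_or_pos k with rfl | hpos
  · have hroot : B.eval c = 0 := (rootMultiplicity_pos hB).1 (by omega)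
    have hmem : c ∈ hardEdges A B := (mem_hardEdges hB).2 ⟨hroot, by simpa using hk⟩
    have : 0 < (hardPart A B).rootMultiplicity c := by
      refine (rootMultiplicity_pos (hardPart_ne_zero A B)).2 ?_
      rw [IsRoot, hardPart, eval_prod]
      exact Finset.prod_eq_zero hmem (by simp)
    omega
  · omega

theorem exists_pow_rootMultiplicity_le {S : ℂ[X]} (hS : S ≠ 0) (b : ℂ) :
    ∃ K : ℝ, 0 < K ∧ ∀ᶠ z in 𝓝 b, ‖z - b‖ ^ S.rootMultiplicity b ≤ K * ‖S.eval z‖ := by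
  obtain ⟨T, hT, hdvd⟩ := exists_eq_pow_rootMultiplicity_mul_and_not_dvd S hS b
  have hTb : T.eval b ≠ 0 := fun h => hdvd (dvd_iff_isRoot.2 h)
  have hpos : 0 < ‖T.eval b‖ := norm_pos_iff.2 hTb
  -- Near b the cofactor T has at least half its modulus at b.
  refine ⟨2 / ‖T.eval b‖, by positivity, ?_⟩
  have hc : Tendsto (fun z => ‖T.eval z‖) (𝓝 b) (𝓝 ‖T.eval b‖) :=
    (T.continuous.norm).tendsto b
  filter_upwards [hc.eventually (lt_mem_nhds (half_lt_self hpos))] with z hz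
  conv_rhs => rw [hT]
  rw [eval_mul, eval_pow, eval_sub, eval_X, eval_C, norm_mul, norm_pow]
  have h1 : (1 : ℝ) ≤ 2 / ‖T.eval b‖ * ‖T.eval z‖ := by
    rw [div_mul_eq_mul_div, le_div_iff₀ hpos]; linarith
  nlinarith [pow_nonneg (norm_nonneg (z - b)) (S.rootMultiplicity b)]

theorem exists_one_le_mul_norm_eval {S : ℂ[X]} (hS : S ≠ 0) {α : Type*} {l : Filter α} {γ : α → ℂ}
    (hγ : Tendsto (fun t => ‖γ t‖) l atTop) :
    ∃ K : ℝ, 0 < K ∧ ∀ᶠ t in l, 1 ≤ K * ‖S.eval (γ t)‖ := by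
  by_cases hd : 0 < S.degree
  · exact ⟨1, one_pos, by simpa using (S.tendsto_norm_atTop hd hγ).eventually_ge_atTop 1⟩
  · rw [not_lt] at hd
    rw [eq_C_of_degree_le_zero hd]
    have h0 : S.coeff 0 ≠ 0 := fun h => hS (by rw [eq_C_of_degree_le_zero hd, h, C_0])
    refine ⟨‖S.coeff 0‖⁻¹, by positivity, Eventually.of_forall fun t => ?_⟩
    rw [eval_C, inv_mul_cancel₀ (norm_ne_zero_iff.2 h0)]

/-! ### Paths and weights -/

/-- The ends of the real line. -/
def IsEnd (l : Filter ℝ) : Prop := l = atBot ∨ l = atTop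

theorem IsEnd.neBot {l : Filter ℝ} (hl : IsEnd l) : l.NeBot := by
  rcases hl with rfl | rfl <;> infer_instance

/-- A neighbourhood of an end contains an open connected one, on which a vanishing derivative forces
constancy. -/
theorem IsEnd.exists_interval {l : Filter ℝ} (hl : IsEnd l) {s : Set ℝ} (hs : s ∈ l) :
    ∃ u ∈ l, u ⊆ s ∧ IsOpen u ∧ IsPreconnected u := by
  rcases hl with rfl | rfl
  · obtain ⟨a, ha⟩ := mem_atBot_sets.1 hs
    exact ⟨Set.Iio a, Iio_mem_atBot a, fun t ht => ha t (le_of_lt ht), isOpen_Iio,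
      isPreconnected_Iio⟩
  · obtain ⟨a, ha⟩ := mem_atTop_sets.1 hs
    exact ⟨Set.Ioi a, Ioi_mem_atTop a, fun t ht => ha t (le_of_lt ht), isOpen_Ioi,
      isPreconnected_Ioi⟩

theorem exists_tendsto_of_integrable_deriv {l : Filter ℝ} (hl : IsEnd l) {F F' : ℝ → ℂ}
    (hF : ∀ t, HasDerivAt F (F' t) t) {u : Set ℝ} (hu : u ∈ l) (hF' : IntegrableOn F' u) :
    ∃ w, Tendsto F l (𝓝 w) := by
  rcases hl with rfl | rfl
  · obtain ⟨a, ha⟩ := mem_atBot_sets.1 hu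
    exact ⟨_, tendsto_limUnder_of_hasDerivAt_of_integrableOn_Iic (a := a) (fun t _ => hF t)
      (hF'.mono_set fun t ht => ha t ht)⟩
  · obtain ⟨a, ha⟩ := mem_atTop_sets.1 hu
    exact ⟨_, tendsto_limUnder_of_hasDerivAt_of_integrableOn_Ioi (a := a) (fun t _ => hF t)
      (hF'.mono_set fun t ht => ha t (le_of_lt ht))⟩

/-- A function with integrable derivative, which is integrable along a path that goes to infinity,
vanishes at infinity along the path. -/
theorem tendsto_zero_of_integrable {l : Filter ℝ} (hl : IsEnd l) {F F' γ : ℝ → ℂ}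
    (hγ : ContDiff ℝ 1 γ) (hF : ∀ t, HasDerivAt F (F' t) t) (hF' : Integrable F')
    (hint : Integrable fun t => F t * deriv γ t)
    (hinf : Tendsto (fun t => ‖γ t‖) l atTop) : Tendsto F l (𝓝 0) := by
  have := hl.neBot
  obtain ⟨w, hw⟩ := exists_tendsto_of_integrable_deriv hl hF univ_mem hF'.integrableOn
  by_cases hw0 : w = 0
  · rwa [hw0] at hw
  exfalso
  have hpos : 0 < ‖w‖ := norm_pos_iff.2 hw0
  have hev : ∀ᶠ t in l, ‖w‖ / 2 < ‖F t‖ := hw.norm.eventually (lt_mem_nhds (half_lt_self hpos))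
  obtain ⟨u, hu, hus, huo, -⟩ := hl.exists_interval hev
  -- If the limit w were nonzero, |γ'| would be at most (2/|w|)|F γ'| near the end. The path would
  -- have finite length there and would converge, although it goes to infinity.
  have hdγ : Continuous (deriv γ) := hγ.continuous_deriv le_rfl
  have hγint : IntegrableOn (deriv γ) u := by
    refine Integrable.mono' ((hint.norm.const_mul (2 / ‖w‖)).integrableOn)
      hdγ.aestronglyMeasurable ?_
    filter_upwards [ae_restrict_mem huo.measurableSet] with t ht
    have h1 : (1 : ℝ) ≤ 2 / ‖w‖ * ‖F t‖ := by
      have : ‖w‖ / 2 < ‖F t‖ := hus ht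
      rw [div_mul_eq_mul_div, le_div_iff₀ hpos]; linarith
    rw [norm_mul, ← mul_assoc]
    exact le_mul_of_one_le_left (norm_nonneg _) h1
  obtain ⟨z, hz⟩ := exists_tendsto_of_integrable_deriv hl
    (fun t => ((hγ.differentiable one_ne_zero) t).hasDerivAt) hu hγint
  exact not_tendsto_nhds_of_tendsto_atTop hinf _ hz.norm

section Weight

variable {A B : ℂ[X]} {D : Set ℂ} {W : ℂ → ℂ} {γ : ℝ → ℂ}

theorem IsWeight.continuousAt (hW : IsWeight A B D W) {z : ℂ} (hz : z ∈ D) : ContinuousAt W z :=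
  (hW.hasDerivAt z hz).continuousAt

theorem IsAdmissible.continuous (hγ : IsAdmissible A B D W γ) : Continuous γ :=
  hγ.contDiff.continuous

theorem IsAdmissible.continuous_deriv (hγ : IsAdmissible A B D W γ) : Continuous (deriv γ) :=
  hγ.contDiff.continuous_deriv le_rfl

theorem IsAdmissible.hasDerivAt (hγ : IsAdmissible A B D W γ) (t : ℝ) :
    HasDerivAt γ (deriv γ t) t :=
  ((hγ.contDiff.differentiable one_ne_zero) t).hasDerivAt

theorem IsAdmissible.continuous_weight (hγ : IsAdmissible A B D W γ) (hW : IsWeight A B D W) :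
    Continuous fun t => W (γ t) :=
  continuous_iff_continuousAt.2 fun t =>
    (hW.continuousAt (hγ.mem t)).comp hγ.continuous.continuousAt

theorem IsAdmissible.hasDerivAt_weight (hγ : IsAdmissible A B D W γ) (hW : IsWeight A B D W)
    (t : ℝ) : HasDerivAt (fun t => W (γ t)) (-(potDeriv A B (γ t)) * W (γ t) * deriv γ t) t :=
  (hW.hasDerivAt _ (hγ.mem t)).comp t (hγ.hasDerivAt t)

/-- Along a path that ends at a simple zero `c` of `B` at which `V'` has residue `-k`, the weight
behaves like a multiple of `(z - c) ^ k`. -/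
theorem exists_tendsto_weight_div_pow {l : Filter ℝ} (hl : IsEnd l) (hB : B ≠ 0)
    (hW : IsWeight A B D W) (hγ : IsAdmissible A B D W γ) {c : ℂ} (hc : B.rootMultiplicity c = 1)
    {k : ℕ} (hk : (A + B.derivative).eval c = -(k : ℂ) * B.derivative.eval c)
    (hlim : Tendsto γ l (𝓝 c)) :
    ∃ w, Tendsto (fun t => W (γ t) / (γ t - c) ^ k) l (𝓝 w) := by
  obtain ⟨T, hT, hdvd⟩ := exists_eq_pow_rootMultiplicity_mul_and_not_dvd B hB c
  rw [hc, pow_one] at hT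
  have hTc : T.eval c ≠ 0 := fun h => hdvd (dvd_iff_isRoot.2 h)
  have hB' : B.derivative.eval c = T.eval c := by rw [hT]; simp
  -- Write B = (z - c)T. Since A + B' = -kT at c, the quotient N makes V' + k/(z - c) = N/T
  -- holomorphic near c.
  obtain ⟨N, hN⟩ : X - C c ∣ A + B.derivative + C (k : ℂ) * T := by
    rw [dvd_iff_isRoot, IsRoot, eval_add, hk, hB', eval_mul, eval_C]; ring
  have hTev : ∀ᶠ z in 𝓝 c, T.eval z ≠ 0 := T.continuous.continuousAt.eventually_ne hTc
  obtain ⟨r, hr, hball⟩ := Metric.eventually_nhds_iff_ball.1 hTev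
  have hdiff : DifferentiableOn ℂ (fun z => N.eval z / T.eval z) (Metric.ball c r) :=
    fun z hz => (N.differentiable.differentiableAt.div T.differentiable.differentiableAt
      (hball z hz)).differentiableWithinAt
  -- With a primitive H of N/T on a disc, W (z - c)^(-k) e^H has derivative zero along the path.
  -- Constancy is used only along the path, since `D` need not contain a punctured disc around c.
  obtain ⟨H, hH⟩ := hdiff.isExactOn_ball
  obtain ⟨u, hu, hus, huo, hup⟩ := hl.exists_interval (hlim (Metric.ball_mem_nhds c hr))
  have hne : ∀ t, γ t - c ≠ 0 := fun t h => by
    refine hW.eval_ne_zero _ (hγ.mem t) ?_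
    rw [hT, eval_mul, eval_sub, eval_X, eval_C, h, zero_mul]
  have hder : ∀ t ∈ u, HasDerivAt
      (fun t => W (γ t) / (γ t - c) ^ k * Complex.exp (H (γ t))) 0 t := by
    intro t ht
    have hBt : B.eval (γ t) = (γ t - c) * T.eval (γ t) := by
      conv_lhs => rw [hT]
      simp
    have hTt := hball _ (hus ht)
    have h1 := (hγ.hasDerivAt_weight hW t).div (((hγ.hasDerivAt t).sub_const c).pow k)
      (pow_ne_zero k (hne t))
    have h2 := ((hH _ (hus ht)).comp t (hγ.hasDerivAt t)).cexp
    refine (h1.mul h2).congr_deriv ?_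
    simp only [Pi.pow_apply, Function.comp, Pi.div_apply]
    have hV : potDeriv A B (γ t) = N.eval (γ t) / T.eval (γ t) - k / (γ t - c) := by
      have hNe : A.eval (γ t) + B.derivative.eval (γ t) =
          (γ t - c) * N.eval (γ t) - k * T.eval (γ t) := by
        have := congrArg (fun p => p.eval (γ t)) hN
        simp only [eval_add, eval_mul, eval_sub, eval_X, eval_C] at this
        linear_combination this
      rw [potDeriv, hNe, hBt]
      have := hne t
      field_simp
    rw [hV]
    have hn := hne t
    rcases k with _ | k
    · simp
      ring
    · simp only [Nat.add_sub_cancel]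
      field_simp
      push_cast
      ring
  have := hl.neBot
  obtain ⟨t₀, ht₀⟩ := hl.neBot.nonempty_of_mem hu
  have hconst : ∀ t ∈ u, W (γ t) / (γ t - c) ^ k * Complex.exp (H (γ t)) =
      W (γ t₀) / (γ t₀ - c) ^ k * Complex.exp (H (γ t₀)) := fun t ht =>
    huo.is_const_of_deriv_eq_zero hup
      (fun t ht => (hder t ht).differentiableAt.differentiableWithinAt)
      (fun t ht => (hder t ht).deriv) ht ht₀
  have hHc : ContinuousAt H c := (hH c (Metric.mem_ball_self hr)).continuousAt
  have hlim2 : Tendsto (fun t => W (γ t₀) / (γ t₀ - c) ^ k * Complex.exp (H (γ t₀)) *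
      Complex.exp (-H (γ t))) l
      (𝓝 (W (γ t₀) / (γ t₀ - c) ^ k * Complex.exp (H (γ t₀)) * Complex.exp (-H c))) :=
    ((Complex.continuous_exp.tendsto _).comp ((hHc.tendsto.comp hlim).neg)).const_mul _
  refine ⟨_, hlim2.congr' ?_⟩
  filter_upwards [hu] with t ht
  rw [← hconst t ht, mul_assoc, ← Complex.exp_add, add_neg_cancel, Complex.exp_zero, mul_one]

end Weight

theorem exists_bound_of_isBigO {f : ℝ → ℂ} {g : ℝ → ℝ} (hf : Continuous f) (hg : Continuous g)
    (hpos : ∀ t, 0 < g t) (hbot : f =O[atBot] g) (htop : f =O[atTop] g) :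
    ∃ K : ℝ, 0 < K ∧ ∀ t, ‖f t‖ ≤ K * g t := by
  obtain ⟨a, ha⟩ := hbot.bound
  obtain ⟨b, hb⟩ := htop.bound
  obtain ⟨p, hp⟩ := eventually_atBot.1 ha
  obtain ⟨q, hq⟩ := eventually_atTop.1 hb
  obtain ⟨m, hm⟩ := (isCompact_Icc (a := p) (b := q)).bddAbove_image
    (f := fun t => ‖f t‖ / g t) (hf.norm.div hg fun t => (hpos t).ne').continuousOn
  -- The two ends give a and b, compactness of the middle gives m, and the 1 makes the constant
  -- positive.
  refine ⟨max (max a b) (max m 1), by positivity, fun t => ?_⟩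
  have hgt := hpos t
  rcases le_or_gt t p with h | h
  · refine (hp t h).trans ?_
    rw [Real.norm_of_nonneg hgt.le]
    gcongr
    exact (le_max_left _ _).trans (le_max_left _ _)
  rcases le_or_gt q t with h' | h'
  · refine (hq t h').trans ?_
    rw [Real.norm_of_nonneg hgt.le]
    gcongr
    exact (le_max_right _ _).trans (le_max_left _ _)
  · have := hm ⟨t, ⟨h.le, h'.le⟩, rfl⟩
    rw [div_le_iff₀ hgt] at this
    refine this.trans ?_
    gcongr
    exact (le_max_left _ _).trans (le_max_right _ _)

/-- From e^u ≥ u^M / M! with u = δ / r^m, followed by r^m ≤ r. The essential singularity thus beats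
every power of the distance. -/
theorem exp_neg_div_pow_le {δ : ℝ} (hδ : 0 < δ) {m : ℕ} (hm : 1 ≤ m) (M : ℕ) {r : ℝ} (hr : 0 < r)
    (hr1 : r ≤ 1) : Real.exp (-δ / r ^ m) ≤ M.factorial / δ ^ M * r ^ M := by
  have h1 := Real.pow_div_factorial_le_exp (δ / r ^ m) (by positivity) M
  have hfac : (0 : ℝ) < M.factorial := by exact_mod_cast M.factorial_pos
  rw [neg_div, Real.exp_neg]
  calc (Real.exp (δ / r ^ m))⁻¹ ≤ ((δ / r ^ m) ^ M / M.factorial)⁻¹ := by gcongr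
    _ = M.factorial / δ ^ M * (r ^ m) ^ M := by rw [div_pow]; field_simp
    _ ≤ M.factorial / δ ^ M * r ^ M := by
      gcongr
      calc r ^ m ≤ r ^ 1 := pow_le_pow_of_le_one hr.le hr1 hm
        _ = r := pow_one r

section Weight

variable {A B : ℂ[X]} {D : Set ℂ} {W : ℂ → ℂ} {γ : ℝ → ℂ}

/-- The end of `γ` along `l` goes to infinity with decaying weight, or converges to a zero of `B`,
at which the weight has a limit that is nonzero only at hard edges. -/
theorem IsAdmissibleEnd.cases {l : Filter ℝ} (hl : IsEnd l) (hB : B ≠ 0) (hW : IsWeight A B D W)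
    (hγ : IsAdmissible A B D W γ) (h : IsAdmissibleEnd A B W γ l) :
    (Tendsto (fun t => ‖γ t‖) l atTop ∧ ∃ δ : ℝ, 0 < δ ∧
      (fun t => W (γ t)) =O[l]
        fun t => Real.exp (-δ * ‖γ t‖ ^ (A.natDegree - B.natDegree + 1))) ∨
    ∃ c w, B.eval c = 0 ∧ Tendsto γ l (𝓝 c) ∧ Tendsto (fun t => W (γ t)) l (𝓝 w) ∧
      (c ∉ hardEdges A B → w = 0) ∧
      (fun t => W (γ t) / (softDen A B).eval (γ t)) =O[l] fun _ => (1 : ℝ) := by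
  have hne : ∀ (c : ℂ), B.eval c = 0 → ∀ t, 0 < ‖γ t - c‖ := fun c hc t => by
    rw [norm_pos_iff, sub_ne_zero]
    rintro rfl
    exact hW.eval_ne_zero _ (hγ.mem t) hc
  rcases h with h | ⟨b, hb, hlim, δ, hδ, hO⟩ | ⟨c, hc, hlim, k, hk⟩
  · exact Or.inl h
  · right
    have hBb : B.eval b = 0 := (rootMultiplicity_pos hB).1 (by omega)
    have hpos := hne b hBb
    obtain ⟨K, hK, hS⟩ := exists_pow_rootMultiplicity_le (softDen_ne_zero (A := A) hB) b
    set M := (softDen A B).rootMultiplicity b with hM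
    have hlim0 : Tendsto (fun t => ‖γ t - b‖) l (𝓝 0) := by
      simpa using (hlim.sub_const b).norm
    have hsmall : ∀ᶠ t in l, ‖γ t - b‖ ≤ 1 := hlim0.eventually_le_const one_pos
    have hWM : ∀ M : ℕ, (fun t => W (γ t)) =O[l] fun t => ‖γ t - b‖ ^ M := fun M => by
      refine hO.trans (Asymptotics.IsBigO.of_bound (M.factorial / δ ^ M) ?_)
      filter_upwards [hsmall] with t ht
      rw [Real.norm_of_nonneg (Real.exp_pos _).le, Real.norm_of_nonneg (by positivity)]
      exact exp_neg_div_pow_le hδ (by omega) M (hpos t) ht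
    refine ⟨b, 0, hBb, hlim, ?_, fun _ => rfl, ?_⟩
    · refine (hWM 1).trans_tendsto ?_
      simpa using hlim0
    · obtain ⟨C₁, hC₁⟩ := (hWM M).bound
      refine Asymptotics.IsBigO.of_bound (|C₁| * K) ?_
      filter_upwards [hC₁, hlim.eventually hS] with t h1 h2
      have hSt : 0 < ‖(softDen A B).eval (γ t)‖ :=
        norm_pos_iff.2 (softDen_eval_ne_zero hB (hW.eval_ne_zero _ (hγ.mem t)))
      rw [norm_one, mul_one, norm_div, div_le_iff₀ hSt]
      rw [Real.norm_of_nonneg (by positivity)] at h1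
      calc ‖W (γ t)‖ ≤ |C₁| * ‖γ t - b‖ ^ M := h1.trans (by gcongr; exact le_abs_self _)
        _ ≤ |C₁| * (K * ‖(softDen A B).eval (γ t)‖) := by gcongr
        _ = _ := by ring
  · right
    have hBc : B.eval c = 0 := (rootMultiplicity_pos hB).1 (by omega)
    have hpos := hne c hBc
    obtain ⟨w, hw⟩ := exists_tendsto_weight_div_pow hl hB hW hγ hc hk hlim
    obtain ⟨K, hK, hS⟩ := exists_pow_rootMultiplicity_le (softDen_ne_zero (A := A) hB) c
    have hMk := softDen_rootMultiplicity_le hB hc hk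
    have hlim0 : Tendsto (fun t => ‖γ t - c‖) l (𝓝 0) := by
      simpa using (hlim.sub_const c).norm
    -- The factor (c - c)^k is 1 for k = 0, the hard edge, and 0 otherwise, so one formula covers
    -- both kinds of simple zero.
    refine ⟨c, w * (c - c) ^ k, hBc, hlim, ?_, ?_, ?_⟩
    · refine (hw.mul ((hlim.sub_const c).pow k)).congr fun t => ?_
      exact div_mul_cancel₀ _ (pow_ne_zero _ (norm_pos_iff.1 (hpos t)))
    · intro hnot
      have : k ≠ 0 := by
        rintro rfl
        exact hnot ((mem_hardEdges hB).2 ⟨hBc, by simpa using hk⟩)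
      simp [this]
    · obtain ⟨C₁, hC₁⟩ := (hw.isBigO_one ℝ).bound
      refine Asymptotics.IsBigO.of_bound (|C₁| * K) ?_
      filter_upwards [hC₁, hlim.eventually hS, hlim0.eventually_le_const one_pos] with t h1 h2 h3
      have hSt : 0 < ‖(softDen A B).eval (γ t)‖ :=
        norm_pos_iff.2 (softDen_eval_ne_zero hB (hW.eval_ne_zero _ (hγ.mem t)))
      have hpt := hpos t
      rw [norm_one, mul_one] at h1
      rw [norm_one, mul_one, norm_div, div_le_iff₀ hSt]
      rw [norm_div, norm_pow, div_le_iff₀ (by positivity)] at h1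
      calc ‖W (γ t)‖ ≤ |C₁| * ‖γ t - c‖ ^ k := h1.trans (by gcongr; exact le_abs_self _)
        _ ≤ |C₁| * ‖γ t - c‖ ^ ((softDen A B).rootMultiplicity c) := by
          gcongr ?_ * ?_
          exact pow_le_pow_of_le_one hpt.le h3 hMk
        _ ≤ |C₁| * (K * ‖(softDen A B).eval (γ t)‖) := by gcongr
        _ = _ := by ring

/-- Both ends of an admissible contour: at infinity, at a zero of `B`, or at the base point of
a loop. -/
theorem IsAdmissible.end_cases {l : Filter ℝ} (hl : IsEnd l) (hB : B ≠ 0) (hW : IsWeight A B D W)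
    (hγ : IsAdmissible A B D W γ) :
    (Tendsto (fun t => ‖γ t‖) l atTop ∧ ∃ δ : ℝ, 0 < δ ∧
      (fun t => W (γ t)) =O[l]
        fun t => Real.exp (-δ * ‖γ t‖ ^ (A.natDegree - B.natDegree + 1))) ∨
    ∃ c w, Tendsto γ l (𝓝 c) ∧ Tendsto (fun t => W (γ t)) l (𝓝 w) ∧
      (fun t => W (γ t) / (softDen A B).eval (γ t)) =O[l] fun _ => (1 : ℝ) := by
  have key : (IsAdmissibleEnd A B W γ l ∨ ∃ z ∈ D, Tendsto γ l (𝓝 z)) := by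
    rcases hγ.ends with ⟨z, hz, h1, h2⟩ | ⟨h1, h2⟩
    · rcases hl with rfl | rfl
      exacts [Or.inr ⟨z, hz, h1⟩, Or.inr ⟨z, hz, h2⟩]
    · rcases hl with rfl | rfl
      exacts [Or.inl h1, Or.inl h2]
  rcases key with h | ⟨z, hz, h⟩
  · rcases h.cases hl hB hW hγ with h | ⟨c, w, -, h1, h2, -, h3⟩
    exacts [Or.inl h, Or.inr ⟨c, w, h1, h2, h3⟩]
  · have hWl := (hW.continuousAt hz).tendsto.comp h
    refine Or.inr ⟨z, W z, h, hWl, ?_⟩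
    exact (hWl.div (((softDen A B).continuous.tendsto z).comp h)
      (softDen_eval_ne_zero hB (hW.eval_ne_zero z hz))).isBigO_one ℝ

/-- A convergent exponent keeps the exponential away from zero, so at a finite end every bounded
function obeys any such bound. -/
theorem isBigO_exp_of_tendsto {l : Filter ℝ} {f : ℝ → ℂ} {u : ℝ → ℝ} {w : ℝ}
    (hf : f =O[l] fun _ => (1 : ℝ)) (hu : Tendsto u l (𝓝 w)) :
    f =O[l] fun t => Real.exp (u t) := by
  refine hf.trans ?_
  have := ((Real.continuous_exp.tendsto _).comp hu.neg).isBigO_one ℝ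
  refine (this.mul (Asymptotics.isBigO_refl (fun t => Real.exp (u t)) l)).congr
    (fun t => ?_) fun t => one_mul _
  simp [← Real.exp_add]

/-- The weight decays at least like `exp (-δ |z| ^ (d + 1))` along an admissible contour. -/
theorem IsAdmissible.exists_norm_weight_le (hB : B ≠ 0) (hW : IsWeight A B D W)
    (hγ : IsAdmissible A B D W γ) :
    ∃ K δ : ℝ, 0 < K ∧ 0 < δ ∧
      ∀ t, ‖W (γ t)‖ ≤ K * Real.exp (-δ * ‖γ t‖ ^ (A.natDegree - B.natDegree + 1)) := by
  have hend : ∀ l, IsEnd l → ∃ δ : ℝ, 0 < δ ∧ ∀ ε, 0 < ε → ε ≤ δ → (fun t => W (γ t)) =O[l]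
      fun t => Real.exp (-ε * ‖γ t‖ ^ (A.natDegree - B.natDegree + 1)) := by
    intro l hl
    rcases hγ.end_cases hl hB hW with ⟨-, δ, hδ, hO⟩ | ⟨c, w, h1, h2, -⟩
    · refine ⟨δ, hδ, fun ε _ hle => hO.trans (Asymptotics.IsBigO.of_bound 1 ?_)⟩
      refine Eventually.of_forall fun t => ?_
      rw [Real.norm_of_nonneg (Real.exp_pos _).le, Real.norm_of_nonneg (Real.exp_pos _).le, one_mul]
      gcongr
    · exact ⟨1, one_pos, fun ε _ _ => isBigO_exp_of_tendsto (h2.isBigO_one ℝ)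
        ((h1.norm.pow _).const_mul _)⟩
  obtain ⟨δ₁, h₁, H₁⟩ := hend _ (Or.inl rfl)
  obtain ⟨δ₂, h₂, H₂⟩ := hend _ (Or.inr rfl)
  have hpos : 0 < min δ₁ δ₂ := lt_min h₁ h₂
  have hc := hγ.continuous
  obtain ⟨K, hK, h⟩ := exists_bound_of_isBigO (hγ.continuous_weight hW)
    (g := fun t => Real.exp (-(min δ₁ δ₂) * ‖γ t‖ ^ (A.natDegree - B.natDegree + 1)))
    (by fun_prop) (fun t => Real.exp_pos _) (H₁ _ hpos (min_le_left _ _))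
    (H₂ _ hpos (min_le_right _ _))
  exact ⟨K, _, hK, hpos, h⟩

/-- The weight divided by the reduced denominator of `V'` is controlled by the weight, up to
a rapidly decaying term. -/
theorem IsAdmissible.exists_norm_weight_div_le (hB : B ≠ 0) (hW : IsWeight A B D W)
    (hγ : IsAdmissible A B D W γ) :
    ∃ K : ℝ, 0 < K ∧ ∀ t, ‖W (γ t) / (softDen A B).eval (γ t)‖ ≤
      K * (‖W (γ t)‖ + Real.exp (-‖γ t‖ ^ 3)) := by
  have hSne : ∀ t, (softDen A B).eval (γ t) ≠ 0 := fun t =>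
    softDen_eval_ne_zero hB (hW.eval_ne_zero _ (hγ.mem t))
  -- At infinity 1/softDen is bounded, so W alone dominates. At a finite end the quotient is bounded
  -- although W may tend to 0, and the exponential term is what dominates it. The cube is chosen so
  -- that this term still beats e^{xy} against Gaussian decay in the other variable.
  have hend : ∀ l, IsEnd l → (fun t => W (γ t) / (softDen A B).eval (γ t)) =O[l]
      fun t => ‖W (γ t)‖ + Real.exp (-‖γ t‖ ^ 3) := by
    intro l hl
    rcases hγ.end_cases hl hB hW with ⟨hinf, -⟩ | ⟨c, w, h1, -, h3⟩
    · obtain ⟨K, hK, hS⟩ := exists_one_le_mul_norm_eval (softDen_ne_zero (A := A) hB) hinf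
      refine Asymptotics.IsBigO.of_bound K ?_
      filter_upwards [hS] with t ht
      have hSt : 0 < ‖(softDen A B).eval (γ t)‖ := norm_pos_iff.2 (hSne t)
      have he := Real.exp_pos (-‖γ t‖ ^ 3)
      rw [Real.norm_of_nonneg (by positivity), norm_div, div_le_iff₀ hSt]
      nlinarith [norm_nonneg (W (γ t)), mul_pos (mul_pos hK hSt) he]
    · refine (isBigO_exp_of_tendsto h3 ((h1.norm.pow 3).neg)).trans
        (Asymptotics.IsBigO.of_bound 1 (Eventually.of_forall fun t => ?_))
      have he := Real.exp_pos (-‖γ t‖ ^ 3)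
      rw [Real.norm_of_nonneg he.le, Real.norm_of_nonneg (by positivity)]
      linarith [norm_nonneg (W (γ t))]
  have hc := hγ.continuous
  have hWc := hγ.continuous_weight hW
  exact exists_bound_of_isBigO (hWc.div ((softDen A B).continuous.comp hc) hSne)
    (hWc.norm.add (by fun_prop)) (fun t => by positivity) (hend _ (Or.inl rfl))
        (hend _ (Or.inr rfl))

end Weight

/-! ### Integrability -/

theorem one_add_pow_le_exp {r : ℝ} (hr : 0 ≤ r) (M : ℕ) :
    (1 + r) ^ M ≤ M.factorial * Real.exp (1 + r) := by
  have := Real.pow_div_factorial_le_exp (1 + r) (by positivity) M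
  rwa [div_le_iff₀ (by exact_mod_cast M.factorial_pos), mul_comm] at this

theorem exists_pow_mul_exp_sq_le {δ : ℝ} (hδ : 0 < δ) (K : ℝ) (M : ℕ) :
    ∃ C : ℝ, 0 < C ∧ ∀ r, 0 ≤ r → (1 + r) ^ M * Real.exp (K * r - δ * r ^ 2) ≤ C := by
  refine ⟨M.factorial * Real.exp (1 + (K + 1) ^ 2 / (4 * δ)),
    mul_pos (by exact_mod_cast M.factorial_pos) (Real.exp_pos _), fun r hr => ?_⟩
  calc (1 + r) ^ M * Real.exp (K * r - δ * r ^ 2)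
      ≤ M.factorial * Real.exp (1 + r) * Real.exp (K * r - δ * r ^ 2) := by
        gcongr; exact one_add_pow_le_exp hr M
    _ = M.factorial * Real.exp (1 + r + (K * r - δ * r ^ 2)) := by rw [mul_assoc, ← Real.exp_add]
    _ ≤ _ := by
      gcongr M.factorial * Real.exp ?_
      -- Completing the square; the 1 added to K pays for the exponential that bounds (1 + r)^M.
      have : (K + 1) * r - δ * r ^ 2 ≤ (K + 1) ^ 2 / (4 * δ) := by
        rw [le_div_iff₀ (by positivity)]
        nlinarith [sq_nonneg (2 * δ * r - (K + 1))]
      linarith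

theorem exists_pow_mul_exp_cube_le {δ : ℝ} (hδ : 0 < δ) (K : ℝ) (M : ℕ) :
    ∃ C : ℝ, 0 < C ∧ ∀ r, 0 ≤ r → (1 + r) ^ M * Real.exp (K * r ^ 2 - δ * r ^ 3) ≤ C := by
  obtain ⟨C, hC, h⟩ := exists_pow_mul_exp_sq_le one_pos 0 M
  refine ⟨C * Real.exp ((|K| + 1) ^ 3 / δ ^ 2), by positivity, fun r hr => ?_⟩
  have h1 : K * r ^ 2 - δ * r ^ 3 ≤ (0 * r - 1 * r ^ 2) + (|K| + 1) ^ 3 / δ ^ 2 := by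
    have hK : K * r ^ 2 ≤ |K| * r ^ 2 := by gcongr; exact le_abs_self K
    have hL : 0 ≤ |K| + 1 := by positivity
    -- Beyond r = (|K| + 1)/δ the cubic term leaves at most -r²; below it r² is bounded by a
    -- constant. The claim is thereby reduced to the Gaussian case with K = 0.
    rcases le_or_gt (|K| + 1) (δ * r) with hle | hlt
    · have : (|K| + 1) * r ^ 2 ≤ δ * r * r ^ 2 := by gcongr
      have : 0 ≤ (|K| + 1) ^ 3 / δ ^ 2 := by positivity
      nlinarith
    · have : (|K| + 1) * r ^ 2 ≤ (|K| + 1) ^ 3 / δ ^ 2 := by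
        rw [le_div_iff₀ (by positivity)]
        have : (δ * r) ^ 2 ≤ (|K| + 1) ^ 2 := by gcongr
        nlinarith
      have : 0 ≤ δ * r ^ 3 := by positivity
      nlinarith
  calc (1 + r) ^ M * Real.exp (K * r ^ 2 - δ * r ^ 3)
      ≤ (1 + r) ^ M * Real.exp ((0 * r - 1 * r ^ 2) + (|K| + 1) ^ 3 / δ ^ 2) := by gcongr
    _ = (1 + r) ^ M * Real.exp (0 * r - 1 * r ^ 2) * Real.exp ((|K| + 1) ^ 3 / δ ^ 2) := by
      rw [Real.exp_add, mul_assoc]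
    _ ≤ _ := by gcongr; exact h r hr

section Path

/-- A function on the line bounded by an integrable density, for paths of polynomial length. -/
theorem integrable_pow_mul_mul_deriv {γ : ℝ → ℂ} (hγ : ContDiff ℝ 1 γ)
    (hlen : ∃ N : ℕ, Integrable fun t => ‖deriv γ t‖ / (1 + ‖γ t‖) ^ N) {w : ℝ → ℝ}
    (hw : Continuous w) (hbound : ∀ M : ℕ, ∃ C, ∀ r, 0 ≤ r → (1 + r) ^ M * |w r| ≤ C) (M : ℕ) :
    Integrable fun t => (1 + ‖γ t‖) ^ M * w ‖γ t‖ * ‖deriv γ t‖ := by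
  obtain ⟨N, hN⟩ := hlen
  obtain ⟨C, hC⟩ := hbound (M + N)
  have hc := hγ.continuous
  have hd : Continuous (deriv γ) := hγ.continuous_deriv le_rfl
  refine (hN.const_mul C).mono' (by fun_prop) (Eventually.of_forall fun t => ?_)
  have hr := norm_nonneg (γ t)
  have h1 := hC _ hr
  rw [norm_mul, norm_mul, norm_norm, Real.norm_of_nonneg (by positivity), Real.norm_eq_abs,
    mul_div_assoc', le_div_iff₀ (by positivity)]
  rw [pow_add] at h1
  nlinarith [norm_nonneg (deriv γ t)]

variable {γ γ' : ℝ → ℂ}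

/-- The Gaussian in one variable and the cubic exponential in the other one control `exp (r s)`. -/
theorem integrable_prod_of_cube_of_sq (hγ : ContDiff ℝ 1 γ) (hγ' : ContDiff ℝ 1 γ')
    (hlen : ∃ N : ℕ, Integrable fun t => ‖deriv γ t‖ / (1 + ‖γ t‖) ^ N)
    (hlen' : ∃ N : ℕ, Integrable fun t => ‖deriv γ' t‖ / (1 + ‖γ' t‖) ^ N)
    {δ ε : ℝ} (hδ : 0 < δ) (hε : 0 < ε) (M N : ℕ) :
    Integrable fun q : ℝ × ℝ => ((1 + ‖γ q.1‖) ^ M * Real.exp (-δ * ‖γ q.1‖ ^ 3) * ‖deriv γ q.1‖) *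
      ((1 + ‖γ' q.2‖) ^ N * Real.exp (-ε * ‖γ' q.2‖ ^ 2) * ‖deriv γ' q.2‖) *
      Real.exp (‖γ q.1‖ * ‖γ' q.2‖) := by
  have h1 := integrable_pow_mul_mul_deriv hγ hlen
    (w := fun r => Real.exp (1 / (2 * ε) * r ^ 2 - δ * r ^ 3)) (by fun_prop)
    (fun M => by
      obtain ⟨C, -, hC⟩ := exists_pow_mul_exp_cube_le hδ (1 / (2 * ε)) M
      exact ⟨C, fun r hr => by rw [abs_of_pos (Real.exp_pos _)]; exact hC r hr⟩) M
  have h2 := integrable_pow_mul_mul_deriv hγ' hlen'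
    (w := fun r => Real.exp (0 * r - ε / 2 * r ^ 2)) (by fun_prop)
    (fun M => by
      obtain ⟨C, -, hC⟩ := exists_pow_mul_exp_sq_le (half_pos hε) 0 M
      exact ⟨C, fun r hr => by rw [abs_of_pos (Real.exp_pos _)]; exact hC r hr⟩) N
  have hc := hγ.continuous
  have hd : Continuous (deriv γ) := hγ.continuous_deriv le_rfl
  have hc' := hγ'.continuous
  have hd' : Continuous (deriv γ') := hγ'.continuous_deriv le_rfl
  refine (h1.mul_prod h2).mono' (Continuous.aestronglyMeasurable (by fun_prop))
    (Eventually.of_forall fun q => ?_)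
  rw [Real.norm_of_nonneg (by positivity)]
  set r := ‖γ q.1‖
  set s := ‖γ' q.2‖
  have hexp : Real.exp (-δ * r ^ 3) * Real.exp (-ε * s ^ 2) * Real.exp (r * s) ≤
      Real.exp (1 / (2 * ε) * r ^ 2 - δ * r ^ 3) * Real.exp (0 * s - ε / 2 * s ^ 2) := by
    rw [← Real.exp_add, ← Real.exp_add, ← Real.exp_add]
    refine Real.exp_le_exp.2 ?_
    -- Young's inequality weighted to spend half of the Gaussian in s; the resulting square in r is
    -- absorbed by the cube.
    have : r * s ≤ 1 / (2 * ε) * r ^ 2 + ε / 2 * s ^ 2 := by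
      have h3 : 1 / (2 * ε) * r ^ 2 + ε / 2 * s ^ 2 - r * s = (r - ε * s) ^ 2 / (2 * ε) := by
        field_simp; ring
      have h4 : 0 ≤ (r - ε * s) ^ 2 / (2 * ε) := by positivity
      linarith
    linarith
  calc (1 + r) ^ M * Real.exp (-δ * r ^ 3) * ‖deriv γ q.1‖ *
        ((1 + s) ^ N * Real.exp (-ε * s ^ 2) * ‖deriv γ' q.2‖) * Real.exp (r * s)
      = ((1 + r) ^ M * ‖deriv γ q.1‖ * ((1 + s) ^ N * ‖deriv γ' q.2‖)) *
        (Real.exp (-δ * r ^ 3) * Real.exp (-ε * s ^ 2) * Real.exp (r * s)) := by ring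
    _ ≤ ((1 + r) ^ M * ‖deriv γ q.1‖ * ((1 + s) ^ N * ‖deriv γ' q.2‖)) *
        (Real.exp (1 / (2 * ε) * r ^ 2 - δ * r ^ 3) * Real.exp (0 * s - ε / 2 * s ^ 2)) := by
      gcongr
    _ = _ := by ring

end Path

theorem exists_norm_eval_le (p : ℂ[X]) :
    ∃ (K : ℝ) (N : ℕ), 0 < K ∧ ∀ z, ‖p.eval z‖ ≤ K * (1 + ‖z‖) ^ N := by
  refine ⟨1 + ∑ i ∈ Finset.range (p.natDegree + 1), ‖p.coeff i‖, p.natDegree, by positivity,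
    fun z => ?_⟩
  rw [eval_eq_sum_range]
  refine (norm_sum_le _ _).trans ?_
  have h1 : ∑ i ∈ Finset.range (p.natDegree + 1), ‖p.coeff i * z ^ i‖ ≤
      (∑ i ∈ Finset.range (p.natDegree + 1), ‖p.coeff i‖) * (1 + ‖z‖) ^ p.natDegree := by
    rw [Finset.sum_mul]
    refine Finset.sum_le_sum fun i hi => ?_
    rw [norm_mul, norm_pow]
    have hz := norm_nonneg z
    gcongr
    calc ‖z‖ ^ i ≤ (1 + ‖z‖) ^ i := by gcongr; linarith
      _ ≤ (1 + ‖z‖) ^ p.natDegree :=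
        pow_le_pow_right₀ (by linarith) (by simpa [Nat.lt_succ_iff] using hi)
  have : 0 < (1 + ‖z‖) ^ p.natDegree := by positivity
  nlinarith

theorem pow_le_pow_add_one {r : ℝ} (hr : 0 ≤ r) {m n : ℕ} (h : m ≤ n) : r ^ m ≤ r ^ n + 1 := by
  rcases le_total r 1 with h1 | h1
  · have := pow_le_one₀ (n := m) hr h1
    have := pow_nonneg hr n
    linarith
  · have := pow_le_pow_right₀ h1 h
    linarith

/-- Differentiation under the integral sign. -/
theorem hasDerivAt_integral_of_bound {α : Type*} [MeasurableSpace α] {μ : Measure α}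
    {F F' : ℂ → α → ℂ} {x : ℂ} {r : ℝ} (hr : 0 < r) {bound : α → ℝ}
    (hF : ∀ z ∈ Metric.ball x r, Integrable (F z) μ) (hF' : AEStronglyMeasurable (F' x) μ)
    (hbound : ∀ a, ∀ z ∈ Metric.ball x r, ‖F' z a‖ ≤ bound a) (hint : Integrable bound μ)
    (hder : ∀ a, ∀ z ∈ Metric.ball x r, HasDerivAt (fun z => F z a) (F' z a) z) :
    HasDerivAt (fun z => ∫ a, F z a ∂μ) (∫ a, F' x a ∂μ) x :=
  (hasDerivAt_integral_of_dominated_loc_of_deriv_le (Metric.ball_mem_nhds x hr)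
    (by filter_upwards [Metric.ball_mem_nhds x hr] with z hz using (hF z hz).aestronglyMeasurable)
    (hF x (Metric.mem_ball_self hr)) hF' (ae_of_all _ hbound) hint (ae_of_all _ hder)).2

/-! ### Decay of the weight and growth classes along the contours. -/

namespace ContourSystem

variable (X : ContourSystem)

/-- The decay exponent of the weight. -/
def decay : ℕ := X.A.natDegree - X.B.natDegree + 1

theorem two_le_decay : 2 ≤ X.decay := by
  have := X.degree_le
  unfold decay; omega

theorem eval_ne_zero (μ : Fin X.d) (t : ℝ) : X.B.eval (X.Γ μ t) ≠ 0 :=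
  X.isWeight.eval_ne_zero _ ((X.admissible μ).mem t)

theorem continuous_contour (μ : Fin X.d) : Continuous (X.Γ μ) := (X.admissible μ).continuous

theorem continuous_deriv_contour (μ : Fin X.d) : Continuous (deriv (X.Γ μ)) :=
  (X.admissible μ).continuous_deriv

theorem continuous_weight (μ : Fin X.d) : Continuous fun t => X.W (X.Γ μ t) :=
  (X.admissible μ).continuous_weight X.isWeight

/-- Since r^m ≤ r^n + 1 for m ≤ n, lowering the decay exponent costs only the factor e^δ. -/
theorem exists_norm_weight_le (μ : Fin X.d) {m : ℕ} (hm : m ≤ X.decay) :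
    ∃ K δ : ℝ, 0 < K ∧ 0 < δ ∧
      ∀ t, ‖X.W (X.Γ μ t)‖ ≤ K * Real.exp (-δ * ‖X.Γ μ t‖ ^ m) := by
  obtain ⟨K, δ, hK, hδ, h⟩ := (X.admissible μ).exists_norm_weight_le X.B_ne_zero X.isWeight
  refine ⟨K * Real.exp δ, δ, by positivity, hδ, fun t => (h t).trans ?_⟩
  rw [mul_assoc, ← Real.exp_add]
  refine mul_le_mul_of_nonneg_left (Real.exp_le_exp.2 ?_) hK.le
  have := pow_le_pow_add_one (norm_nonneg (X.Γ μ t)) hm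
  unfold decay at this
  nlinarith

/-- Because deg A exceeds deg B, the decay is at least Gaussian and beats every exponential. This is
the majorant for the transforms and for their derivatives in x. -/
theorem integrable_pow_mul_exp_mul_weight (μ : Fin X.d) (K : ℝ) (M : ℕ) :
    Integrable fun t => (1 + ‖X.Γ μ t‖) ^ M * Real.exp (K * ‖X.Γ μ t‖) *
      ‖X.W (X.Γ μ t)‖ * ‖deriv (X.Γ μ) t‖ := by
  obtain ⟨C, δ, hC, hδ, h⟩ := X.exists_norm_weight_le μ X.two_le_decay
  have hc := X.continuous_contour μ
  have hd := X.continuous_deriv_contour μ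
  have hw := X.continuous_weight μ
  have h1 := integrable_pow_mul_mul_deriv (X.admissible μ).contDiff (X.admissible μ).length
    (w := fun r => Real.exp (K * r - δ * r ^ 2)) (by fun_prop)
    (fun M => by
      obtain ⟨C, -, hC⟩ := exists_pow_mul_exp_sq_le hδ K M
      exact ⟨C, fun r hr => by rw [abs_of_pos (Real.exp_pos _)]; exact hC r hr⟩) M
  refine (h1.const_mul C).mono' ?_ (Eventually.of_forall fun t => ?_)
  · exact (((Continuous.mul (by fun_prop) (by fun_prop)).mul hw.norm).mul
      hd.norm).aestronglyMeasurable
  · rw [Real.norm_of_nonneg (by positivity)]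
    calc (1 + ‖X.Γ μ t‖) ^ M * Real.exp (K * ‖X.Γ μ t‖) * ‖X.W (X.Γ μ t)‖ * ‖deriv (X.Γ μ) t‖
        ≤ (1 + ‖X.Γ μ t‖) ^ M * Real.exp (K * ‖X.Γ μ t‖) *
          (C * Real.exp (-δ * ‖X.Γ μ t‖ ^ 2)) * ‖deriv (X.Γ μ) t‖ := by gcongr; exact h t
      _ = _ := by rw [sub_eq_add_neg, Real.exp_add]; ring_nf

/-- Functions of at most polynomial growth along the contours. -/
def Moderate (f : ℂ → ℂ) : Prop :=
  ∀ μ, Continuous (fun t => f (X.Γ μ t)) ∧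
    ∃ (K : ℝ) (N : ℕ), 0 < K ∧ ∀ t, ‖f (X.Γ μ t)‖ ≤ K * (1 + ‖X.Γ μ t‖) ^ N

/-- Functions whose product with the weight has at most polynomial growth relative to the weight,
up to a rapidly decaying term. -/
def Tempered (f : ℂ → ℂ) : Prop :=
  ∀ μ, Continuous (fun t => f (X.Γ μ t)) ∧
    ∃ (K : ℝ) (N : ℕ), 0 < K ∧ ∀ t, ‖f (X.Γ μ t) * X.W (X.Γ μ t)‖ ≤
      K * (1 + ‖X.Γ μ t‖) ^ N * (‖X.W (X.Γ μ t)‖ + Real.exp (-‖X.Γ μ t‖ ^ 3))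

variable {X} {f g : ℂ → ℂ}

theorem moderate_eval (p : ℂ[X]) : X.Moderate fun z => p.eval z := fun μ =>
  ⟨p.continuous.comp (X.continuous_contour μ), by
    obtain ⟨K, N, hK, h⟩ := exists_norm_eval_le p
    exact ⟨K, N, hK, fun t => h _⟩⟩

theorem Moderate.mul (hf : X.Moderate f) (hg : X.Moderate g) :
    X.Moderate fun z => f z * g z := fun μ => by
  obtain ⟨hfc, K, N, hK, hfb⟩ := hf μ
  obtain ⟨hgc, K', N', hK', hgb⟩ := hg μ
  refine ⟨hfc.mul hgc, K * K', N + N', by positivity, fun t => ?_⟩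
  rw [norm_mul]
  calc _ ≤ (K * (1 + ‖X.Γ μ t‖) ^ N) * (K' * (1 + ‖X.Γ μ t‖) ^ N') := by
        gcongr; exacts [hfb t, hgb t]
    _ = _ := by ring

theorem Moderate.mul_tempered (hf : X.Moderate f) (hg : X.Tempered g) :
    X.Tempered fun z => f z * g z := fun μ => by
  obtain ⟨hfc, K, N, hK, hfb⟩ := hf μ
  obtain ⟨hgc, K', N', hK', hgb⟩ := hg μ
  refine ⟨hfc.mul hgc, K * K', N + N', by positivity, fun t => ?_⟩
  rw [mul_assoc, norm_mul]
  calc _ ≤ (K * (1 + ‖X.Γ μ t‖) ^ N) * (K' * (1 + ‖X.Γ μ t‖) ^ N' *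
          (‖X.W (X.Γ μ t)‖ + Real.exp (-‖X.Γ μ t‖ ^ 3))) := by
        gcongr; exacts [hfb t, hgb t]
    _ = _ := by ring

theorem tempered_one : X.Tempered fun _ => 1 := fun μ =>
  ⟨continuous_const, 1, 0, one_pos, fun t => by
    have := Real.exp_pos (-‖X.Γ μ t‖ ^ 3)
    simp only [one_mul, pow_zero]
    linarith⟩

theorem Moderate.tempered (hf : X.Moderate f) : X.Tempered f := by
  simpa using hf.mul_tempered tempered_one

/-- The reason for the class `Tempered`: this function is unbounded near soft zeros of B reached by
a contour, yet its product with the weight is controlled. -/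
theorem tempered_softDen_inv : X.Tempered fun z => ((softDen X.A X.B).eval z)⁻¹ := fun μ => by
  obtain ⟨K, hK, h⟩ := (X.admissible μ).exists_norm_weight_div_le X.B_ne_zero X.isWeight
  refine ⟨((softDen X.A X.B).continuous.comp (X.continuous_contour μ)).inv₀ fun t =>
    softDen_eval_ne_zero X.B_ne_zero (X.eval_ne_zero μ t), K, 0, hK, fun t => ?_⟩
  rw [pow_zero, mul_one, mul_comm, ← div_eq_mul_inv]
  exact h t

theorem Tempered.congr (hf : X.Tempered f) (h : ∀ μ t, f (X.Γ μ t) = g (X.Γ μ t)) :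
    X.Tempered g := fun μ => by
  simpa only [h] using hf μ

theorem Tempered.const_mul (c : ℂ) (hf : X.Tempered f) : X.Tempered fun z => c * f z := by
  simpa using (moderate_eval (C c)).mul_tempered hf

theorem Tempered.add (hf : X.Tempered f) (hg : X.Tempered g) :
    X.Tempered fun z => f z + g z := fun μ => by
  obtain ⟨hfc, K, N, hK, hfb⟩ := hf μ
  obtain ⟨hgc, K', N', hK', hgb⟩ := hg μ
  refine ⟨hfc.add hgc, K + K', N + N', by positivity, fun t => ?_⟩
  rw [add_mul]
  have h1 : (1 : ℝ) ≤ 1 + ‖X.Γ μ t‖ := by simp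
  calc _ ≤ _ := norm_add_le _ _
    _ ≤ K * (1 + ‖X.Γ μ t‖) ^ N * (‖X.W (X.Γ μ t)‖ + Real.exp (-‖X.Γ μ t‖ ^ 3)) +
        K' * (1 + ‖X.Γ μ t‖) ^ N' * (‖X.W (X.Γ μ t)‖ + Real.exp (-‖X.Γ μ t‖ ^ 3)) :=
      add_le_add (hfb t) (hgb t)
    _ ≤ K * (1 + ‖X.Γ μ t‖) ^ (N + N') * (‖X.W (X.Γ μ t)‖ + Real.exp (-‖X.Γ μ t‖ ^ 3)) +
        K' * (1 + ‖X.Γ μ t‖) ^ (N + N') * (‖X.W (X.Γ μ t)‖ + Real.exp (-‖X.Γ μ t‖ ^ 3)) := by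
      gcongr <;> first | exact h1 | omega
    _ = _ := by ring

/-- A point outside the closed support has positive distance r from the contours, so the Cauchy
kernel is bounded by 1/r. -/
theorem moderate_inv_sub {x : ℂ} (hx : x ∉ X.support) : X.Moderate fun z => (x - z)⁻¹ := by
  have hopen : IsOpen X.supportᶜ := isClosed_closure.isOpen_compl
  obtain ⟨r, hr, hball⟩ := Metric.isOpen_iff.1 hopen x hx
  intro μ
  have hmem : ∀ t, X.Γ μ t ∈ X.support := fun t =>
    subset_closure (Set.mem_iUnion.2 ⟨μ, t, rfl⟩)
  have hle : ∀ t, r ≤ ‖x - X.Γ μ t‖ := fun t => by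
    by_contra h
    exact hball (Metric.mem_ball'.2 (by rw [dist_eq_norm]; exact not_le.1 h)) (hmem t)
  refine ⟨(continuous_const.sub (X.continuous_contour μ)).inv₀ fun t => ?_, r⁻¹, 0, by positivity,
    fun t => ?_⟩
  · exact norm_pos_iff.1 (hr.trans_le (hle t))
  · rw [norm_inv, pow_zero, mul_one]
    gcongr
    exact hle t

/-! ### The Fourier-Laplace transforms -/

theorem integrable_transform (Y : ContourSystem) (ν : Fin Y.d) (x : ℂ) (s : ℂ[X]) :
    Integrable fun t => Complex.exp (x * Y.Γ ν t) * s.eval (Y.Γ ν t) * Y.W (Y.Γ ν t) *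
      deriv (Y.Γ ν) t := by
  obtain ⟨K, N, hK, h⟩ := exists_norm_eval_le s
  have hc := Y.continuous_contour ν
  refine ((Y.integrable_pow_mul_exp_mul_weight ν ‖x‖ N).const_mul K).mono' ?_
    (Eventually.of_forall fun t => ?_)
  · exact (((Continuous.mul (by fun_prop) (s.continuous.comp hc)).mul
      (Y.continuous_weight ν)).mul (Y.continuous_deriv_contour ν)).aestronglyMeasurable
  · rw [norm_mul, norm_mul, norm_mul]
    have h1 : ‖Complex.exp (x * Y.Γ ν t)‖ ≤ Real.exp (‖x‖ * ‖Y.Γ ν t‖) :=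
      (Complex.norm_exp_le_exp_norm _).trans (by rw [norm_mul])
    calc _ ≤ Real.exp (‖x‖ * ‖Y.Γ ν t‖) * (K * (1 + ‖Y.Γ ν t‖) ^ N) * ‖Y.W (Y.Γ ν t)‖ *
          ‖deriv (Y.Γ ν) t‖ := by gcongr; exact h _
      _ = _ := by ring

/-- The Fourier-Laplace transform `s ↦ ∫_{Γ_ν} e^{x y} s(y) e^{-V(y)} dy`. -/
def transform (Y : ContourSystem) (ν : Fin Y.d) (x : ℂ) : ℂ[X] →ₗ[ℂ] ℂ where
  toFun s := Y.integral ν fun y => Complex.exp (x * y) * s.eval y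
  map_add' s s' := by
    unfold integral
    rw [← integral_add (Y.integrable_transform ν x s) (Y.integrable_transform ν x s')]
    congr 1; funext t; simp only [eval_add]; ring
  map_smul' c s := by
    unfold integral
    rw [RingHom.id_apply, smul_eq_mul, ← integral_const_mul]
    congr 1; funext t; simp only [eval_smul, smul_eq_mul]; ring

theorem transform_apply (Y : ContourSystem) (ν : Fin Y.d) (x : ℂ) (s : ℂ[X]) :
    Y.transform ν x s = ∫ t : ℝ, Complex.exp (x * Y.Γ ν t) * s.eval (Y.Γ ν t) * Y.W (Y.Γ ν t) *
      deriv (Y.Γ ν) t := rfl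

/-- Differentiation under the integral turns d/dx into multiplication by y. On the unit disc around
x the integrand is dominated with exponential rate ‖x‖ + 1. -/
theorem hasDerivAt_transform (Y : ContourSystem) (ν : Fin Y.d) (x : ℂ) (s : ℂ[X]) :
    HasDerivAt (fun z => Y.transform ν z s) (Y.transform ν x (Polynomial.X * s)) x := by
  obtain ⟨K, N, hK, h⟩ := exists_norm_eval_le (Polynomial.X * s)
  have hbound : ∀ t : ℝ, ∀ z ∈ Metric.ball x 1,
      ‖Complex.exp (z * Y.Γ ν t) * (Polynomial.X * s).eval (Y.Γ ν t) * Y.W (Y.Γ ν t) *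
        deriv (Y.Γ ν) t‖ ≤ K * ((1 + ‖Y.Γ ν t‖) ^ N * Real.exp ((‖x‖ + 1) * ‖Y.Γ ν t‖) *
          ‖Y.W (Y.Γ ν t)‖ * ‖deriv (Y.Γ ν) t‖) := by
    intro t z hz
    rw [norm_mul, norm_mul, norm_mul]
    have hz' : ‖z‖ ≤ ‖x‖ + 1 := by
      have h1 := norm_le_norm_add_norm_sub' z x
      have h2 : ‖z - x‖ < 1 := by rwa [Metric.mem_ball, dist_eq_norm] at hz
      linarith
    have h1 : ‖Complex.exp (z * Y.Γ ν t)‖ ≤ Real.exp ((‖x‖ + 1) * ‖Y.Γ ν t‖) :=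
      (Complex.norm_exp_le_exp_norm _).trans (by rw [norm_mul]; gcongr)
    calc _ ≤ Real.exp ((‖x‖ + 1) * ‖Y.Γ ν t‖) * (K * (1 + ‖Y.Γ ν t‖) ^ N) * ‖Y.W (Y.Γ ν t)‖ *
          ‖deriv (Y.Γ ν) t‖ := by gcongr; exact h _
      _ = _ := by ring
  have hder : ∀ t : ℝ, ∀ z ∈ Metric.ball x 1,
      HasDerivAt (fun z => Complex.exp (z * Y.Γ ν t) * s.eval (Y.Γ ν t) * Y.W (Y.Γ ν t) *
        deriv (Y.Γ ν) t) (Complex.exp (z * Y.Γ ν t) * (Polynomial.X * s).eval (Y.Γ ν t) *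
        Y.W (Y.Γ ν t) * deriv (Y.Γ ν) t) z := by
    intro t z _
    have h1 : HasDerivAt (fun z => Complex.exp (z * Y.Γ ν t))
        (Complex.exp (z * Y.Γ ν t) * Y.Γ ν t) z := by
      simpa using ((hasDerivAt_id z).mul_const (Y.Γ ν t)).cexp
    refine (((h1.mul_const (s.eval (Y.Γ ν t))).mul_const (Y.W (Y.Γ ν t))).mul_const
      (deriv (Y.Γ ν) t)).congr_deriv ?_
    rw [eval_mul, eval_X]
    ring
  have h01 : (0 : ℝ) < 1 := one_pos
  obtain ⟨F, hF⟩ : ∃ F : ℂ[X] → ℂ → ℝ → ℂ, ∀ s z, F s z = fun t => Complex.exp (z * Y.Γ ν t) *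
    s.eval (Y.Γ ν t) * Y.W (Y.Γ ν t) * deriv (Y.Γ ν) t := ⟨_, fun _ _ => rfl⟩
  have key := hasDerivAt_integral_of_bound (x := x) (μ := volume) (F := F s)
    (F' := F (Polynomial.X * s)) h01 (fun z _ => by rw [hF]; exact Y.integrable_transform ν z s)
    (by rw [hF]; exact (Y.integrable_transform ν x (Polynomial.X * s)).aestronglyMeasurable)
    (fun t z hz => by rw [hF]; exact hbound t z hz)
    ((Y.integrable_pow_mul_exp_mul_weight ν (‖x‖ + 1) N).const_mul K)
    (fun t z hz => by simp only [hF]; exact hder t z hz)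
  simp only [hF] at key
  exact key

/-- Integration by parts in the transforms. -/
theorem transform_adjoint (Y : ContourSystem) (ν : Fin Y.d) (x : ℂ) (s : ℂ[X]) :
    Y.transform ν x (Y.A * s - Y.B * s.derivative) = x * Y.transform ν x (Y.B * s) := by
  have hadm := Y.admissible ν
  set F : ℝ → ℂ := fun t => Complex.exp (x * Y.Γ ν t) * (Y.B * s).eval (Y.Γ ν t) *
    Y.W (Y.Γ ν t) with hF
  -- In (Bs)' - V'Bs the two occurrences of B' cancel, leaving -(As - Bs').
  have hder : ∀ t, HasDerivAt F
      (x * (Complex.exp (x * Y.Γ ν t) * (Y.B * s).eval (Y.Γ ν t) * Y.W (Y.Γ ν t) *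
        deriv (Y.Γ ν) t) -
      Complex.exp (x * Y.Γ ν t) * (Y.A * s - Y.B * s.derivative).eval (Y.Γ ν t) * Y.W (Y.Γ ν t) *
        deriv (Y.Γ ν) t) t := by
    intro t
    have hg := hadm.hasDerivAt t
    have h1 := (hg.const_mul x).cexp
    have h2 := ((Y.B * s).hasDerivAt (Y.Γ ν t)).comp t hg
    have h3 := hadm.hasDerivAt_weight Y.isWeight t
    refine ((h1.mul h2).mul h3).congr_deriv ?_
    have hB := Y.eval_ne_zero ν t
    simp only [Function.comp, potDeriv, derivative_mul, eval_add, eval_mul, eval_sub, Pi.mul_apply]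
    field_simp
    ring
  have hi1 := (Y.integrable_transform ν x (Y.B * s)).const_mul x
  have hi2 := Y.integrable_transform ν x (Y.A * s - Y.B * s.derivative)
  have hcont : Continuous fun z => Complex.exp (x * z) * (Y.B * s).eval z := by fun_prop
  -- At a finite end the factor B vanishes while the weight has a limit, so even hard edges
  -- contribute nothing. At infinity integrability alone forces the limit 0.
  have hend : ∀ l, IsEnd l → IsAdmissibleEnd Y.A Y.B Y.W (Y.Γ ν) l → Tendsto F l (𝓝 0) := by
    intro l hl h
    rcases h.cases hl Y.B_ne_zero Y.isWeight hadm with ⟨hinf, -⟩ | ⟨c, w, hc, hlim, hw, -⟩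
    · exact tendsto_zero_of_integrable hl hadm.contDiff hder (hi1.sub hi2)
        (Y.integrable_transform ν x (Y.B * s)) hinf
    · have := ((hcont.tendsto c).comp hlim).mul hw
      simpa [hc, hF] using this
  obtain ⟨w, hbot, htop⟩ : ∃ w, Tendsto F atBot (𝓝 w) ∧ Tendsto F atTop (𝓝 w) := by
    rcases hadm.ends with ⟨z, hz, h1, h2⟩ | ⟨h1, h2⟩
    · have hFz : Tendsto (fun z => Complex.exp (x * z) * (Y.B * s).eval z * Y.W z) (𝓝 z)
          (𝓝 (Complex.exp (x * z) * (Y.B * s).eval z * Y.W z)) :=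
        (hcont.tendsto z).mul (Y.isWeight.continuousAt hz)
      exact ⟨_, hFz.comp h1, hFz.comp h2⟩
    · exact ⟨0, hend _ (Or.inl rfl) h1, hend _ (Or.inr rfl) h2⟩
  have := integral_of_hasDerivAt_of_tendsto hder (hi1.sub hi2) hbot htop
  rw [integral_sub hi1 hi2, integral_const_mul, sub_self, sub_eq_zero] at this
  exact this.symm

end ContourSystem

open ContourSystem

/-! ### The double integral as an iterated integral. -/

section Functional

variable {X Y : ContourSystem} {κ : Fin X.d → Fin Y.d → ℂ}

theorem continuous_density (μ : Fin X.d) (ν : Fin Y.d) : Continuous (density X Y μ ν) := by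
  have h1 : Continuous fun q : ℝ × ℝ => X.Γ μ q.1 := (X.continuous_contour μ).comp continuous_fst
  have h2 : Continuous fun q : ℝ × ℝ => Y.Γ ν q.2 := (Y.continuous_contour ν).comp continuous_snd
  have h3 : Continuous fun q : ℝ × ℝ => X.W (X.Γ μ q.1) :=
    (X.continuous_weight μ).comp continuous_fst
  have h4 : Continuous fun q : ℝ × ℝ => Y.W (Y.Γ ν q.2) :=
    (Y.continuous_weight ν).comp continuous_snd
  have h5 : Continuous fun q : ℝ × ℝ => deriv (X.Γ μ) q.1 :=
    (X.continuous_deriv_contour μ).comp continuous_fst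
  have h6 : Continuous fun q : ℝ × ℝ => deriv (Y.Γ ν) q.2 :=
    (Y.continuous_deriv_contour ν).comp continuous_snd
  exact ((Complex.continuous_exp.comp (h1.mul h2)).mul (h3.mul h5)).mul (h4.mul h6)

theorem norm_density_le (μ : Fin X.d) (ν : Fin Y.d) (q : ℝ × ℝ) :
    ‖density X Y μ ν q‖ ≤ Real.exp (‖X.Γ μ q.1‖ * ‖Y.Γ ν q.2‖) *
      (‖X.W (X.Γ μ q.1)‖ * ‖deriv (X.Γ μ) q.1‖) * (‖Y.W (Y.Γ ν q.2)‖ * ‖deriv (Y.Γ ν) q.2‖) := by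
  rw [density, norm_mul, norm_mul, norm_mul, norm_mul]
  gcongr
  exact (Complex.norm_exp_le_exp_norm _).trans (by rw [norm_mul])

theorem integrable_prod_contours {X Y : ContourSystem} (μ : Fin X.d) (ν : Fin Y.d) {δ ε : ℝ}
    (hδ : 0 < δ) (hε : 0 < ε) (M N : ℕ) :
    Integrable fun q : ℝ × ℝ =>
      ((1 + ‖X.Γ μ q.1‖) ^ M * Real.exp (-δ * ‖X.Γ μ q.1‖ ^ 3) * ‖deriv (X.Γ μ) q.1‖) *
      ((1 + ‖Y.Γ ν q.2‖) ^ N * Real.exp (-ε * ‖Y.Γ ν q.2‖ ^ 2) * ‖deriv (Y.Γ ν) q.2‖) *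
      Real.exp (‖X.Γ μ q.1‖ * ‖Y.Γ ν q.2‖) :=
  integrable_prod_of_cube_of_sq (X.admissible μ).contDiff (Y.admissible ν).contDiff
    (X.admissible μ).length (Y.admissible ν).length hδ hε M N

theorem norm_moment_le (μ : Fin X.d) (ν : Fin Y.d) (i j : ℕ) (q : ℝ × ℝ) {a b : ℝ}
    (ha : ‖X.W (X.Γ μ q.1)‖ ≤ a) (hb : ‖Y.W (Y.Γ ν q.2)‖ ≤ b) :
    ‖X.Γ μ q.1 ^ i * Y.Γ ν q.2 ^ j * density X Y μ ν q‖ ≤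
      ((1 + ‖X.Γ μ q.1‖) ^ i * a * ‖deriv (X.Γ μ) q.1‖) *
      ((1 + ‖Y.Γ ν q.2‖) ^ j * b * ‖deriv (Y.Γ ν) q.2‖) *
      Real.exp (‖X.Γ μ q.1‖ * ‖Y.Γ ν q.2‖) := by
  have ha0 := (norm_nonneg _).trans ha
  have hb0 := (norm_nonneg _).trans hb
  rw [norm_mul, norm_mul, norm_pow, norm_pow]
  calc _ ≤ (1 + ‖X.Γ μ q.1‖) ^ i * (1 + ‖Y.Γ ν q.2‖) ^ j *
        (Real.exp (‖X.Γ μ q.1‖ * ‖Y.Γ ν q.2‖) * (a * ‖deriv (X.Γ μ) q.1‖) *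
          (b * ‖deriv (Y.Γ ν) q.2‖)) := by
        gcongr
        · linarith
        · linarith
        · refine (norm_density_le μ ν q).trans ?_
          gcongr
    _ = _ := by ring

/-- The bimoments converge absolutely, by Young's inequality if one of the weights decays faster
than a Gaussian. -/
theorem momentsConverge_of_degree
    (hconv : X.A.natDegree = X.B.natDegree + 1 → Y.A.natDegree = Y.B.natDegree + 1 →
      MomentsConverge X Y κ) : MomentsConverge X Y κ := by
  have hX := X.degree_le
  have hY := Y.degree_le
  have hcont : ∀ μ ν (i j : ℕ), AEStronglyMeasurable
      (fun q : ℝ × ℝ => X.Γ μ q.1 ^ i * Y.Γ ν q.2 ^ j * density X Y μ ν q) := fun μ ν i j =>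
    (((((X.continuous_contour μ).comp continuous_fst).pow i).mul
      (((Y.continuous_contour ν).comp continuous_snd).pow j)).mul
      (continuous_density μ ν)).aestronglyMeasurable
  by_cases h3 : 3 ≤ X.decay
  · intro μ ν _ i j
    obtain ⟨K, δ, hK, hδ, h1⟩ := X.exists_norm_weight_le μ h3
    obtain ⟨L, ε, hL, hε, h2⟩ := Y.exists_norm_weight_le ν Y.two_le_decay
    refine ((integrable_prod_contours μ ν hδ hε i j).const_mul (K * L)).mono' (hcont μ ν i j)
      (ae_of_all _ fun q => (norm_moment_le μ ν i j q (h1 _) (h2 _)).trans (le_of_eq ?_))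
    ring
  by_cases h4 : 3 ≤ Y.decay
  · intro μ ν _ i j
    obtain ⟨K, δ, hK, hδ, h1⟩ := X.exists_norm_weight_le μ X.two_le_decay
    obtain ⟨L, ε, hL, hε, h2⟩ := Y.exists_norm_weight_le ν h4
    -- The same estimate with the roles of the variables exchanged.
    refine ((integrable_prod_contours ν μ hε hδ j i).swap.const_mul (K * L)).mono' (hcont μ ν i j)
      (ae_of_all _ fun q => (norm_moment_le μ ν i j q (h1 _) (h2 _)).trans (le_of_eq ?_))
    simp only [Function.comp, Prod.swap, mul_comm ‖Y.Γ ν q.2‖ ‖X.Γ μ q.1‖]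
    ring
  · unfold decay at h3 h4
    exact hconv (by omega) (by omega)

theorem one_add_pow_le {r : ℝ} (hr : 0 ≤ r) (N : ℕ) : (1 + r) ^ N ≤ 2 ^ N * (1 + r ^ N) := by
  have h := add_pow_le zero_le_one hr N
  rw [one_pow] at h
  refine h.trans ?_
  gcongr
  · norm_num
  · omega

/-- As (1 + r)^M ≤ 2^M(1 + r^M), four absolutely convergent bimoments dominate the integrand. -/
theorem integrable_pow_mul_density (hc : MomentsConverge X Y κ) {μ : Fin X.d} {ν : Fin Y.d}
    (hκ : κ μ ν ≠ 0) (M N : ℕ) :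
    Integrable fun q : ℝ × ℝ =>
      (1 + ‖X.Γ μ q.1‖) ^ M * (1 + ‖Y.Γ ν q.2‖) ^ N * ‖density X Y μ ν q‖ := by
  have h00 := (hc μ ν hκ 0 0).norm
  have h10 := (hc μ ν hκ M 0).norm
  have h01 := (hc μ ν hκ 0 N).norm
  have h11 := (hc μ ν hκ M N).norm
  have h1 : Continuous fun q : ℝ × ℝ => X.Γ μ q.1 := (X.continuous_contour μ).comp continuous_fst
  have h2 : Continuous fun q : ℝ × ℝ => Y.Γ ν q.2 := (Y.continuous_contour ν).comp continuous_snd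
  refine ((((h00.add h10).add h01).add h11).const_mul (2 ^ M * 2 ^ N)).mono' ?_
    (ae_of_all _ fun q => ?_)
  · exact ((((continuous_const.add h1.norm).pow M).mul ((continuous_const.add h2.norm).pow N)).mul
      (continuous_density μ ν).norm).aestronglyMeasurable
  · rw [Real.norm_of_nonneg (by positivity)]
    simp only [Pi.add_apply, norm_mul, norm_pow, pow_zero, one_mul, mul_one]
    calc _ ≤ (2 ^ M * (1 + ‖X.Γ μ q.1‖ ^ M)) * (2 ^ N * (1 + ‖Y.Γ ν q.2‖ ^ N)) *
          ‖density X Y μ ν q‖ := by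
          gcongr <;> exact one_add_pow_le (norm_nonneg _) _
      _ = _ := by ring

/-- The tempered bound splits the integrand in two: the part with the true weight is handled by the
absolute moments, the part with exp(-r³) by Young's inequality and the Gaussian decay of the second
weight. The assumption on moments therefore suffices even when both weights are only Gaussian. -/
theorem integrable_mul_density (hc : MomentsConverge X Y κ) {μ : Fin X.d} {ν : Fin Y.d}
    (hκ : κ μ ν ≠ 0) {f : ℂ → ℂ} (hf : X.Tempered f) (s : ℂ[X]) :
    Integrable fun q : ℝ × ℝ => f (X.Γ μ q.1) * s.eval (Y.Γ ν q.2) * density X Y μ ν q := by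
  obtain ⟨hfc, K, M, hK, hfb⟩ := hf μ
  obtain ⟨L, N, hL, hs⟩ := exists_norm_eval_le s
  obtain ⟨G, ε, hG, hε, hw⟩ := Y.exists_norm_weight_le ν Y.two_le_decay
  have h1 := integrable_pow_mul_density hc hκ M N
  have h2 := integrable_prod_contours μ ν one_pos hε M N
  have hsc : Continuous fun q : ℝ × ℝ => s.eval (Y.Γ ν q.2) :=
    (s.continuous.comp (Y.continuous_contour ν)).comp continuous_snd
  refine ((h1.add (h2.const_mul G)).const_mul (K * L)).mono'
    (((hfc.comp continuous_fst).mul hsc).mul (continuous_density μ ν)).aestronglyMeasurable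
    (ae_of_all _ fun q => ?_)
  set r := ‖X.Γ μ q.1‖
  set t := ‖Y.Γ ν q.2‖
  have hfq := hfb q.1
  have hsq := hs (Y.Γ ν q.2)
  have hwq := hw q.2
  set E := Complex.exp (X.Γ μ q.1 * Y.Γ ν q.2)
  have hE : ‖E‖ ≤ Real.exp (r * t) := (Complex.norm_exp_le_exp_norm _).trans (by rw [norm_mul])
  have hD : ‖density X Y μ ν q‖ = ‖E‖ * (‖X.W (X.Γ μ q.1)‖ * ‖deriv (X.Γ μ) q.1‖) *
      (‖Y.W (Y.Γ ν q.2)‖ * ‖deriv (Y.Γ ν) q.2‖) := by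
    rw [density, norm_mul, norm_mul, norm_mul, norm_mul]
  simp only [Pi.add_apply]
  calc ‖f (X.Γ μ q.1) * s.eval (Y.Γ ν q.2) * density X Y μ ν q‖
      = ‖f (X.Γ μ q.1) * X.W (X.Γ μ q.1)‖ * ‖s.eval (Y.Γ ν q.2)‖ *
        (‖E‖ * ‖deriv (X.Γ μ) q.1‖ * (‖Y.W (Y.Γ ν q.2)‖ * ‖deriv (Y.Γ ν) q.2‖)) := by
        rw [norm_mul, norm_mul, hD, norm_mul]; ring
    _ ≤ (K * (1 + r) ^ M * (‖X.W (X.Γ μ q.1)‖ + Real.exp (-r ^ 3))) * (L * (1 + t) ^ N) *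
        (‖E‖ * ‖deriv (X.Γ μ) q.1‖ * (‖Y.W (Y.Γ ν q.2)‖ * ‖deriv (Y.Γ ν) q.2‖)) := by gcongr
    _ = K * L * ((1 + r) ^ M * (1 + t) ^ N * ‖density X Y μ ν q‖) +
        K * L * ((1 + r) ^ M * Real.exp (-r ^ 3) * ‖deriv (X.Γ μ) q.1‖ *
          ((1 + t) ^ N * ‖Y.W (Y.Γ ν q.2)‖ * ‖deriv (Y.Γ ν) q.2‖) * ‖E‖) := by rw [hD]; ring
    _ ≤ K * L * ((1 + r) ^ M * (1 + t) ^ N * ‖density X Y μ ν q‖) +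
        K * L * ((1 + r) ^ M * Real.exp (-r ^ 3) * ‖deriv (X.Γ μ) q.1‖ *
          ((1 + t) ^ N * (G * Real.exp (-ε * t ^ 2)) * ‖deriv (Y.Γ ν) q.2‖) *
          Real.exp (r * t)) := by gcongr
    _ = _ := by simp only [r, t, neg_mul, one_mul]; ring

variable (κ) in
/-- The combination `∑_ν κ_{μν} ∫_{Γ_ν} e^{z y} s(y) e^{-V₂(y)} dy`. -/
def kappaTransform (μ : Fin X.d) (z : ℂ) : ℂ[X] →ₗ[ℂ] ℂ := ∑ ν, κ μ ν • Y.transform ν z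

theorem kappaTransform_apply (μ : Fin X.d) (z : ℂ) (s : ℂ[X]) :
    kappaTransform κ μ z s = ∑ ν, κ μ ν * Y.transform ν z s := by
  simp [kappaTransform, LinearMap.sum_apply]

theorem hasDerivAt_kappaTransform (μ : Fin X.d) (z : ℂ) (s : ℂ[X]) :
    HasDerivAt (fun z => kappaTransform κ μ z s)
      (kappaTransform κ μ z (Polynomial.X * s)) z := by
  simp only [kappaTransform_apply]
  exact HasDerivAt.fun_sum fun ν _ => (Y.hasDerivAt_transform ν z s).const_mul _

/-- Fubini. The coefficient stays inside because convergence is known only where it is nonzero;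
elsewhere both sides vanish. -/
theorem integral_mul_density (hc : MomentsConverge X Y κ) (μ : Fin X.d) (ν : Fin Y.d)
    {f : ℂ → ℂ} (hf : X.Tempered f) (s : ℂ[X]) :
    Integrable (fun t => f (X.Γ μ t) * X.W (X.Γ μ t) * deriv (X.Γ μ) t *
      (κ μ ν * Y.transform ν (X.Γ μ t) s)) ∧
    κ μ ν * ∫ q : ℝ × ℝ, f (X.Γ μ q.1) * s.eval (Y.Γ ν q.2) * density X Y μ ν q =
      ∫ t, f (X.Γ μ t) * X.W (X.Γ μ t) * deriv (X.Γ μ) t *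
        (κ μ ν * Y.transform ν (X.Γ μ t) s) := by
  by_cases hκ : κ μ ν = 0
  · simp [hκ]
  have hint := integrable_mul_density hc hκ hf s
  have hinner : ∀ t, ∫ u, f (X.Γ μ t) * s.eval (Y.Γ ν u) * density X Y μ ν (t, u) =
      f (X.Γ μ t) * X.W (X.Γ μ t) * deriv (X.Γ μ) t * Y.transform ν (X.Γ μ t) s := fun t => by
    rw [transform_apply, ← integral_const_mul]
    congr 1; funext u
    rw [density]
    ring
  have hint' := (Integrable.integral_prod_left hint).const_mul (κ μ ν)
  simp only [hinner] at hint'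
  constructor
  · refine hint'.congr (ae_of_all _ fun t => ?_)
    simp only
    ring
  · rw [Measure.volume_eq_prod, integral_prod _ hint]
    simp only [hinner]
    rw [← integral_const_mul]
    congr 1; funext t
    ring

theorem integrable_kappaTransform (hc : MomentsConverge X Y κ) (μ : Fin X.d)
    {f : ℂ → ℂ} (hf : X.Tempered f) (s : ℂ[X]) :
    Integrable fun t => f (X.Γ μ t) * X.W (X.Γ μ t) * deriv (X.Γ μ) t *
      kappaTransform κ μ (X.Γ μ t) s := by
  simp only [kappaTransform_apply, Finset.mul_sum]
  exact integrable_finsetSum _ fun ν _ => (integral_mul_density hc μ ν hf s).1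

/-- Integrating out y leaves single integrals against an entire function, so linearity,
differentiation and integration by parts become one-variable statements. -/
theorem pairing_eq (hc : MomentsConverge X Y κ) {f : ℂ → ℂ} (hf : X.Tempered f) (s : ℂ[X]) :
    pairing X Y κ f (fun y => s.eval y) =
      ∑ μ, ∫ t, f (X.Γ μ t) * X.W (X.Γ μ t) * deriv (X.Γ μ) t *
        kappaTransform κ μ (X.Γ μ t) s := by
  unfold pairing
  refine Finset.sum_congr rfl fun μ _ => ?_
  simp only [kappaTransform_apply, Finset.mul_sum]
  rw [integral_finsetSum _ fun ν _ => (integral_mul_density hc μ ν hf s).1]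
  exact Finset.sum_congr rfl fun ν _ => (integral_mul_density hc μ ν hf s).2

theorem pairing_congr {f g : ℂ → ℂ} (h : ∀ μ t, f (X.Γ μ t) = g (X.Γ μ t)) (k : ℂ → ℂ) :
    pairing X Y κ f k = pairing X Y κ g k := by
  simp only [pairing, h]

theorem pairing_add_left (hc : MomentsConverge X Y κ) {f g : ℂ → ℂ} (hf : X.Tempered f)
    (hg : X.Tempered g) (s : ℂ[X]) :
    pairing X Y κ (fun z => f z + g z) (fun y => s.eval y) =
      pairing X Y κ f (fun y => s.eval y) + pairing X Y κ g (fun y => s.eval y) := by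
  rw [pairing_eq hc hf, pairing_eq hc hg, pairing_eq hc (hf.add hg), ← Finset.sum_add_distrib]
  refine Finset.sum_congr rfl fun μ _ => ?_
  rw [← integral_add (integrable_kappaTransform hc μ hf s) (integrable_kappaTransform hc μ hg s)]
  congr 1; funext t; ring

theorem pairing_const_mul_left (c : ℂ) (f k : ℂ → ℂ) :
    pairing X Y κ (fun z => c * f z) k = c * pairing X Y κ f k := by
  simp only [pairing, Finset.mul_sum]
  refine Finset.sum_congr rfl fun μ _ => Finset.sum_congr rfl fun ν _ => ?_
  rw [mul_left_comm]
  congr 1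
  rw [← integral_const_mul]
  congr 1; funext q; ring

/-- The pairing with a fixed function on the left, as a linear functional of polynomials. -/
def pairingRight (hc : MomentsConverge X Y κ) {f : ℂ → ℂ} (hf : X.Tempered f) : ℂ[X] →ₗ[ℂ] ℂ where
  toFun s := pairing X Y κ f (fun y => s.eval y)
  map_add' s s' := by
    rw [pairing_eq hc hf, pairing_eq hc hf, pairing_eq hc hf, ← Finset.sum_add_distrib]
    refine Finset.sum_congr rfl fun μ _ => ?_
    rw [← integral_add (integrable_kappaTransform hc μ hf s)
      (integrable_kappaTransform hc μ hf s')]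
    congr 1; funext t; rw [map_add]; ring
  map_smul' c s := by
    rw [pairing_eq hc hf, pairing_eq hc hf, RingHom.id_apply, smul_eq_mul, Finset.mul_sum]
    refine Finset.sum_congr rfl fun μ _ => ?_
    rw [← integral_const_mul]
    congr 1; funext t; rw [map_smul, smul_eq_mul]; ring

/-- Integration by parts in the second variable. -/
theorem pairing_adjoint_right (hc : MomentsConverge X Y κ) {f : ℂ → ℂ} (hf : X.Tempered f)
    (s : ℂ[X]) :
    pairing X Y κ f (fun y => (Y.A * s - Y.B * s.derivative).eval y) =
      pairing X Y κ (fun z => z * f z) (fun y => (Y.B * s).eval y) := by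
  have hzf : X.Tempered fun z => z * f z := by
    simpa using (moderate_eval (Polynomial.X)).mul_tempered hf
  rw [pairing_eq hc hf, pairing_eq hc hzf]
  refine Finset.sum_congr rfl fun μ _ => ?_
  congr 1; funext t
  have : kappaTransform κ μ (X.Γ μ t) (Y.A * s - Y.B * s.derivative) =
      X.Γ μ t * kappaTransform κ μ (X.Γ μ t) (Y.B * s) := by
    simp only [kappaTransform_apply, transform_adjoint, Finset.mul_sum]
    exact Finset.sum_congr rfl fun ν _ => by ring
  rw [this]; ring

end Functional

/-! ### Integration by parts in the first variable -/

section ByParts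

variable {X Y : ContourSystem} (κ : Fin X.d → Fin Y.d → ℂ)

/-- The boundary value at the end of `Γ_μ` along `l`, which vanishes unless that end is
a hard edge. -/
def edgeValue (f : ℂ → ℂ) (s : ℂ[X]) (μ : Fin X.d) (l : Filter ℝ) : ℂ :=
  open Classical in
  ∑ c ∈ hardEdges X.A X.B,
    if Tendsto (X.Γ μ) l (𝓝 c) then
      f c * limUnder l (fun t => X.W (X.Γ μ t)) * kappaTransform κ μ c s
    else 0

/-- The sum of all boundary terms. -/
def edgeTerm (f : ℂ → ℂ) (s : ℂ[X]) : ℂ :=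
  ∑ μ, (edgeValue κ f s μ atTop - edgeValue κ f s μ atBot)

variable {κ}

/-- A path has at most one limit, so the sum over the hard edges has at most one term. -/
theorem edgeValue_of_tendsto {l : Filter ℝ} [l.NeBot] {μ : Fin X.d} {c : ℂ}
    (h : Tendsto (X.Γ μ) l (𝓝 c)) (f : ℂ → ℂ) (s : ℂ[X]) :
    edgeValue κ f s μ l = if c ∈ hardEdges X.A X.B then
      f c * limUnder l (fun t => X.W (X.Γ μ t)) * kappaTransform κ μ c s else 0 := by
  have hiff : ∀ c', Tendsto (X.Γ μ) l (𝓝 c') ↔ c' = c := fun c' =>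
    ⟨fun h' => tendsto_nhds_unique h' h, fun h' => h' ▸ h⟩
  simp only [edgeValue, hiff]
  rw [Finset.sum_ite_eq']

/-- At a finite end the weight converges, with nonzero limit only at hard edges. At an infinite end
the product and its derivative are integrable, which gives the limit 0 without comparing the growth
of the transform with the decay of the weight. -/
theorem tendsto_edgeValue (hc : MomentsConverge X Y κ) {l : Filter ℝ} (hl : IsEnd l) (μ : Fin X.d)
    {f : ℂ → ℂ} (hf : X.Moderate f) (hfc : ∀ z ∈ X.support, ContinuousAt f z) (s : ℂ[X])
    (hend : IsAdmissibleEnd X.A X.B X.W (X.Γ μ) l) {F' : ℝ → ℂ}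
    (hder : ∀ t, HasDerivAt
      (fun t => f (X.Γ μ t) * X.W (X.Γ μ t) * kappaTransform κ μ (X.Γ μ t) s) (F' t) t)
    (hint : Integrable F') :
    Tendsto (fun t => f (X.Γ μ t) * X.W (X.Γ μ t) * kappaTransform κ μ (X.Γ μ t) s) l
      (𝓝 (edgeValue κ f s μ l)) := by
  have := hl.neBot
  rcases hend.cases hl X.B_ne_zero X.isWeight (X.admissible μ) with
    ⟨hinf, -⟩ | ⟨c, w, -, hlim, hw, hw0, -⟩
  · have h0 : edgeValue κ f s μ l = 0 := by
      refine Finset.sum_eq_zero fun c _ => if_neg fun h => ?_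
      exact not_tendsto_nhds_of_tendsto_atTop hinf _ h.norm
    rw [h0]
    refine tendsto_zero_of_integrable hl (X.admissible μ).contDiff hder hint ?_ hinf
    refine (integrable_kappaTransform hc μ hf.tempered s).congr (ae_of_all _ fun t => ?_)
    simp only
    ring
  · have hcs : c ∈ X.support := mem_closure_of_tendsto hlim
      (Eventually.of_forall fun t => Set.mem_iUnion.2 ⟨μ, t, rfl⟩)
    have hk : ContinuousAt (fun z => kappaTransform κ μ z s) c :=
      (hasDerivAt_kappaTransform μ c s).continuousAt
    have hF := (((hfc c hcs).tendsto.comp hlim).mul hw).mul (hk.tendsto.comp hlim)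
    have he : edgeValue κ f s μ l = f c * w * kappaTransform κ μ c s := by
      rw [edgeValue_of_tendsto hlim, hw.limUnder_eq]
      split_ifs with h
      · rfl
      · rw [hw0 h]; ring
    rw [he]
    exact hF

theorem tempered_dV : X.Tempered X.dV := by
  refine ((moderate_eval (softNum X.A X.B)).mul_tempered tempered_softDen_inv).congr fun μ t => ?_
  rw [dV, potDeriv_eq X.B_ne_zero (X.eval_ne_zero μ t), div_eq_mul_inv]

/-- Integration by parts in the first variable, with the boundary terms at the hard edges. -/
theorem pairing_X_mul_right (hc : MomentsConverge X Y κ) {f f' : ℂ → ℂ} (hf : X.Moderate f)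
    (hf' : X.Moderate f') (hder : ∀ z ∈ X.support, HasDerivAt f (f' z) z) (s : ℂ[X]) :
    pairing X Y κ f (fun y => (Polynomial.X * s).eval y) =
      edgeTerm κ f s - pairing X Y κ f' (fun y => s.eval y) +
        pairing X Y κ (fun z => f z * X.dV z) (fun y => s.eval y) := by
  have hfV := hf.mul_tempered (tempered_dV (X := X))
  rw [pairing_eq hc hf.tempered, pairing_eq hc hf'.tempered, pairing_eq hc hfV, edgeTerm,
    ← Finset.sum_sub_distrib, ← Finset.sum_add_distrib]
  refine Finset.sum_congr rfl fun μ _ => ?_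
  have hadm := X.admissible μ
  have hi1 := integrable_kappaTransform hc μ hf.tempered (Polynomial.X * s)
  have hi2 := integrable_kappaTransform hc μ hf'.tempered s
  have hi3 := integrable_kappaTransform hc μ hfV s
  have hF : ∀ t, HasDerivAt
      (fun t => f (X.Γ μ t) * X.W (X.Γ μ t) * kappaTransform κ μ (X.Γ μ t) s)
      (f (X.Γ μ t) * X.W (X.Γ μ t) * deriv (X.Γ μ) t *
          kappaTransform κ μ (X.Γ μ t) (Polynomial.X * s) +
        f' (X.Γ μ t) * X.W (X.Γ μ t) * deriv (X.Γ μ) t * kappaTransform κ μ (X.Γ μ t) s -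
        f (X.Γ μ t) * X.dV (X.Γ μ t) * X.W (X.Γ μ t) * deriv (X.Γ μ) t *
          kappaTransform κ μ (X.Γ μ t) s) t := by
    intro t
    have hg := hadm.hasDerivAt t
    have h1 := (hder _ (subset_closure (Set.mem_iUnion.2 ⟨μ, t, rfl⟩))).comp t hg
    have h2 := hadm.hasDerivAt_weight X.isWeight t
    have h3 := (hasDerivAt_kappaTransform (κ := κ) μ (X.Γ μ t) s).comp t hg
    refine ((h1.mul h2).mul h3).congr_deriv ?_
    simp only [Function.comp, Pi.mul_apply, dV]
    ring
  have hint := (hi1.add hi2).sub hi3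
  have hfc : ∀ z ∈ X.support, ContinuousAt f z := fun z hz => (hder z hz).continuousAt
  have key : ∃ a b, Tendsto (fun t => f (X.Γ μ t) * X.W (X.Γ μ t) * kappaTransform κ μ (X.Γ μ t) s)
      atBot (𝓝 a) ∧ Tendsto (fun t => f (X.Γ μ t) * X.W (X.Γ μ t) * kappaTransform κ μ (X.Γ μ t) s)
      atTop (𝓝 b) ∧ b - a = edgeValue κ f s μ atTop - edgeValue κ f s μ atBot := by
    rcases hadm.ends with ⟨z, hz, h1, h2⟩ | ⟨h1, h2⟩
    · have hzs : z ∈ X.support := mem_closure_of_tendsto h1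
        (Eventually.of_forall fun t => Set.mem_iUnion.2 ⟨μ, t, rfl⟩)
      have hlim : Tendsto (fun z => f z * X.W z * kappaTransform κ μ z s) (𝓝 z)
          (𝓝 (f z * X.W z * kappaTransform κ μ z s)) :=
        ((hfc z hzs).tendsto.mul (X.isWeight.continuousAt hz)).mul
          (hasDerivAt_kappaTransform μ z s).continuousAt
      -- The base point of a loop lies in `D`, where B has no zeros, so both edge values vanish
      -- while the two limits agree.
      have hnot : z ∉ hardEdges X.A X.B := fun h =>
        X.isWeight.eval_ne_zero z hz ((mem_hardEdges X.B_ne_zero).1 h).1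
      refine ⟨_, _, hlim.comp h1, hlim.comp h2, ?_⟩
      simp only [edgeValue_of_tendsto h1, edgeValue_of_tendsto h2, hnot, if_false, sub_self]
    · exact ⟨_, _, tendsto_edgeValue hc (Or.inl rfl) μ hf hfc s h1 hF hint,
        tendsto_edgeValue hc (Or.inr rfl) μ hf hfc s h2 hF hint, rfl⟩
  obtain ⟨a, b, ha, hb, hab⟩ := key
  have := integral_of_hasDerivAt_of_tendsto hF hint ha hb
  have hsub := integral_sub (hi1.add hi2) hi3
  simp only [Pi.add_apply] at hsub
  rw [hab, hsub, integral_add hi1 hi2] at this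
  linear_combination this

/-- On the disc of half the distance from x to the support, |z - ξ| ≥ r/2 for every contour point ξ,
which dominates the derivative of the Cauchy kernel uniformly. -/
theorem hasDerivAt_pairing_inv_sub (hc : MomentsConverge X Y κ) {x : ℂ} (hx : x ∉ X.support)
    (s : ℂ[X]) :
    HasDerivAt (fun z => pairing X Y κ (fun ξ => (z - ξ)⁻¹) (fun y => s.eval y))
      (-pairing X Y κ (fun ξ => (x - ξ)⁻¹ * (x - ξ)⁻¹) (fun y => s.eval y)) x := by
  have hopen : IsOpen X.supportᶜ := isClosed_closure.isOpen_compl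
  obtain ⟨r, hr, hball⟩ := Metric.isOpen_iff.1 hopen x hx
  have hmem : ∀ μ t, X.Γ μ t ∈ X.support := fun μ t =>
    subset_closure (Set.mem_iUnion.2 ⟨μ, t, rfl⟩)
  have hr2 : 0 < r / 2 := half_pos hr
  have hsub : ∀ z ∈ Metric.ball x (r / 2), z ∉ X.support := fun z hz =>
    hball (Metric.ball_subset_ball (half_le_self hr.le) hz)
  have hle : ∀ z ∈ Metric.ball x (r / 2), ∀ μ t, r / 2 ≤ ‖z - X.Γ μ t‖ := by
    intro z hz μ t
    by_contra h
    have h1 : dist (X.Γ μ t) z < r / 2 := by rw [dist_comm, dist_eq_norm]; exact not_le.1 h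
    have h2 : dist (X.Γ μ t) x < r := by
      have := dist_triangle (X.Γ μ t) z x
      have := Metric.mem_ball.1 hz
      linarith
    exact hball (Metric.mem_ball.2 h2) (hmem μ t)
  have hev : ∀ᶠ z in 𝓝 x, pairing X Y κ (fun ξ => (z - ξ)⁻¹) (fun y => s.eval y) =
      ∑ μ, ∫ t, (z - X.Γ μ t)⁻¹ * X.W (X.Γ μ t) * deriv (X.Γ μ) t *
        kappaTransform κ μ (X.Γ μ t) s := by
    filter_upwards [Metric.ball_mem_nhds x hr2] with z hz
    exact pairing_eq hc (moderate_inv_sub (hsub z hz)).tempered s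
  have hm := moderate_inv_sub hx
  refine HasDerivAt.congr_of_eventuallyEq ?_ hev
  rw [pairing_eq hc (hm.mul hm).tempered, ← Finset.sum_neg_distrib]
  refine HasDerivAt.fun_sum fun μ _ => ?_
  have hg := integrable_kappaTransform hc μ (tempered_one (X := X)) s
  rw [← integral_neg]
  obtain ⟨g, hgeq⟩ : ∃ g : ℝ → ℂ, ∀ t, g t = X.W (X.Γ μ t) * deriv (X.Γ μ) t *
      kappaTransform κ μ (X.Γ μ t) s := ⟨_, fun _ => rfl⟩
  have hF : ∀ z, (fun t => (z - X.Γ μ t)⁻¹ * X.W (X.Γ μ t) * deriv (X.Γ μ) t *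
      kappaTransform κ μ (X.Γ μ t) s) = fun t => (z - X.Γ μ t)⁻¹ * g t := fun z => by
    funext t; rw [hgeq]; ring
  have hF' : (fun t => -((x - X.Γ μ t)⁻¹ * (x - X.Γ μ t)⁻¹ * X.W (X.Γ μ t) * deriv (X.Γ μ) t *
      kappaTransform κ μ (X.Γ μ t) s)) =
      fun t => -((x - X.Γ μ t)⁻¹ * (x - X.Γ μ t)⁻¹ * g t) := by
    funext t; rw [hgeq]; ring
  have hgi : Integrable g := hg.congr (ae_of_all _ fun t => by simp only [hgeq]; ring)
  have hFi : ∀ z ∈ Metric.ball x (r / 2), Integrable fun t => (z - X.Γ μ t)⁻¹ * g t :=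
    fun z hz => by
      rw [← hF]
      exact integrable_kappaTransform hc μ (moderate_inv_sub (hsub z hz)).tempered s
  have hFi' : Integrable fun t => -((x - X.Γ μ t)⁻¹ * (x - X.Γ μ t)⁻¹ * g t) := by
    rw [← hF']
    exact (integrable_kappaTransform hc μ (hm.mul hm).tempered s).neg
  simp only [hF]
  rw [hF']
  refine hasDerivAt_integral_of_bound hr2
    (F' := fun z t => -((z - X.Γ μ t)⁻¹ * (z - X.Γ μ t)⁻¹ * g t))
    (bound := fun t => ((r / 2)⁻¹ * (r / 2)⁻¹) * ‖g t‖) hFi hFi'.aestronglyMeasurable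
    (fun t z hz => ?_) (hgi.norm.const_mul _) fun t z hz => ?_
  · rw [norm_neg, norm_mul, norm_mul, norm_inv]
    have := hle z hz μ t
    gcongr
  · have hne : z - X.Γ μ t ≠ 0 := norm_pos_iff.1 (hr2.trans_le (hle z hz μ t))
    refine ((((hasDerivAt_id z).sub_const (X.Γ μ t)).inv hne).mul_const (g t)).congr_deriv ?_
    simp only [id]
    field_simp

end ByParts

/-! ### Biorthogonal expansions -/

theorem exists_eq_sum_smul {s : ℕ → ℂ[X]} (hs : ∀ n, (s n).degree = n) (N : ℕ) :
    ∀ f : ℂ[X], f.degree < N → ∃ c : ℕ → ℂ, f = ∑ k ∈ Finset.range N, c k • s k := by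
  induction N with
  | zero =>
    intro f hf
    exact ⟨0, by simpa using hf⟩
  | succ N ih =>
    intro f hf
    have hN : (s N).coeff N ≠ 0 := coeff_ne_zero_of_eq_degree (hs N)
    -- Subtracting the multiple of s_N with the same coefficient of degree N lowers the degree bound
    -- by one.
    obtain ⟨c, hc⟩ := ih (f - (f.coeff N / (s N).coeff N) • s N) <| by
      rw [degree_lt_iff_coeff_zero]
      intro m hm
      rw [coeff_sub, coeff_smul, smul_eq_mul]
      rcases hm.eq_or_lt with rfl | hlt
      · rw [div_mul_cancel₀ _ hN, sub_self]
      · have h0 : (s N).coeff m = 0 :=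
          coeff_eq_zero_of_degree_lt (by rw [hs]; exact_mod_cast hlt)
        rw [(degree_lt_iff_coeff_zero f (N + 1)).1 hf m hlt, h0, mul_zero, sub_zero]
    refine ⟨fun k => if k = N then f.coeff N / (s N).coeff N else c k, ?_⟩
    simp only [Finset.sum_range_succ, if_true]
    have : ∑ k ∈ Finset.range N, (if k = N then f.coeff N / (s N).coeff N else c k) • s k =
        ∑ k ∈ Finset.range N, c k • s k :=
      Finset.sum_congr rfl fun k hk => by rw [if_neg (Finset.mem_range.1 hk).ne]
    rw [this, ← hc, sub_add_cancel]

namespace IsBiorthonormal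

variable {M : ℂ[X] →ₗ[ℂ] ℂ[X] →ₗ[ℂ] ℂ} {p s : ℕ → ℂ[X]}

theorem flip (h : IsBiorthonormal (fun f g => M f g) p s) :
    IsBiorthonormal (fun f g => M.flip f g) s p where
  degree_left := h.degree_right
  degree_right := h.degree_left
  orthonormal n m := by
    rw [LinearMap.flip_apply, h.orthonormal m n]
    simp only [eq_comm]

theorem expand_right (h : IsBiorthonormal (fun f g => M f g) p s) {f : ℂ[X]} {N : ℕ}
    (hf : f.degree < N) : f = ∑ k ∈ Finset.range N, M (p k) f • s k := by
  obtain ⟨c, hc⟩ := exists_eq_sum_smul h.degree_right N f hf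
  have key : ∀ k ∈ Finset.range N, M (p k) f = c k := fun k hk => by
    rw [hc, map_sum]
    have hkj : ∀ j ∈ Finset.range N, M (p k) (c j • s j) = if k = j then c j else 0 := by
      intro j _
      have := h.orthonormal k j
      rw [map_smul, this, smul_eq_mul, mul_ite, mul_one, mul_zero]
    rw [Finset.sum_congr rfl hkj, Finset.sum_ite_eq, if_pos hk]
  conv_lhs => rw [hc]
  exact Finset.sum_congr rfl fun k hk => by rw [key k hk]

theorem expand_left (h : IsBiorthonormal (fun f g => M f g) p s) {f : ℂ[X]} {N : ℕ}
    (hf : f.degree < N) : f = ∑ k ∈ Finset.range N, M f (s k) • p k :=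
  h.flip.expand_right hf

theorem apply_right_eq_zero (h : IsBiorthonormal (fun f g => M f g) p s) {f : ℂ[X]} {n : ℕ}
    (hf : f.degree < n) : M (p n) f = 0 := by
  rw [h.expand_right hf, map_sum]
  refine Finset.sum_eq_zero fun k hk => ?_
  have := h.orthonormal n k
  rw [map_smul, this, if_neg (Finset.mem_range.1 hk).ne', smul_zero]

theorem apply_left_eq_zero (h : IsBiorthonormal (fun f g => M f g) p s) {f : ℂ[X]} {n : ℕ}
    (hf : f.degree < n) : M f (s n) = 0 :=
  h.flip.apply_right_eq_zero hf

/-- In the biorthogonal expansion only s_n reaches degree n. This identifies the extreme entries of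
the banded matrices through leading coefficients. -/
theorem apply_right_mul_coeff (h : IsBiorthonormal (fun f g => M f g) p s) {f : ℂ[X]} {n : ℕ}
    (hf : f.degree ≤ n) : M (p n) f * (s n).leadingCoeff = f.coeff n := by
  have hlt : f.degree < (n + 1 : ℕ) := hf.trans_lt (by exact_mod_cast n.lt_succ_self)
  conv_rhs => rw [h.expand_right hlt]
  rw [finsetSum_coeff, Finset.sum_range_succ, Finset.sum_eq_zero, zero_add, coeff_smul,
    smul_eq_mul, leadingCoeff, natDegree_eq_of_degree_eq_some (h.degree_right n)]
  intro k hk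
  rw [coeff_smul, coeff_eq_zero_of_degree_lt, smul_zero]
  rw [h.degree_right]
  exact_mod_cast Finset.mem_range.1 hk

theorem apply_left_mul_coeff (h : IsBiorthonormal (fun f g => M f g) p s) {f : ℂ[X]} {n : ℕ}
    (hf : f.degree ≤ n) : M f (s n) * (p n).leadingCoeff = f.coeff n :=
  h.flip.apply_right_mul_coeff hf

theorem leadingCoeff_left_ne_zero (h : IsBiorthonormal (fun f g => M f g) p s) (n : ℕ) :
    (p n).leadingCoeff ≠ 0 := by
  rw [leadingCoeff_ne_zero]
  intro h0
  have := h.degree_left n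
  simp [h0] at this

theorem natDegree_left (h : IsBiorthonormal (fun f g => M f g) p s) (n : ℕ) :
    (p n).natDegree = n :=
  natDegree_eq_of_degree_eq_some (h.degree_left n)

end IsBiorthonormal

/-! ### The bimoment functional as a bilinear map -/

section Bilinear

variable {X Y : ContourSystem} {κ : Fin X.d → Fin Y.d → ℂ}

theorem pairing_sum_left (hc : MomentsConverge X Y κ) {ι : Type*} (t : Finset ι) {f : ι → ℂ → ℂ}
    (hf : ∀ i, X.Tempered (f i)) (u : ι → ℂ) (s : ℂ[X]) :
    X.Tempered (fun z => ∑ i ∈ t, u i * f i z) ∧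
    pairing X Y κ (fun z => ∑ i ∈ t, u i * f i z) (fun y => s.eval y) =
      ∑ i ∈ t, u i * pairing X Y κ (f i) (fun y => s.eval y) := by
  classical
  induction t using Finset.induction_on with
  | empty =>
    refine ⟨by simpa using (tempered_one (X := X)).const_mul 0, ?_⟩
    simp only [Finset.sum_empty]
    simpa using pairing_const_mul_left (κ := κ) 0 (fun _ => 1) (fun y => s.eval y)
  | insert i t hi ih =>
    simp only [Finset.sum_insert hi]
    refine ⟨((hf i).const_mul _).add ih.1, ?_⟩
    rw [pairing_add_left hc ((hf i).const_mul _) ih.1, ih.2, pairing_const_mul_left]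

/-- The bimoment functional as a bilinear map. -/
def bimomentBilin (hc : MomentsConverge X Y κ) : ℂ[X] →ₗ[ℂ] ℂ[X] →ₗ[ℂ] ℂ :=
  LinearMap.mk₂ ℂ (bimoment X Y κ)
    (fun p p' s => by
      simp only [bimoment, eval_add]
      exact pairing_add_left hc (moderate_eval p).tempered (moderate_eval p').tempered s)
    (fun c p s => by
      simp only [bimoment, eval_smul, smul_eq_mul]
      exact pairing_const_mul_left _ _ _)
    (fun p s s' => (pairingRight hc (moderate_eval p).tempered).map_add s s')
    (fun c p s => (pairingRight hc (moderate_eval p).tempered).map_smul c s)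

theorem bimomentBilin_apply (hc : MomentsConverge X Y κ) (p s : ℂ[X]) :
    bimomentBilin hc p s = bimoment X Y κ p s := rfl

/-- The functional `𝓛̂` as a bilinear map. -/
def bimomentHatBilin (hc : MomentsConverge X Y κ) : ℂ[X] →ₗ[ℂ] ℂ[X] →ₗ[ℂ] ℂ :=
  (bimomentBilin hc).compl₂ (LinearMap.mulLeft ℂ Y.B)

theorem bimomentHatBilin_apply (hc : MomentsConverge X Y κ) (p s : ℂ[X]) :
    bimomentHatBilin hc p s = bimoment X Y κ p (Y.B * s) := rfl

/-- Integration by parts in the second variable, for polynomials. -/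
theorem bimoment_adjoint (hc : MomentsConverge X Y κ) (p s : ℂ[X]) :
    bimoment X Y κ p (Y.A * s - Y.B * s.derivative) =
      bimoment X Y κ (Polynomial.X * p) (Y.B * s) := by
  simp only [bimoment, eval_mul, eval_X, eval_sub]
  simpa using pairing_adjoint_right hc (moderate_eval p).tempered s

end Bilinear

/-! ### Band structure of the matrices L̂, Â and P. -/

namespace BOPs

variable {X Y : ContourSystem} {κ : Fin X.d → Fin Y.d → ℂ} (𝔅 : BOPs X Y κ)

theorem isBiorthonormal (hc : MomentsConverge X Y κ) :
    IsBiorthonormal (fun f g => bimomentBilin hc f g) 𝔅.p 𝔅.s := 𝔅.biorth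

theorem isBiorthonormalHat (hc : MomentsConverge X Y κ) :
    IsBiorthonormal (fun f g => bimomentHatBilin hc f g) 𝔅.ph 𝔅.sh := 𝔅.biorthHat

/-- The coefficients `𝓛(p_k | B₂ ŝ_n)`, including the diagonal ones. -/
def fullL (k n : ℕ) : ℂ := bimoment X Y κ (𝔅.p k) (Y.B * 𝔅.sh n)

theorem degree_B_mul_sh (n : ℕ) : (Y.B * 𝔅.sh n).degree < (n + Y.d : ℕ) := by
  rw [degree_mul, 𝔅.biorthHat.degree_right, degree_eq_natDegree Y.B_ne_zero]
  have := Y.degree_le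
  have h : Y.B.natDegree + n < n + Y.d := by unfold ContourSystem.d; omega
  exact_mod_cast h

theorem degree_B_mul_derivative (n : ℕ) :
    (Y.B * (𝔅.sh n).derivative).degree < (n + Y.d : ℕ) := by
  refine lt_of_le_of_lt ?_ (𝔅.degree_B_mul_sh n)
  rw [degree_mul, degree_mul]
  gcongr
  exact degree_derivative_le

theorem degree_A_mul_sh (n : ℕ) : (Y.A * 𝔅.sh n).degree = (n + Y.d : ℕ) := by
  have hA : Y.A ≠ 0 := by
    intro h
    have := Y.degree_le
    rw [h] at this
    simp at this
  rw [degree_mul, 𝔅.biorthHat.degree_right, degree_eq_natDegree hA, add_comm]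
  rfl

theorem degree_adjoint (n : ℕ) :
    (Y.A * 𝔅.sh n - Y.B * (𝔅.sh n).derivative).degree = (n + Y.d : ℕ) := by
  rw [degree_sub_eq_left_of_degree_lt, degree_A_mul_sh]
  rw [degree_A_mul_sh]
  exact 𝔅.degree_B_mul_derivative n

theorem Lhat_of_lt {k n : ℕ} (h : n < k) : 𝔅.Lhat k n = 𝔅.fullL k n := if_pos h

/-- Integration by parts in y moves the adjoint operator onto p_k as multiplication by x. Â thus has
two readings, columns expanded in s_k and rows in p̂_l, and each reading bounds the band on one
side. -/
theorem Ahat_eq (hc : MomentsConverge X Y κ) (k n : ℕ) :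
    𝔅.Ahat k n = bimomentHatBilin hc (Polynomial.X * 𝔅.p k) (𝔅.sh n) :=
  bimoment_adjoint hc _ _

theorem degree_X_mul_p (k : ℕ) :
    (Polynomial.X * 𝔅.p k).degree = ((k + 1 : ℕ) : WithBot ℕ) := by
  rw [degree_mul, degree_X, 𝔅.biorth.degree_left, add_comm]
  rfl

theorem Ahat_eq_zero_of_lt (hc : MomentsConverge X Y κ) {k n : ℕ} (h : k + 1 < n) :
    𝔅.Ahat k n = 0 := by
  rw [𝔅.Ahat_eq hc]
  refine (𝔅.isBiorthonormalHat hc).apply_left_eq_zero ?_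
  rw [𝔅.degree_X_mul_p]
  exact_mod_cast h

theorem Ahat_eq_zero_of_gt (hc : MomentsConverge X Y κ) {k n : ℕ} (h : n + Y.d < k) :
    𝔅.Ahat k n = 0 := by
  refine (𝔅.isBiorthonormal hc).apply_right_eq_zero ?_
  rw [𝔅.degree_adjoint]
  exact_mod_cast h

theorem Ahat_sub_diag_ne_zero (hc : MomentsConverge X Y κ) (n : ℕ) : 𝔅.Ahat n (n + 1) ≠ 0 := by
  rw [𝔅.Ahat_eq hc]
  intro h
  have := (𝔅.isBiorthonormalHat hc).apply_left_mul_coeff (𝔅.degree_X_mul_p n).le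
  rw [h, zero_mul, coeff_X_mul] at this
  have h2 := (𝔅.isBiorthonormal hc).leadingCoeff_left_ne_zero n
  rw [leadingCoeff, (𝔅.isBiorthonormal hc).natDegree_left] at h2
  exact h2 this.symm

theorem Ahat_top_ne_zero (hc : MomentsConverge X Y κ) (n : ℕ) : 𝔅.Ahat (n + Y.d) n ≠ 0 := by
  intro h
  have := (𝔅.isBiorthonormal hc).apply_right_mul_coeff (𝔅.degree_adjoint n).le
  rw [bimomentBilin_apply] at this
  unfold Ahat at h
  rw [h, zero_mul] at this
  refine coeff_ne_zero_of_eq_degree (𝔅.degree_adjoint n) this.symm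

theorem fullL_eq_zero_of_lt (hc : MomentsConverge X Y κ) {k n : ℕ} (h : k < n) :
    𝔅.fullL k n = 0 := by
  refine (𝔅.isBiorthonormalHat hc).apply_left_eq_zero (f := 𝔅.p k) ?_
  rw [𝔅.biorth.degree_left]
  exact_mod_cast h

/-- This is where the common leading coefficient of p_n and p̂_n enters. -/
theorem fullL_diag (hc : MomentsConverge X Y κ) (n : ℕ) : 𝔅.fullL n n = 1 := by
  have h := (𝔅.isBiorthonormalHat hc).apply_left_mul_coeff (𝔅.biorth.degree_left n).le
  have h2 : (𝔅.p n).coeff n = (𝔅.ph n).leadingCoeff := by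
    rw [𝔅.leadingCoeffHat_eq, leadingCoeff, (𝔅.isBiorthonormal hc).natDegree_left]
  rw [h2] at h
  exact mul_right_cancel₀ ((𝔅.isBiorthonormalHat hc).leadingCoeff_left_ne_zero n)
    (h.trans (one_mul _).symm)

theorem fullL_eq_zero_of_ge (hc : MomentsConverge X Y κ) {k n : ℕ} (h : n + Y.d ≤ k) :
    𝔅.fullL k n = 0 := by
  refine (𝔅.isBiorthonormal hc).apply_right_eq_zero ((𝔅.degree_B_mul_sh n).trans_le ?_)
  exact_mod_cast h

theorem P_eq_zero (hc : MomentsConverge X Y κ) {j k : ℕ} (h : k + 1 < j) : 𝔅.P j k = 0 := by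
  refine (𝔅.isBiorthonormal hc).apply_right_eq_zero ?_
  rw [degree_mul, degree_X, 𝔅.biorth.degree_right, add_comm]
  exact_mod_cast h

/-- The coefficients `𝓛(1 | B₂ ŝ_n)` vanish for `n ≥ 1`. -/
theorem bimoment_one_eq_zero (hc : MomentsConverge X Y κ) {n : ℕ} (hn : n ≠ 0) :
    bimoment X Y κ 1 (Y.B * 𝔅.sh n) = 0 := by
  refine (𝔅.isBiorthonormalHat hc).apply_left_eq_zero (f := 1) ?_
  rw [degree_one]
  exact_mod_cast Nat.pos_of_ne_zero hn

/-- The expansion of the constant 1 in the p̂_l has only the term l = 0. It makes the inhomogeneous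
term of a row contribute exactly -ε to the Christoffel-Darboux identity. -/
theorem bimoment_one_mul (hc : MomentsConverge X Y κ) (ξ : ℂ) :
    bimoment X Y κ 1 (Y.B * 𝔅.sh 0) * (𝔅.ph 0).eval ξ = 1 := by
  have h := (𝔅.isBiorthonormalHat hc).expand_left (f := 1) (N := 1)
    (by rw [degree_one]; exact_mod_cast one_pos)
  have h2 := congrArg (fun f => f.eval ξ) h
  rw [Finset.sum_range_one] at h2
  simpa [bimomentHatBilin_apply] using h2.symm

theorem fullL_expand_B (hc : MomentsConverge X Y κ) (n : ℕ) :
    Y.B * 𝔅.sh n = ∑ k ∈ Finset.range (n + Y.d + 1), 𝔅.fullL k n • 𝔅.s k :=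
  (𝔅.isBiorthonormal hc).expand_right ((𝔅.degree_B_mul_sh n).trans (by
    exact_mod_cast Nat.lt_succ_self _))

theorem Ahat_expand (hc : MomentsConverge X Y κ) (n : ℕ) :
    Y.A * 𝔅.sh n - Y.B * (𝔅.sh n).derivative =
      ∑ k ∈ Finset.range (n + Y.d + 1), 𝔅.Ahat k n • 𝔅.s k :=
  (𝔅.isBiorthonormal hc).expand_right ((𝔅.degree_adjoint n).le.trans_lt (by
    exact_mod_cast Nat.lt_succ_self _))

theorem p_expand (hc : MomentsConverge X Y κ) {k N : ℕ} (h : k < N) :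
    𝔅.p k = ∑ l ∈ Finset.range N, 𝔅.fullL k l • 𝔅.ph l :=
  (𝔅.isBiorthonormalHat hc).expand_left (by
    rw [𝔅.biorth.degree_left]; exact_mod_cast h)

theorem X_mul_p_expand (hc : MomentsConverge X Y κ) {k N : ℕ} (h : k + 1 < N) :
    Polynomial.X * 𝔅.p k = ∑ l ∈ Finset.range N, 𝔅.Ahat k l • 𝔅.ph l := by
  simp only [𝔅.Ahat_eq hc]
  refine (𝔅.isBiorthonormalHat hc).expand_left ?_
  rw [𝔅.degree_X_mul_p]; exact_mod_cast h

theorem X_mul_s_expand (hc : MomentsConverge X Y κ) {m N : ℕ} (h : m + 1 < N) :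
    Polynomial.X * 𝔅.s m = ∑ j ∈ Finset.range N, 𝔅.P j m • 𝔅.s j := by
  refine (𝔅.isBiorthonormal hc).expand_right ?_
  rw [degree_mul, degree_X, 𝔅.biorth.degree_right, add_comm]
  exact_mod_cast h

end BOPs

theorem sum_range_window {K m d : ℕ} (hK : m + d < K) {g : ℕ → ℂ}
    (hg : ∀ k < K, k < m ∨ m + d < k → g k = 0) :
    ∑ k ∈ Finset.range K, g k = ∑ a : Fin (d + 1), g (m + a) := by
  rw [Fin.sum_univ_eq_sum_range (fun a => g (m + a)) (d + 1)]
  have h := Finset.sum_Ico_eq_sum_range g m (m + (d + 1))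
  rw [Nat.add_sub_cancel_left] at h
  rw [← h, Finset.range_eq_Ico]
  symm
  refine Finset.sum_subset (fun k hk => ?_) fun k hk hk' => hg k ?_ ?_
  · rw [Finset.mem_Ico] at hk ⊢; omega
  · rw [Finset.mem_Ico] at hk; omega
  · rw [Finset.mem_Ico] at hk'; omega

theorem sum_range_window_sub {K n d : ℕ} (hK : n < K) {g : ℕ → ℂ}
    (hg : ∀ k < K, k + d < n ∨ n < k → g k = 0) :
    ∑ k ∈ Finset.range K, g k =
      ∑ a : Fin (d + 1), if n + a < d then 0 else g (n + a - d) := by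
  -- All indices are shifted up by d, so that the window starts at n and truncated subtraction does
  -- no harm.
  have h := sum_range_window (K := d + K) (m := n) (d := d) (by omega)
    (g := fun k => if k < d then 0 else g (k - d)) (fun k hk hk' => by
      by_cases h : k < d
      · simp [h]
      · simp only [h, if_false]
        exact hg _ (by omega) (by omega))
  rw [← h]
  symm
  rw [Finset.sum_range_add, Finset.sum_eq_zero, zero_add]
  · refine Finset.sum_congr rfl fun k _ => ?_
    rw [if_neg (by omega), Nat.add_sub_cancel_left]
  · intro k hk
    exact if_pos (Finset.mem_range.1 hk)

/-! ### The recurrence of the rows and the Christoffel-Darboux identity. -/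

namespace BOPs

variable {X Y : ContourSystem} {κ : Fin X.d → Fin Y.d → ℂ} (𝔅 : BOPs X Y κ)

/-- Linear functionals of the second polynomial that satisfy the equation of the Fourier-Laplace
transforms at `x`, up to an inhomogeneous term. -/
def IsRow (X Y : ContourSystem) (κ : Fin X.d → Fin Y.d → ℂ) (x ε : ℂ) (Λ : ℂ[X] →ₗ[ℂ] ℂ) : Prop :=
  ∀ t : ℂ[X], Λ (Y.A * t - Y.B * t.derivative) =
    x * Λ (Y.B * t) - ε * bimoment X Y κ 1 (Y.B * t)

/-- The entries of the matrix `Â - x L̂`. -/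
def recur (x : ℂ) (k l : ℕ) : ℂ := 𝔅.Ahat k l - x * 𝔅.fullL k l

theorem recur_eq_zero_of_lt (hc : MomentsConverge X Y κ) (x : ℂ) {k l : ℕ} (h : k + 1 < l) :
    𝔅.recur x k l = 0 := by
  rw [recur, 𝔅.Ahat_eq_zero_of_lt hc h, 𝔅.fullL_eq_zero_of_lt hc (by omega), mul_zero, sub_zero]

theorem recur_eq_zero_of_gt (hc : MomentsConverge X Y κ) (x : ℂ) {k l : ℕ} (h : l + Y.d < k) :
    𝔅.recur x k l = 0 := by
  rw [recur, 𝔅.Ahat_eq_zero_of_gt hc h, 𝔅.fullL_eq_zero_of_ge hc (by omega), mul_zero, sub_zero]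

section Row

variable {x ε : ℂ} {Λ : ℂ[X] →ₗ[ℂ] ℂ}

theorem sum_row_mul_recur (hc : MomentsConverge X Y κ) (hΛ : IsRow X Y κ x ε Λ) {l K : ℕ}
    (hK : l + Y.d < K) :
    ∑ k ∈ Finset.range K, Λ (𝔅.s k) * 𝔅.recur x k l =
      -ε * bimoment X Y κ 1 (Y.B * 𝔅.sh l) := by
  have h0 : ∑ k ∈ Finset.range K, Λ (𝔅.s k) * 𝔅.recur x k l =
      ∑ k ∈ Finset.range (l + Y.d + 1), Λ (𝔅.s k) * 𝔅.recur x k l := by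
    symm
    refine Finset.sum_subset (Finset.range_subset_range.2 (by omega)) fun k _ hk => ?_
    rw [𝔅.recur_eq_zero_of_gt hc x (by rw [Finset.mem_range] at hk; omega), mul_zero]
  have h := hΛ (𝔅.sh l)
  rw [𝔅.Ahat_expand hc, 𝔅.fullL_expand_B hc l, map_sum, map_sum, ← 𝔅.fullL_expand_B hc l] at h
  simp only [map_smul, smul_eq_mul] at h
  rw [h0]
  have h1 : ∑ k ∈ Finset.range (l + Y.d + 1), Λ (𝔅.s k) * 𝔅.recur x k l =
      ∑ k ∈ Finset.range (l + Y.d + 1), 𝔅.Ahat k l * Λ (𝔅.s k) -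
      x * ∑ k ∈ Finset.range (l + Y.d + 1), 𝔅.fullL k l * Λ (𝔅.s k) := by
    rw [Finset.mul_sum, ← Finset.sum_sub_distrib]
    exact Finset.sum_congr rfl fun k _ => by rw [recur]; ring
  rw [h1, h]
  ring

/-- Rows of Â expand x p_k and rows of L̂ expand p_k in the same basis p̂_l; the difference gives
the factor ξ - x. -/
theorem sum_recur_mul_ph (hc : MomentsConverge X Y κ) (x ξ : ℂ) {k K : ℕ} (hK : k + 1 < K) :
    ∑ l ∈ Finset.range K, 𝔅.recur x k l * (𝔅.ph l).eval ξ = (ξ - x) * (𝔅.p k).eval ξ := by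
  have h1 := congrArg (fun f => f.eval ξ) (𝔅.X_mul_p_expand hc hK)
  have h2 := congrArg (fun f => f.eval ξ) (𝔅.p_expand hc (Nat.lt_of_succ_lt hK))
  simp only [eval_mul, eval_X, eval_finsetSum, eval_smul, smul_eq_mul] at h1 h2
  rw [sub_mul, h1]
  rw [h2]
  rw [Finset.mul_sum, ← Finset.sum_sub_distrib]
  exact Finset.sum_congr rfl fun l _ => by rw [recur]; ring

/-- The Christoffel-Darboux identity. -/
theorem christoffel_darboux (hc : MomentsConverge X Y κ) (hΛ : IsRow X Y κ x ε Λ) {n : ℕ}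
    (hn : 1 ≤ n) (ξ : ℂ) :
    ∑ b, (∑ a : Fin (Y.d + 1), Λ (𝔅.s (n - 1 + a)) * 𝔅.cdMatrix n x a b) *
        (𝔅.hatWindow n b).eval ξ =
      -ε + (x - ξ) * ∑ j ∈ Finset.range n, Λ (𝔅.s j) * (𝔅.p j).eval ξ := by
  set K := n + Y.d + 1 with hKdef
  -- G is the summand of the commutator with Π_n. It vanishes unless exactly one of k, l is below n,
  -- and the bands then confine (k, l) to the displayed block.
  set G : ℕ → ℕ → ℂ := fun k l => Λ (𝔅.s k) * (𝔅.recur x k l *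
    ((if l < n then 1 else 0) - (if k < n then 1 else 0))) * (𝔅.ph l).eval ξ with hG
  have hwin : ∑ b, (∑ a : Fin (Y.d + 1), Λ (𝔅.s (n - 1 + a)) * 𝔅.cdMatrix n x a b) *
        (𝔅.hatWindow n b).eval ξ = ∑ l ∈ Finset.range K, ∑ k ∈ Finset.range K, G k l := by
    rw [sum_range_window_sub (n := n) (d := Y.d) (by omega)]
    · refine Finset.sum_congr rfl fun b _ => ?_
      split_ifs with hb
      · simp [hatWindow, hb]
      · rw [sum_range_window (m := n - 1) (d := Y.d) (by omega)]
        · rw [Finset.sum_mul]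
          refine Finset.sum_congr rfl fun a _ => ?_
          simp only [hG, hatWindow, cdMatrix, Matrix.of_apply, hb, if_false]
          congr 2
          -- `cdMatrix` uses the strictly lower L̂ and `recur` the one with unit diagonal; on the
          -- diagonal the commutator factor is zero, so they agree.
          by_cases hlt : n + b - Y.d < n - 1 + (a : ℕ)
          · rw [𝔅.Lhat_of_lt hlt, recur]
          · rcases (not_lt.1 hlt).eq_or_lt with heq | hlt'
            · rw [heq]; simp
            · by_cases hz : n - 1 + (a : ℕ) + 1 < n + b - Y.d
              · rw [𝔅.recur_eq_zero_of_lt hc x hz, 𝔅.Ahat_eq_zero_of_lt hc hz, Lhat,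
                  if_neg hlt]
                simp
              · rw [recur, 𝔅.fullL_eq_zero_of_lt hc hlt', Lhat, if_neg hlt]
        · intro k hk hk'
          simp only [hG]
          by_cases h1 : k < n
          · by_cases h2 : n + (b : ℕ) - Y.d < n
            · simp [h1, h2]
            · rw [𝔅.recur_eq_zero_of_lt hc x (by omega)]; simp
          · by_cases h2 : n + (b : ℕ) - Y.d < n
            · rw [𝔅.recur_eq_zero_of_gt hc x (by omega)]; simp
            · simp [h1, h2]
    · intro l hl hl'
      refine Finset.sum_eq_zero fun k hk => ?_
      simp only [hG]
      by_cases h1 : k < n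
      · by_cases h2 : l < n
        · simp [h1, h2]
        · rw [𝔅.recur_eq_zero_of_lt hc x (by omega)]; simp
      · by_cases h2 : l < n
        · rw [𝔅.recur_eq_zero_of_gt hc x (by omega)]; simp
        · simp [h1, h2]
  -- The two products in the commutator: with the projector on the columns, the row recurrence sums
  -- over k; with the projector on the rows, the expansion in p̂ sums over l.
  have hsplit : ∑ l ∈ Finset.range K, ∑ k ∈ Finset.range K, G k l =
      ∑ l ∈ Finset.range n, (∑ k ∈ Finset.range K, Λ (𝔅.s k) * 𝔅.recur x k l) *
        (𝔅.ph l).eval ξ -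
      ∑ k ∈ Finset.range n, Λ (𝔅.s k) *
        ∑ l ∈ Finset.range K, 𝔅.recur x k l * (𝔅.ph l).eval ξ := by
    have hsub : Finset.range n ⊆ Finset.range K := Finset.range_subset_range.2 (by omega)
    have e1 : ∑ l ∈ Finset.range n, (∑ k ∈ Finset.range K, Λ (𝔅.s k) * 𝔅.recur x k l) *
        (𝔅.ph l).eval ξ = ∑ l ∈ Finset.range K, ∑ k ∈ Finset.range K,
          (if l < n then 1 else 0) * (Λ (𝔅.s k) * 𝔅.recur x k l * (𝔅.ph l).eval ξ) := by
      symm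
      rw [← Finset.sum_subset hsub]
      · refine Finset.sum_congr rfl fun l hl => ?_
        rw [Finset.sum_mul]
        simp [Finset.mem_range.1 hl]
      · intro l _ hl
        rw [Finset.mem_range] at hl
        simp [hl]
    have e2 : ∑ k ∈ Finset.range n, Λ (𝔅.s k) *
        ∑ l ∈ Finset.range K, 𝔅.recur x k l * (𝔅.ph l).eval ξ =
        ∑ k ∈ Finset.range K, ∑ l ∈ Finset.range K,
          (if k < n then 1 else 0) * (Λ (𝔅.s k) * 𝔅.recur x k l * (𝔅.ph l).eval ξ) := by
      symm
      rw [← Finset.sum_subset hsub]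
      · refine Finset.sum_congr rfl fun k hk => ?_
        rw [Finset.mul_sum]
        simp [Finset.mem_range.1 hk, mul_assoc]
      · intro k _ hk
        rw [Finset.mem_range] at hk
        simp [hk]
    rw [e1, e2, Finset.sum_comm (s := Finset.range K) (t := Finset.range K) (f := fun k l =>
      (if k < n then (1 : ℂ) else 0) * (Λ (𝔅.s k) * 𝔅.recur x k l * (𝔅.ph l).eval ξ)),
      ← Finset.sum_sub_distrib]
    refine Finset.sum_congr rfl fun l _ => ?_
    rw [← Finset.sum_sub_distrib]
    refine Finset.sum_congr rfl fun k _ => ?_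
    simp only [hG]
    ring
  rw [hwin, hsplit]
  have h1 : ∑ l ∈ Finset.range n, (∑ k ∈ Finset.range K, Λ (𝔅.s k) * 𝔅.recur x k l) *
        (𝔅.ph l).eval ξ = -ε := by
    rw [Finset.sum_eq_single_of_mem 0 (Finset.mem_range.2 (by omega))]
    · rw [𝔅.sum_row_mul_recur hc hΛ (by omega), mul_assoc, 𝔅.bimoment_one_mul hc, mul_one]
    · intro l hl hl0
      rw [Finset.mem_range] at hl
      rw [𝔅.sum_row_mul_recur hc hΛ (by omega), 𝔅.bimoment_one_eq_zero hc hl0, mul_zero, zero_mul]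
  have h2 : ∑ k ∈ Finset.range n, Λ (𝔅.s k) *
        ∑ l ∈ Finset.range K, 𝔅.recur x k l * (𝔅.ph l).eval ξ =
      (ξ - x) * ∑ j ∈ Finset.range n, Λ (𝔅.s j) * (𝔅.p j).eval ξ := by
    rw [Finset.mul_sum]
    refine Finset.sum_congr rfl fun k hk => ?_
    rw [Finset.mem_range] at hk
    rw [𝔅.sum_recur_mul_ph hc x ξ (by omega)]
    ring
  rw [h1, h2]
  ring

/-! ### The ladder matrix -/

/-- The first column of the ladder matrix. -/
def ladderCol (n : ℕ) (x : ℂ) (a : ℕ) : ℂ :=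
  (x * (if a = 0 then 1 else 𝔅.Lhat (n + a) n) - 𝔅.Ahat (n + a) n) / 𝔅.Ahat (n - 1) n

theorem ladder_apply (n : ℕ) (x : ℂ) (a b : Fin (Y.d + 1)) :
    𝔅.ladder n x a b = (if (b : ℕ) = a + 1 then 1 else 0) +
      if (b : ℕ) = 0 then 𝔅.ladderCol n x a else 0 := rfl

theorem ladder_zero (n : ℕ) (x : ℂ) (a : Fin (Y.d + 1)) :
    𝔅.ladder n x a 0 = 𝔅.ladderCol n x a := by
  simp [ladder_apply]

theorem ladder_succ (n : ℕ) (x : ℂ) (a : Fin (Y.d + 1)) (b : Fin Y.d) :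
    𝔅.ladder n x a b.succ = if (b : ℕ) = a then 1 else 0 := by
  simp [ladder_apply]

theorem ladderCol_eq (hc : MomentsConverge X Y κ) (n : ℕ) (x : ℂ) (a : ℕ) :
    𝔅.ladderCol n x a = -𝔅.recur x (n + a) n / 𝔅.Ahat (n - 1) n := by
  rw [ladderCol, recur]
  congr 1
  split_ifs with h
  · rw [h, add_zero, 𝔅.fullL_diag hc]; ring
  · rw [𝔅.Lhat_of_lt (by omega)]; ring

/-- deg(B₂ŝ_n) < n + d₂ makes the coefficient of x vanish. The pivot of the ladder matrix is hence
constant, its inverse exists for all x and is polynomial in x. -/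
theorem ladderCol_last (hc : MomentsConverge X Y κ) (n : ℕ) (x : ℂ) :
    𝔅.ladderCol n x Y.d = -𝔅.Ahat (n + Y.d) n / 𝔅.Ahat (n - 1) n := by
  rw [𝔅.ladderCol_eq hc, recur, 𝔅.fullL_eq_zero_of_ge hc le_rfl, mul_zero, sub_zero]

theorem ladderCol_last_ne_zero (hc : MomentsConverge X Y κ) {n : ℕ} (hn : 1 ≤ n) (x : ℂ) :
    𝔅.ladderCol n x Y.d ≠ 0 := by
  rw [𝔅.ladderCol_last hc]
  have h := 𝔅.Ahat_sub_diag_ne_zero hc (n - 1)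
  rw [Nat.sub_add_cancel hn] at h
  exact div_ne_zero (neg_ne_zero.2 (𝔅.Ahat_top_ne_zero hc n)) h

/-- Column n of the recurrence, solved for its top entry, whose coefficient Â_{n-1,n} is nonzero.
The inhomogeneous term is absent because 1 is orthogonal to ŝ_n for n ≥ 1. -/
theorem row_eq_sum_ladderCol (hc : MomentsConverge X Y κ) (hΛ : IsRow X Y κ x ε Λ) {n : ℕ}
    (hn : 1 ≤ n) :
    Λ (𝔅.s (n - 1)) = ∑ a : Fin (Y.d + 1), Λ (𝔅.s (n + a)) * 𝔅.ladderCol n x a := by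
  have hne := 𝔅.Ahat_sub_diag_ne_zero hc (n - 1)
  rw [Nat.sub_add_cancel hn] at hne
  have h := 𝔅.sum_row_mul_recur hc hΛ (l := n) (K := n + Y.d + 1) (by omega)
  rw [𝔅.bimoment_one_eq_zero hc (by omega), mul_zero,
    sum_range_window (m := n - 1) (d := Y.d + 1) (by omega), Fin.sum_univ_succ] at h
  · simp only [Fin.val_zero, add_zero, Fin.val_succ] at h
    have hs : ∀ a : Fin (Y.d + 1), n - 1 + ((a : ℕ) + 1) = n + a := fun a => by omega
    simp only [hs] at h
    have hr : 𝔅.recur x (n - 1) n = 𝔅.Ahat (n - 1) n := by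
      rw [recur, 𝔅.fullL_eq_zero_of_lt hc (by omega), mul_zero, sub_zero]
    rw [hr] at h
    simp only [𝔅.ladderCol_eq hc]
    have h3 : ∑ a : Fin (Y.d + 1), Λ (𝔅.s (n + a)) * (-𝔅.recur x (n + a) n / 𝔅.Ahat (n - 1) n) =
        -(∑ a : Fin (Y.d + 1), Λ (𝔅.s (n + a)) * 𝔅.recur x (n + a) n) / 𝔅.Ahat (n - 1) n := by
      rw [← Finset.sum_neg_distrib, Finset.sum_div]
      exact Finset.sum_congr rfl fun a _ => by ring
    rw [h3, eq_div_iff hne]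
    linear_combination h
  · intro k _ hk
    rcases hk with hk | hk
    · rw [𝔅.recur_eq_zero_of_lt hc x (by omega), mul_zero]
    · rw [𝔅.recur_eq_zero_of_gt hc x (by omega), mul_zero]

theorem row_vecMul_ladder (hc : MomentsConverge X Y κ) (hΛ : IsRow X Y κ x ε Λ) {n : ℕ}
    (hn : 1 ≤ n) (b : Fin (Y.d + 1)) :
    ∑ a : Fin (Y.d + 1), Λ (𝔅.s (n + a)) * 𝔅.ladder n x a b = Λ (𝔅.s (n - 1 + b)) := by
  refine Fin.cases ?_ (fun b => ?_) b
  · simp only [ladder_zero]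
    exact (𝔅.row_eq_sum_ladderCol hc hΛ hn).symm
  · simp only [ladder_succ, Fin.val_succ]
    rw [Finset.sum_eq_single_of_mem b.castSucc (Finset.mem_univ _)]
    · rw [Fin.val_castSucc, if_pos rfl, mul_one]
      congr 2
      omega
    · intro a _ hab
      rw [if_neg, mul_zero]
      intro h
      exact hab (Fin.ext (by simp [h]))

/-- The inverse of the ladder matrix. -/
def ladderInv (n : ℕ) (x : ℂ) : Matrix (Fin (Y.d + 1)) (Fin (Y.d + 1)) ℂ :=
  Matrix.of fun a b => Fin.cases (if b = Fin.last Y.d then (𝔅.ladderCol n x Y.d)⁻¹ else 0)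
    (fun a => (if b = a.castSucc then 1 else 0) -
      if b = Fin.last Y.d then 𝔅.ladderCol n x a * (𝔅.ladderCol n x Y.d)⁻¹ else 0) a

theorem ladder_mul_ladderInv (hc : MomentsConverge X Y κ) {n : ℕ} (hn : 1 ≤ n) (x : ℂ) :
    𝔅.ladder n x * 𝔅.ladderInv n x = 1 := by
  have hne := 𝔅.ladderCol_last_ne_zero hc hn x
  ext a b
  rw [Matrix.mul_apply, Fin.sum_univ_succ, Matrix.one_apply]
  simp only [ladder_zero, ladder_succ, ladderInv, Matrix.of_apply, Fin.cases_zero, Fin.cases_succ]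
  refine Fin.lastCases ?_ (fun a => ?_) a
  · rw [Finset.sum_eq_zero, add_zero]
    · by_cases hb : b = Fin.last Y.d
      · simp [hb, hne]
      · simp [hb, Ne.symm hb]
    · intro j _
      rw [if_neg (by have := j.2; simp; omega), zero_mul]
  · rw [Finset.sum_eq_single_of_mem a (Finset.mem_univ _)]
    · simp only [Fin.val_castSucc, if_true, one_mul]
      by_cases hb : b = Fin.last Y.d
      · have hne := (Fin.castSucc_lt_last a).ne
        simp only [hb, if_true, hne, hne.symm, if_false]
        ring
      · simp only [hb, if_false, mul_zero, zero_add, sub_zero, eq_comm]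
    · intro j _ hj
      rw [if_neg, zero_mul]
      intro h
      exact hj (Fin.ext (by simpa using h))

theorem isUnit_ladder (hc : MomentsConverge X Y κ) {n : ℕ} (hn : 1 ≤ n) (x : ℂ) :
    IsUnit (𝔅.ladder n x) :=
  IsUnit.of_mul_eq_one _ (𝔅.ladder_mul_ladderInv hc hn x)

theorem inv_ladder (hc : MomentsConverge X Y κ) {n : ℕ} (hn : 1 ≤ n) (x : ℂ) :
    (𝔅.ladder n x)⁻¹ = 𝔅.ladderInv n x :=
  Matrix.inv_eq_right_inv (𝔅.ladder_mul_ladderInv hc hn x)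

theorem row_vecMul_inv_ladder (hc : MomentsConverge X Y κ) (hΛ : IsRow X Y κ x ε Λ) {n : ℕ}
    (hn : 1 ≤ n) (b : Fin (Y.d + 1)) :
    ∑ a : Fin (Y.d + 1), Λ (𝔅.s (n - 1 + a)) * (𝔅.ladder n x)⁻¹ a b = Λ (𝔅.s (n + b)) := by
  have hu := (Matrix.isUnit_iff_isUnit_det _).1 (𝔅.isUnit_ladder hc hn x)
  have hv : Matrix.vecMul (fun a : Fin (Y.d + 1) => Λ (𝔅.s (n + a))) (𝔅.ladder n x) =
      fun a : Fin (Y.d + 1) => Λ (𝔅.s (n - 1 + a)) :=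
    funext fun b => 𝔅.row_vecMul_ladder hc hΛ hn b
  have h := congrArg (fun v => Matrix.vecMul v (𝔅.ladder n x)⁻¹) hv
  simp only [Matrix.vecMul_vecMul, Matrix.mul_nonsing_inv _ hu, Matrix.vecMul_one] at h
  exact (congrFun h b).symm

end Row

end BOPs

/-! ### Linearity of the hard-edge terms. -/

section EdgeTerm

variable {X Y : ContourSystem} {κ : Fin X.d → Fin Y.d → ℂ}

theorem edgeTerm_congr {f g : ℂ → ℂ} (h : ∀ c ∈ hardEdges X.A X.B, f c = g c) (s : ℂ[X]) :
    edgeTerm κ f s = edgeTerm κ g s := by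
  have key : ∀ μ l, edgeValue κ f s μ l = edgeValue κ g s μ l := fun μ l =>
    Finset.sum_congr rfl fun c hc => by rw [h c hc]
  simp only [edgeTerm, key]

theorem edgeTerm_add (f g : ℂ → ℂ) (s : ℂ[X]) :
    edgeTerm κ (fun z => f z + g z) s = edgeTerm κ f s + edgeTerm κ g s := by
  have key : ∀ μ l, edgeValue κ (fun z => f z + g z) s μ l =
      edgeValue κ f s μ l + edgeValue κ g s μ l := fun μ l => by
    rw [edgeValue, edgeValue, edgeValue, ← Finset.sum_add_distrib]
    refine Finset.sum_congr rfl fun c _ => ?_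
    split_ifs <;> ring
  simp only [edgeTerm, key, ← Finset.sum_add_distrib]
  exact Finset.sum_congr rfl fun μ _ => by ring

theorem edgeTerm_const_mul (u : ℂ) (f : ℂ → ℂ) (s : ℂ[X]) :
    edgeTerm κ (fun z => u * f z) s = u * edgeTerm κ f s := by
  have key : ∀ μ l, edgeValue κ (fun z => u * f z) s μ l = u * edgeValue κ f s μ l :=
    fun μ l => by
      rw [edgeValue, edgeValue, Finset.mul_sum]
      refine Finset.sum_congr rfl fun c _ => ?_
      split_ifs <;> ring
  simp only [edgeTerm, key, ← mul_sub, Finset.mul_sum]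

theorem edgeTerm_sum {ι : Type*} (t : Finset ι) (u : ι → ℂ) (f : ι → ℂ → ℂ) (s : ℂ[X]) :
    edgeTerm κ (fun z => ∑ i ∈ t, u i * f i z) s = ∑ i ∈ t, u i * edgeTerm κ (f i) s := by
  classical
  induction t using Finset.induction_on with
  | empty =>
    simp only [Finset.sum_empty]
    simpa using edgeTerm_const_mul (κ := κ) 0 (fun _ => 1) s
  | insert i t hi ih =>
    simp only [Finset.sum_insert hi]
    rw [edgeTerm_add, edgeTerm_const_mul, ih]

end EdgeTerm

/-! ### The derivative of a row in terms of its window. -/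

namespace BOPs

variable {X Y : ContourSystem} {κ : Fin X.d → Fin Y.d → ℂ} (𝔅 : BOPs X Y κ)

theorem boundary_eq (n : ℕ) (x : ℂ) (a b : Fin (Y.d + 1)) :
    𝔅.boundary n x a b =
      edgeTerm κ (fun ρ => (𝔅.hatWindow n a).eval ρ * (x - ρ)⁻¹) (𝔅.s (n - 1 + b)) := by
  have key : ∀ μ l, 𝔅.endValue n x μ l a b =
      edgeValue κ (fun ρ => (𝔅.hatWindow n a).eval ρ * (x - ρ)⁻¹) (𝔅.s (n - 1 + b)) μ l :=
    fun μ l => Finset.sum_congr rfl fun c _ => by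
      have : 𝔅.phiKappa μ (n - 1 + b) c = kappaTransform κ μ c (𝔅.s (n - 1 + b)) := by
        rw [kappaTransform_apply]; rfl
      rw [this]
      split_ifs
      · rw [div_eq_mul_inv]; ring
      · rfl
  simp only [boundary, Matrix.of_apply, key, edgeTerm]

/-- The rational kernel `(V'(ρ) - V'(x)) / (ρ - x)` is tempered along the contours. -/
theorem tempered_dV_sub_div {x : ℂ} (hx : x ∉ X.support) :
    X.Tempered fun ρ => (X.dV ρ - X.dV x) / (ρ - x) := by
  have h1 := (moderate_inv_sub hx).mul_tempered
    ((tempered_dV (X := X)).add ((tempered_one (X := X)).const_mul (-X.dV x)))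
  refine (h1.const_mul (-1)).congr fun μ t => ?_
  have h2 : X.Γ μ t - x = -(x - X.Γ μ t) := by ring
  rw [h2, div_neg, div_eq_mul_inv]
  ring

section Row

variable {x ε : ℂ} {Λ : ℂ[X] →ₗ[ℂ] ℂ}

/-- The main identity: the derivative of a row of the fundamental system in terms of the window. -/
theorem row_X_mul (hc : MomentsConverge X Y κ) (hΛ : IsRow X Y κ x ε Λ) {n : ℕ}
    (hn : 1 ≤ n) (hxB : X.B.eval x ≠ 0) (hx : x ∉ X.support) (b : Fin (Y.d + 1)) :
    Λ (Polynomial.X * 𝔅.s (n - 1 + b)) +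
      ε * (pairing X Y κ (fun ρ => (X.dV ρ - X.dV x) / (ρ - x))
          (fun y => (𝔅.s (n - 1 + b)).eval y) -
        edgeTerm κ (fun ρ => (x - ρ)⁻¹) (𝔅.s (n - 1 + b))) =
      ∑ a : Fin (Y.d + 1), Λ (𝔅.s (n - 1 + a)) * 𝔅.coeffMatrix n x a b := by
  set m := n - 1 + (b : ℕ) with hm
  have hb := b.2
  -- The truncated kernel K; by Christoffel-Darboux its product with x - ξ is a combination of the
  -- p̂ window, up to ε.
  set Kp : ℂ[X] := ∑ j ∈ Finset.range n, Λ (𝔅.s j) • 𝔅.p j with hKp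
  set u : Fin (Y.d + 1) → ℂ := fun c =>
    ∑ a : Fin (Y.d + 1), Λ (𝔅.s (n - 1 + a)) * 𝔅.cdMatrix n x a c with hu
  have hcd : ∀ ξ, ∑ c, u c * (𝔅.hatWindow n c).eval ξ = -ε + (x - ξ) * Kp.eval ξ := fun ξ => by
    rw [𝔅.christoffel_darboux hc hΛ hn ξ, hKp, eval_finsetSum]
    simp only [eval_smul, smul_eq_mul]
  have hxc : ∀ c ∈ hardEdges X.A X.B, x - c ≠ 0 := fun c hc' h => by
    rw [sub_eq_zero] at h
    exact hxB (h ▸ ((mem_hardEdges X.B_ne_zero).1 hc').1)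
  have hxΓ : ∀ μ t, X.Γ μ t - x ≠ 0 := fun μ t h => by
    rw [sub_eq_zero] at h
    exact hx (h ▸ subset_closure (Set.mem_iUnion.2 ⟨μ, t, rfl⟩))
  set S : ℂ[X] := 𝔅.s m with hS
  have hvE : ∑ c, u c * 𝔅.boundary n x c b =
      edgeTerm κ (fun z => Kp.eval z) S - ε * edgeTerm κ (fun ρ => (x - ρ)⁻¹) S := by
    simp only [boundary_eq]
    rw [← edgeTerm_sum, edgeTerm_congr (g := fun z => Kp.eval z + (-ε) * (x - z)⁻¹),
      edgeTerm_add, edgeTerm_const_mul]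
    · ring
    · intro c hc'
      have hne := hxc c hc'
      simp only [← mul_assoc]
      rw [← Finset.sum_mul, hcd]
      field_simp
      ring
  have hTw := tempered_dV_sub_div hx
  have hTV := (moderate_eval (X := X) Kp).mul_tempered tempered_dV
  -- Substituting -ε + (x - ρ)K(ρ) cancels the denominator in the K part, leaving K(ρ)(V'(x) -
  -- V'(ρ)), and leaves the divided difference only with the coefficient -ε.
  have hvW : ∑ c, u c * 𝔅.potMatrix n x c b =
      -(pairing X Y κ (fun z => Kp.eval z * X.dV z) fun y => S.eval y) +
        X.dV x * bimoment X Y κ Kp S -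
        ε * pairing X Y κ (fun ρ => (X.dV ρ - X.dV x) / (ρ - x)) (fun y => S.eval y) := by
    simp only [potMatrix, Matrix.of_apply]
    rw [← (pairing_sum_left hc Finset.univ
      (fun c => (moderate_eval (𝔅.hatWindow n c)).mul_tempered hTw) u S).2]
    have hT2 := ((moderate_eval (X := X) Kp).tempered.const_mul (X.dV x))
    have e : ∀ μ t, ∑ c, u c * ((𝔅.hatWindow n c).eval (X.Γ μ t) *
        ((X.dV (X.Γ μ t) - X.dV x) / (X.Γ μ t - x))) =
        (-1 * (Kp.eval (X.Γ μ t) * X.dV (X.Γ μ t)) + X.dV x * Kp.eval (X.Γ μ t)) +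
          (-ε) * ((X.dV (X.Γ μ t) - X.dV x) / (X.Γ μ t - x)) := by
      intro μ t
      simp only [← mul_assoc (u _)]
      rw [← Finset.sum_mul, hcd]
      have := hxΓ μ t
      field_simp
      ring
    rw [pairing_congr
      (f := fun ρ => ∑ c, u c * ((𝔅.hatWindow n c).eval ρ * ((X.dV ρ - X.dV x) / (ρ - x))))
      (g := fun z => (-1 * (Kp.eval z * X.dV z) + X.dV x * Kp.eval z) +
        (-ε) * ((X.dV z - X.dV x) / (z - x))) e,
      pairing_add_left hc ((hTV.const_mul (-1)).add hT2) (hTw.const_mul (-ε)),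
      pairing_add_left hc (hTV.const_mul (-1)) hT2, pairing_const_mul_left, pairing_const_mul_left,
      pairing_const_mul_left, bimoment]
    ring
  -- K involves p_j with j < n and m ≥ n - 1, so only the first column m = n - 1 survives; this
  -- yields the corner entry V'(x) of `leadMatrix`.
  have hbim : bimoment X Y κ Kp S = if (b : ℕ) = 0 then Λ (𝔅.s (n - 1)) else 0 := by
    rw [← bimomentBilin_apply hc, hKp, map_sum, LinearMap.sum_apply]
    have hterm : ∀ j ∈ Finset.range n, (bimomentBilin hc (Λ (𝔅.s j) • 𝔅.p j)) S =
        if j = m then Λ (𝔅.s j) else 0 := by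
      intro j _
      have h1 := (𝔅.isBiorthonormal hc).orthonormal j m
      rw [map_smul, LinearMap.smul_apply, smul_eq_mul, h1, mul_ite, mul_one, mul_zero]
    rw [Finset.sum_congr rfl hterm, Finset.sum_ite_eq']
    by_cases h0 : (b : ℕ) = 0
    · have : m = n - 1 := by omega
      rw [if_pos h0, if_pos (Finset.mem_range.2 (by omega)), this]
    · rw [if_neg h0, if_neg (by rw [Finset.mem_range]; omega)]
  -- K' is a polynomial of degree below n - 1 ≤ m, hence orthogonal to s_m.
  have hder : pairing X Y κ (fun z => Kp.derivative.eval z) (fun y => S.eval y) = 0 := by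
    refine (𝔅.isBiorthonormal hc).apply_left_eq_zero (f := Kp.derivative) (n := m) ?_
    rw [degree_lt_iff_coeff_zero]
    intro i hi
    rw [coeff_derivative, hKp, finsetSum_coeff, Finset.sum_eq_zero, zero_mul]
    intro j hj
    rw [coeff_smul, coeff_eq_zero_of_degree_lt, smul_zero]
    rw [𝔅.biorth.degree_left]
    have : j < i + 1 := by rw [Finset.mem_range] at hj; omega
    exact_mod_cast this
  have hlow : ∑ j ∈ Finset.range n, 𝔅.P j m * Λ (𝔅.s j) =
      edgeTerm κ (fun z => Kp.eval z) S +
        pairing X Y κ (fun z => Kp.eval z * X.dV z) (fun y => S.eval y) := by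
    have h1 := pairing_X_mul_right hc (moderate_eval Kp) (moderate_eval Kp.derivative)
      (fun z _ => Kp.hasDerivAt z) S
    rw [hder, sub_zero] at h1
    rw [← h1]
    have h2 : pairing X Y κ (fun z => Kp.eval z) (fun y => (Polynomial.X * S).eval y) =
        bimomentBilin hc Kp (Polynomial.X * S) := rfl
    rw [h2, hKp, map_sum, LinearMap.sum_apply]
    refine Finset.sum_congr rfl fun j _ => ?_
    rw [map_smul, LinearMap.smul_apply, smul_eq_mul, mul_comm]
    rfl
  have hX : Λ (Polynomial.X * S) = ∑ j ∈ Finset.range n, 𝔅.P j m * Λ (𝔅.s j) +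
      ∑ i : Fin Y.d, 𝔅.P (n + i) m * Λ (𝔅.s (n + i)) +
      𝔅.P (n + Y.d) m * Λ (𝔅.s (n + Y.d)) := by
    rw [𝔅.X_mul_s_expand hc (N := n + (Y.d + 1)) (by omega), map_sum]
    simp only [map_smul, smul_eq_mul]
    rw [Finset.sum_range_add, Finset.sum_range_succ,
      Fin.sum_univ_eq_sum_range (fun i => 𝔅.P (n + i) m * Λ (𝔅.s (n + i))) Y.d, add_assoc]
  have hlead : ∑ a : Fin (Y.d + 1), Λ (𝔅.s (n - 1 + a)) * 𝔅.leadMatrix n x a b =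
      (if (b : ℕ) = 0 then Λ (𝔅.s (n - 1)) else 0) * X.dV x +
      ∑ i : Fin Y.d, 𝔅.P (n + i) m * Λ (𝔅.s (n + i)) := by
    rw [Fin.sum_univ_succ]
    congr 1
    · simp only [leadMatrix, Matrix.of_apply, Fin.val_zero, if_true, add_zero]
      split_ifs <;> ring
    · refine Finset.sum_congr rfl fun i _ => ?_
      have hi : n - 1 + ((i : ℕ) + 1) = n + i := by omega
      simp only [leadMatrix, Matrix.of_apply, Fin.val_succ, Nat.add_eq_zero_iff, one_ne_zero,
        and_false, if_false, hi]
      ring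
  have hdiag : ∑ a : Fin (Y.d + 1), Λ (𝔅.s (n - 1 + a)) * ((𝔅.ladder n x)⁻¹ *
      Matrix.diagonal (fun b : Fin (Y.d + 1) => 𝔅.P (n + Y.d) (n - 1 + b))) a b =
      𝔅.P (n + Y.d) m * Λ (𝔅.s (n + Y.d)) := by
    simp only [Matrix.mul_diagonal, ← mul_assoc]
    rw [← Finset.sum_mul, 𝔅.row_vecMul_inv_ladder hc hΛ hn, mul_comm]
    -- P_{n+d,m} is nonzero at most for the last column m = n + d - 1. There it multiplies
    -- Λ(s_{n+d}), the last entry of the next window.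
    by_cases hlast : (b : ℕ) = Y.d
    · rw [hm, hlast]
    · rw [𝔅.P_eq_zero hc (by omega), zero_mul, zero_mul]
  have hmul : ∀ N : Matrix (Fin (Y.d + 1)) (Fin (Y.d + 1)) ℂ,
      ∑ a : Fin (Y.d + 1), Λ (𝔅.s (n - 1 + a)) * (𝔅.cdMatrix n x * N) a b =
        ∑ c, u c * N c b := fun N => by
    simp only [hu, Matrix.mul_apply, Finset.mul_sum, Finset.sum_mul]
    rw [Finset.sum_comm]
    exact Finset.sum_congr rfl fun c _ => Finset.sum_congr rfl fun a _ => by ring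
  have htotal : ∑ a : Fin (Y.d + 1), Λ (𝔅.s (n - 1 + a)) * 𝔅.coeffMatrix n x a b =
      ∑ a : Fin (Y.d + 1), Λ (𝔅.s (n - 1 + a)) * 𝔅.leadMatrix n x a b +
      ∑ a : Fin (Y.d + 1), Λ (𝔅.s (n - 1 + a)) * ((𝔅.ladder n x)⁻¹ *
        Matrix.diagonal (fun b : Fin (Y.d + 1) => 𝔅.P (n + Y.d) (n - 1 + b))) a b +
      ∑ a : Fin (Y.d + 1), Λ (𝔅.s (n - 1 + a)) * (𝔅.cdMatrix n x * 𝔅.boundary n x) a b -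
      ∑ a : Fin (Y.d + 1), Λ (𝔅.s (n - 1 + a)) * (𝔅.cdMatrix n x * 𝔅.potMatrix n x) a b := by
    simp only [← Finset.sum_add_distrib, ← Finset.sum_sub_distrib]
    refine Finset.sum_congr rfl fun a _ => ?_
    rw [coeffMatrix, Matrix.sub_apply, Matrix.add_apply, Matrix.add_apply]
    ring
  rw [htotal, hlead, hdiag, hmul, hmul, hvE, hvW, hX, hlow, hbim]
  ring

end Row

/-! ### The rows of the fundamental system -/

theorem isRow_transform (ν : Fin Y.d) (x : ℂ) : IsRow X Y κ x 0 (Y.transform ν x) := fun t => by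
  rw [transform_adjoint, zero_mul, sub_zero]

/-- The functional `s ↦ e^{V₁(x)} 𝓛(1 / (x - ξ) | s)`. -/
def cauchyRow (hc : MomentsConverge X Y κ) {x : ℂ} (hx : x ∉ X.support) : ℂ[X] →ₗ[ℂ] ℂ :=
  (X.W x)⁻¹ • pairingRight hc (moderate_inv_sub hx).tempered

theorem cauchyRow_apply (hc : MomentsConverge X Y κ) {x : ℂ} (hx : x ∉ X.support) (s : ℂ[X]) :
    cauchyRow hc hx s =
      (X.W x)⁻¹ * pairing X Y κ (fun ξ => (x - ξ)⁻¹) (fun y => s.eval y) := rfl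

theorem sub_contour_ne_zero {x : ℂ} (hx : x ∉ X.support) (μ : Fin X.d) (t : ℝ) :
    x - X.Γ μ t ≠ 0 := fun h => by
  rw [sub_eq_zero] at h
  exact hx (h ▸ subset_closure (Set.mem_iUnion.2 ⟨μ, t, rfl⟩))

/-- The identity ξ/(x - ξ) = x/(x - ξ) - 1 turns multiplication by ξ into multiplication by x plus
the inhomogeneous term. -/
theorem isRow_cauchyRow (hc : MomentsConverge X Y κ) {x : ℂ} (hx : x ∉ X.support) :
    IsRow X Y κ x (X.W x)⁻¹ (cauchyRow hc hx) := fun t => by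
  have hT := (moderate_inv_sub hx).tempered
  have e : ∀ μ u, X.Γ μ u * (x - X.Γ μ u)⁻¹ =
      x * (x - X.Γ μ u)⁻¹ + -1 * (1 : ℂ[X]).eval (X.Γ μ u) := fun μ u => by
    have := sub_contour_ne_zero hx μ u
    rw [eval_one]
    field_simp
    ring
  have h := pairing_adjoint_right hc hT t
  rw [pairing_congr (f := fun z => z * (x - z)⁻¹)
    (g := fun z => x * (x - z)⁻¹ + -1 * (1 : ℂ[X]).eval z) e, pairing_add_left hc (hT.const_mul x)
    ((moderate_eval (X := X) 1).tempered.const_mul (-1)), pairing_const_mul_left,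
    pairing_const_mul_left] at h
  rw [cauchyRow_apply, cauchyRow_apply, h, bimoment]
  ring

/-- The factor 1/W contributes V'(x), the kernel contributes -(x - ξ)^(-2). Integration by parts in
ξ replaces the latter by multiplication by y, a hard-edge term and -V'(ξ)/(x - ξ); the two V' terms
combine into the divided difference. -/
theorem hasDerivAt_cauchyRow (hc : MomentsConverge X Y κ) {x : ℂ} (hxD : x ∈ X.D)
    (hx : x ∉ X.support) (s : ℂ[X]) :
    HasDerivAt (fun z => (X.W z)⁻¹ * pairing X Y κ (fun ξ => (z - ξ)⁻¹) (fun y => s.eval y))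
      (cauchyRow hc hx (Polynomial.X * s) + (X.W x)⁻¹ *
        (pairing X Y κ (fun ρ => (X.dV ρ - X.dV x) / (ρ - x)) (fun y => s.eval y) -
          edgeTerm κ (fun ρ => (x - ρ)⁻¹) s)) x := by
  have hW := X.isWeight.hasDerivAt x hxD
  have hne := X.isWeight.ne_zero x hxD
  have hm := moderate_inv_sub hx
  refine ((hW.inv hne).mul (hasDerivAt_pairing_inv_sub hc hx s)).congr_deriv ?_
  have hder : ∀ z ∈ X.support, HasDerivAt (fun ξ => (x - ξ)⁻¹) ((x - z)⁻¹ * (x - z)⁻¹) z := by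
    intro z hz
    have hxz : x - z ≠ 0 := fun h => hx (by rw [sub_eq_zero] at h; exact h ▸ hz)
    refine (((hasDerivAt_id z).const_sub x).inv hxz).congr_deriv ?_
    simp only [id]
    field_simp
  have hibp := pairing_X_mul_right (κ := κ) hc hm (hm.mul hm) hder s
  have hTV := hm.mul_tempered (tempered_dV (X := X))
  have e : ∀ μ u, (X.dV (X.Γ μ u) - X.dV x) / (X.Γ μ u - x) =
      X.dV x * (x - X.Γ μ u)⁻¹ + -1 * ((x - X.Γ μ u)⁻¹ * X.dV (X.Γ μ u)) := fun μ u => by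
    have h1 := sub_contour_ne_zero hx μ u
    have h2 : X.Γ μ u - x = -(x - X.Γ μ u) := by ring
    rw [h2]
    field_simp
    ring
  rw [cauchyRow_apply, hibp, pairing_congr (f := fun ρ => (X.dV ρ - X.dV x) / (ρ - x))
    (g := fun z => X.dV x * (x - z)⁻¹ + -1 * ((x - z)⁻¹ * X.dV z)) e, pairing_add_left hc
        (hm.tempered.const_mul _)
    (hTV.const_mul _), pairing_const_mul_left, pairing_const_mul_left]
  have hdV : potDeriv X.A X.B x = X.dV x := rfl
  rw [hdV, Pi.inv_apply]
  field_simp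
  ring

/-- The functionals whose values on the `s_m` are the rows of the fundamental system. -/
def row (hc : MomentsConverge X Y κ) {x : ℂ} (hx : x ∉ X.support) (r : Fin (Y.d + 1)) :
    ℂ[X] →ₗ[ℂ] ℂ := Fin.cases (cauchyRow hc hx) (fun ν => Y.transform ν x) r

variable (X Y) in
/-- The coefficients of the inhomogeneous terms of the rows. -/
def rowWeight (x : ℂ) (r : Fin (Y.d + 1)) : ℂ := Fin.cases (X.W x)⁻¹ (fun _ => 0) r

theorem isRow_row (hc : MomentsConverge X Y κ) {x : ℂ} (hx : x ∉ X.support) (r : Fin (Y.d + 1)) :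
    IsRow X Y κ x (rowWeight X Y x r) (row hc hx r) := by
  refine Fin.cases ?_ (fun ν => ?_) r
  · exact isRow_cauchyRow hc hx
  · exact isRow_transform ν x

theorem Phi_eq_row (hc : MomentsConverge X Y κ) {x : ℂ} (hx : x ∉ X.support) (n : ℕ)
    (r b : Fin (Y.d + 1)) : 𝔅.Phi n x r b = row hc hx r (𝔅.s (n - 1 + b)) := by
  refine Fin.cases ?_ (fun ν => ?_) r <;> rfl

theorem Phi_eq_mul_ladder (hc : MomentsConverge X Y κ) {x : ℂ} (hx : x ∉ X.support) {n : ℕ}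
    (hn : 1 ≤ n) : 𝔅.Phi n x = 𝔅.Phi (n + 1) x * 𝔅.ladder n x := by
  ext r b
  simp only [Matrix.mul_apply, 𝔅.Phi_eq_row hc hx, Nat.add_sub_cancel]
  exact (𝔅.row_vecMul_ladder hc (isRow_row hc hx r) hn b).symm

theorem hasDerivAt_Phi (hc : MomentsConverge X Y κ) {x : ℂ} (hxD : x ∈ X.D) (hx : x ∉ X.support)
    {n : ℕ} (hn : 1 ≤ n) (r b : Fin (Y.d + 1)) :
    HasDerivAt (fun z => 𝔅.Phi n z r b) ((𝔅.Phi n x * 𝔅.coeffMatrix n x) r b) x := by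
  have h := 𝔅.row_X_mul hc (isRow_row hc hx r) hn (X.isWeight.eval_ne_zero x hxD) hx b
  simp only [Matrix.mul_apply, 𝔅.Phi_eq_row hc hx]
  rw [← h]
  refine Fin.cases ?_ (fun ν => ?_) r
  · exact hasDerivAt_cauchyRow hc hxD hx _
  · refine (Y.hasDerivAt_transform ν x (𝔅.s (n - 1 + b))).congr_deriv ?_
    simp only [row, rowWeight, Fin.cases_succ, zero_mul, add_zero]

end BOPs

namespace BOPs

variable {X Y : ContourSystem} {κ : Fin X.d → Fin Y.d → ℂ} (𝔅 : BOPs X Y κ)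

/-! ### Invertibility of the fundamental system -/

section Vanishing

variable {x ε : ℂ} {Λ : ℂ[X] →ₗ[ℂ] ℂ}

/-- The ladder and its inverse carry the vanishing from one window to its neighbours in both
directions, and the s_k span all polynomials. -/
theorem row_eq_zero_of_window (hc : MomentsConverge X Y κ) (hΛ : IsRow X Y κ x ε Λ) {n : ℕ}
    (h : ∀ a : Fin (Y.d + 1), Λ (𝔅.s (n - 1 + a)) = 0) : Λ = 0 := by
  have h0 : ∀ k, ∀ a : Fin (Y.d + 1), Λ (𝔅.s (k + a)) = 0 := by
    have up : ∀ k, (∀ a : Fin (Y.d + 1), Λ (𝔅.s (k + a)) = 0) →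
        ∀ a : Fin (Y.d + 1), Λ (𝔅.s (k + 1 + a)) = 0 := fun k hk b => by
      rw [← 𝔅.row_vecMul_inv_ladder hc hΛ (n := k + 1) (by omega)]
      exact Finset.sum_eq_zero fun a _ => by rw [Nat.add_sub_cancel, hk, zero_mul]
    have down : ∀ k, (∀ a : Fin (Y.d + 1), Λ (𝔅.s (k + 1 + a)) = 0) →
        ∀ a : Fin (Y.d + 1), Λ (𝔅.s (k + a)) = 0 := fun k hk b => by
      have := 𝔅.row_vecMul_ladder hc hΛ (n := k + 1) (by omega) b
      rw [Nat.add_sub_cancel] at this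
      rw [← this]
      exact Finset.sum_eq_zero fun a _ => by rw [hk, zero_mul]
    have zero : ∀ a : Fin (Y.d + 1), Λ (𝔅.s (0 + a)) = 0 := by
      generalize n - 1 = k at h
      induction k with
      | zero => exact h
      | succ k ih => exact ih (down k h)
    intro k
    induction k with
    | zero => exact zero
    | succ k ih => exact up k ih
  refine LinearMap.ext fun f => ?_
  obtain ⟨c, hf⟩ := exists_eq_sum_smul 𝔅.biorth.degree_right (f.natDegree + 1) f
    (degree_le_natDegree.trans_lt (by exact_mod_cast Nat.lt_succ_self _))
  rw [hf, map_sum, LinearMap.zero_apply]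
  exact Finset.sum_eq_zero fun k _ => by rw [map_smul, show Λ (𝔅.s k) = 0 from h0 k 0, smul_zero]

theorem weight_eq_zero (𝔅 : BOPs X Y κ) (hc : MomentsConverge X Y κ) (h : IsRow X Y κ x ε 0) :
    ε = 0 := by
  have h1 := h (𝔅.sh 0)
  have h2 := left_ne_zero_of_mul_eq_one (𝔅.bimoment_one_mul hc 0)
  rw [LinearMap.zero_apply, LinearMap.zero_apply, mul_zero, zero_sub] at h1
  exact (mul_eq_zero.1 (neg_eq_zero.1 h1.symm)).resolve_right h2

theorem isRow_sum {ι : Type*} (t : Finset ι) (v : ι → ℂ) {η : ι → ℂ} {R : ι → ℂ[X] →ₗ[ℂ] ℂ}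
    (h : ∀ i, IsRow X Y κ x (η i) (R i)) :
    IsRow X Y κ x (∑ i ∈ t, v i * η i) (∑ i ∈ t, v i • R i) := fun f => by
  simp only [LinearMap.sum_apply, LinearMap.smul_apply, smul_eq_mul]
  rw [Finset.mul_sum, Finset.sum_mul, ← Finset.sum_sub_distrib]
  exact Finset.sum_congr rfl fun i _ => by rw [h i f]; ring

end Vanishing

/-- A combination of the transforms that vanishes on all polynomials at one point vanishes
identically. -/
theorem sum_transform_eq_zero {x : ℂ} {v : Fin Y.d → ℂ}
    (h : ∀ s : ℂ[X], ∑ ν, v ν * Y.transform ν x s = 0) (z : ℂ) :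
    ∑ ν, v ν * Y.transform ν z 1 = 0 := by
  have hder : ∀ s : ℂ[X], ∀ w, HasDerivAt (fun w => ∑ ν, v ν * Y.transform ν w s)
      (∑ ν, v ν * Y.transform ν w (Polynomial.X * s)) w := fun s w =>
    HasDerivAt.fun_sum fun ν _ => (Y.hasDerivAt_transform ν w s).const_mul (v ν)
  -- The Taylor coefficients at x are, up to factorials, the values on the monomials y^j, all zero
  -- by hypothesis.
  have hiter : ∀ j : ℕ, iteratedDeriv j (fun w => ∑ ν, v ν * Y.transform ν w 1) =
      fun w => ∑ ν, v ν * Y.transform ν w (Polynomial.X ^ j) := fun j => by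
    induction j with
    | zero => simp
    | succ j ih =>
      rw [iteratedDeriv_succ, ih]
      funext w
      rw [(hder _ w).deriv, pow_succ']
  have hsum := Complex.hasSum_taylorSeries_of_entire (fun w => (hder 1 w).differentiableAt) x z
  simp only [hiter, h, smul_zero] at hsum
  exact hsum.unique hasSum_zero

/-- A left null vector combines the rows into a functional that vanishes on the window, hence
everywhere. The inhomogeneous equation then kills the coefficient of the Cauchy row, and
independence of the transforms kills the others. -/
theorem isUnit_Phi (hc : MomentsConverge X Y κ) (hli : LinearIndependent ℂ
      (fun (ν : Fin Y.d) (x : ℂ) => Y.integral ν fun y => Complex.exp (x * y)))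
    {x : ℂ} (hxD : x ∈ X.D) (hx : x ∉ X.support) (n : ℕ) :
    IsUnit (𝔅.Phi n x) := by
  rw [← Matrix.vecMul_injective_iff_isUnit]
  refine (injective_iff_map_eq_zero (𝔅.Phi n x).vecMulLinear).2 ?_
  intro v hv
  have hrow := isRow_sum Finset.univ v (fun r => isRow_row (κ := κ) hc hx r)
  have hzero := 𝔅.row_eq_zero_of_window hc hrow (n := n) fun a => by
    have h := congrFun hv a
    rw [Matrix.vecMulLinear_apply] at h
    simp only [Matrix.vecMul, dotProduct, 𝔅.Phi_eq_row hc hx, Pi.zero_apply] at h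
    simpa only [LinearMap.sum_apply, LinearMap.smul_apply, smul_eq_mul] using h
  have hε := 𝔅.weight_eq_zero hc (hzero ▸ hrow)
  have hv0 : v 0 = 0 := by
    rw [Fin.sum_univ_succ] at hε
    simpa [rowWeight, X.isWeight.ne_zero x hxD] using hε
  have htr : ∀ s : ℂ[X], ∑ ν, v (Fin.succ ν) * Y.transform ν x s = 0 := fun s => by
    have h := LinearMap.congr_fun hzero s
    rw [Fin.sum_univ_succ, hv0, zero_smul, zero_add] at h
    simp only [LinearMap.sum_apply, LinearMap.smul_apply, smul_eq_mul] at h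
    exact h
  have hv' := Fintype.linearIndependent_iff.1 hli (fun ν => v ν.succ) (by
    funext z
    have h := sum_transform_eq_zero htr z
    simp only [transform_apply, eval_one, mul_one] at h
    simpa only [Finset.sum_apply, Pi.smul_apply, smul_eq_mul, Pi.zero_apply,
      ContourSystem.integral] using h)
  funext r
  exact Fin.cases hv0 hv' r

/-! ### Rationality of the coefficient matrix -/

variable (X) in
/-- Functions that agree with a polynomial off the contours and the zeros of `B`. -/
def AgreesWithPolynomial (f : ℂ → ℂ) : Prop :=
  ∃ p : ℂ[X], ∀ x, X.B.eval x ≠ 0 → x ∉ X.support → f x = p.eval x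

namespace AgreesWithPolynomial

variable {f g : ℂ → ℂ}

theorem of_eval (p : ℂ[X]) : AgreesWithPolynomial X fun x => p.eval x := ⟨p, fun _ _ _ => rfl⟩

theorem const (c : ℂ) : AgreesWithPolynomial X fun _ => c := ⟨C c, fun _ _ _ => eval_C.symm⟩

theorem id : AgreesWithPolynomial X fun x => x := ⟨Polynomial.X, fun _ _ _ => eval_X.symm⟩

theorem congr (hf : AgreesWithPolynomial X f)
    (h : ∀ x, X.B.eval x ≠ 0 → x ∉ X.support → g x = f x) : AgreesWithPolynomial X g := by
  obtain ⟨p, hp⟩ := hf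
  exact ⟨p, fun x h1 h2 => (h x h1 h2).trans (hp x h1 h2)⟩

theorem add (hf : AgreesWithPolynomial X f) (hg : AgreesWithPolynomial X g) :
    AgreesWithPolynomial X fun x => f x + g x := by
  obtain ⟨p, hp⟩ := hf
  obtain ⟨q, hq⟩ := hg
  exact ⟨p + q, fun x h1 h2 => by simp only [hp x h1 h2, hq x h1 h2, eval_add]⟩

theorem mul (hf : AgreesWithPolynomial X f) (hg : AgreesWithPolynomial X g) :
    AgreesWithPolynomial X fun x => f x * g x := by
  obtain ⟨p, hp⟩ := hf
  obtain ⟨q, hq⟩ := hg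
  exact ⟨p * q, fun x h1 h2 => by simp only [hp x h1 h2, hq x h1 h2, eval_mul]⟩

theorem sub (hf : AgreesWithPolynomial X f) (hg : AgreesWithPolynomial X g) :
    AgreesWithPolynomial X fun x => f x - g x :=
  (hf.add ((const (-1)).mul hg)).congr fun x _ _ => by ring

theorem sum {ι : Type*} {t : Finset ι} {f : ι → ℂ → ℂ}
    (hf : ∀ i ∈ t, AgreesWithPolynomial X (f i)) :
    AgreesWithPolynomial X fun x => ∑ i ∈ t, f i x := by
  classical
  induction t using Finset.induction_on with
  | empty => simpa using const (X := X) 0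
  | insert i t hi ih =>
    simp only [Finset.sum_insert hi]
    exact (hf i (Finset.mem_insert_self _ _)).add
      (ih fun j hj => hf j (Finset.mem_insert_of_mem hj))

theorem ite {P : Prop} {_ : Decidable P} (hf : AgreesWithPolynomial X f)
    (hg : AgreesWithPolynomial X g) : AgreesWithPolynomial X fun x => if P then f x else g x := by
  by_cases h : P
  · simpa only [h, if_true] using hf
  · simpa only [h, if_false] using hg

end AgreesWithPolynomial

open AgreesWithPolynomial

/-- The divided difference of a polynomial is a polynomial in both variables. -/
theorem exists_divided_difference (F : ℂ[X]) : ∃ G : ℂ[X][X], ∀ ρ x : ℂ,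
    F.eval ρ - F.eval x = (ρ - x) * (G.map (evalRingHom ρ)).eval x := by
  induction F using Polynomial.induction_on with
  | C a => exact ⟨0, fun ρ x => by simp⟩
  | add p q hp hq =>
    obtain ⟨G, hG⟩ := hp
    obtain ⟨H, hH⟩ := hq
    refine ⟨G + H, fun ρ x => ?_⟩
    rw [Polynomial.map_add, eval_add, eval_add, eval_add, mul_add, ← hG, ← hH]
    ring
  | monomial n a hn =>
    obtain ⟨G, hG⟩ := hn
    refine ⟨C Polynomial.X * G + (C a * Polynomial.X ^ n).map C, fun ρ x => ?_⟩
    have h1 : (((C a * Polynomial.X ^ n : ℂ[X]).map C).map (evalRingHom ρ)).eval x =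
        a * x ^ n := by simp
    have h2 := hG ρ x
    simp only [eval_mul, eval_C, eval_pow, eval_X] at h2
    rw [Polynomial.map_add, eval_add, h1, Polynomial.map_mul, Polynomial.map_C, eval_mul, eval_C,
      coe_evalRingHom, eval_X]
    simp only [eval_mul, eval_C, eval_pow, eval_X]
    linear_combination ρ * h2

theorem agrees_B_mul_dV : AgreesWithPolynomial X fun x => X.B.eval x * X.dV x :=
  ⟨X.A + X.B.derivative, fun x hx _ => by
    rw [eval_add]
    exact mul_div_cancel₀ _ hx⟩

/-- Each pole x = c is a hard edge, hence a zero of B. -/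
theorem agrees_B_mul_edgeTerm (f : ℂ → ℂ) (s : ℂ[X]) :
    AgreesWithPolynomial X fun x => X.B.eval x * edgeTerm κ (fun ρ => f ρ * (x - ρ)⁻¹) s := by
  have hval : ∀ c ∈ hardEdges X.A X.B,
      AgreesWithPolynomial X fun x => X.B.eval x * (f c * (x - c)⁻¹) := fun c hc => by
    obtain ⟨q, hq⟩ := dvd_iff_isRoot.2 ((mem_hardEdges X.B_ne_zero).1 hc).1
    refine ((const (f c)).mul (of_eval q)).congr fun x hx _ => ?_
    rw [hq, eval_mul, eval_sub, eval_X, eval_C] at hx ⊢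
    have := left_ne_zero_of_mul hx
    field_simp
  have hedge : ∀ μ l, AgreesWithPolynomial X fun x =>
      X.B.eval x * edgeValue κ (fun ρ => f ρ * (x - ρ)⁻¹) s μ l := fun μ l => by
    simp only [edgeValue, Finset.mul_sum, mul_ite, ← mul_assoc (X.B.eval _), mul_zero]
    refine AgreesWithPolynomial.sum fun c hc => AgreesWithPolynomial.ite ?_ (const 0)
    exact (((hval c hc).mul (const (limUnder l fun t => X.W (X.Γ μ t)))).mul
      (const (kappaTransform κ μ c s))).congr fun x _ _ => by ring
  simp only [edgeTerm, Finset.mul_sum, mul_sub]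
  exact AgreesWithPolynomial.sum fun μ _ => (hedge μ _).sub (hedge μ _)

/-- With V' = Q/S in lowest hard-edge form, S(x)S(ρ)(V'(ρ) - V'(x))/(ρ - x) is a polynomial in both
variables. Its coefficients in x pair convergently after division by S(ρ), and B(x) = H(x)S(x). -/
theorem agrees_B_mul_pairing (hc : MomentsConverge X Y κ) (p s : ℂ[X]) :
    AgreesWithPolynomial X fun x => X.B.eval x *
      pairing X Y κ (fun ρ => p.eval ρ * ((X.dV ρ - X.dV x) / (ρ - x))) (fun y => s.eval y) := by
  set Q := softNum X.A X.B with hQ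
  set S := softDen X.A X.B with hS
  set H := hardPart X.A X.B with hH
  obtain ⟨G₁, hG₁⟩ := exists_divided_difference Q
  obtain ⟨G₂, hG₂⟩ := exists_divided_difference S
  -- Chosen so that (ρ - x)K = Q(ρ)S(x) - Q(x)S(ρ), by subtracting and adding Q(x)S(x).
  set K : ℂ[X][X] := G₁ * S.map C - Q.map C * G₂ with hK
  have hKeval : ∀ ρ x, (K.map (evalRingHom ρ)).eval x =
      (G₁.map (evalRingHom ρ)).eval x * S.eval x - Q.eval x * (G₂.map (evalRingHom ρ)).eval x := by
    intro ρ x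
    have hC : ∀ F : ℂ[X], ((F.map C).map (evalRingHom ρ)).eval x = F.eval x := fun F => by
      rw [Polynomial.map_map, show (evalRingHom ρ).comp C = RingHom.id ℂ from
        RingHom.ext fun a => by simp, Polynomial.map_id]
    rw [hK, Polynomial.map_sub, Polynomial.map_mul, Polynomial.map_mul, eval_sub, eval_mul,
      eval_mul, hC, hC]
  have hKsum : ∀ ρ x, (K.map (evalRingHom ρ)).eval x =
      ∑ i ∈ Finset.range (K.natDegree + 1), x ^ i * (K.coeff i).eval ρ := fun ρ x => by
    rw [eval_map, eval₂_eq_sum_range]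
    exact Finset.sum_congr rfl fun i _ => by rw [coe_evalRingHom, mul_comm]
  have hT : ∀ i, X.Tempered fun ρ => (p * K.coeff i).eval ρ * (S.eval ρ)⁻¹ := fun i =>
    (moderate_eval _).mul_tempered tempered_softDen_inv
  refine ((of_eval H).mul (AgreesWithPolynomial.sum (t := Finset.range (K.natDegree + 1)) fun i _ =>
    (of_eval (Polynomial.X ^ i)).mul (const (pairing X Y κ
      (fun ρ => (p * K.coeff i).eval ρ * (S.eval ρ)⁻¹) fun y => s.eval y)))).congr
        fun x hx hxs => ?_
  simp only [eval_pow, eval_X]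
  rw [← (pairing_sum_left hc _ hT _ s).2, ← pairing_const_mul_left, ← pairing_const_mul_left]
  refine pairing_congr (fun μ t => ?_) _
  have hρ := X.eval_ne_zero μ t
  have hne := sub_contour_ne_zero hxs μ t
  generalize X.Γ μ t = ρ at hρ hne ⊢
  have hne' : ρ - x ≠ 0 := fun h => hne (by linear_combination -h)
  have e1 : ∑ i ∈ Finset.range (K.natDegree + 1), x ^ i * ((p * K.coeff i).eval ρ * (S.eval ρ)⁻¹) =
      p.eval ρ * (K.map (evalRingHom ρ)).eval x * (S.eval ρ)⁻¹ := by
    rw [hKsum, Finset.mul_sum, Finset.sum_mul]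
    exact Finset.sum_congr rfl fun i _ => by rw [eval_mul]; ring
  have hB : X.B.eval x = H.eval x * S.eval x := by
    rw [← eval_mul, hH, hS, hardPart_mul_softDen X.B_ne_zero]
  have hSx : S.eval x ≠ 0 := softDen_eval_ne_zero X.B_ne_zero hx
  have hSρ : S.eval ρ ≠ 0 := softDen_eval_ne_zero X.B_ne_zero hρ
  have hVx : X.dV x = Q.eval x / S.eval x := potDeriv_eq X.B_ne_zero hx
  have hVρ : X.dV ρ = Q.eval ρ / S.eval ρ := potDeriv_eq X.B_ne_zero hρ
  have h1 := hG₁ ρ x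
  have h2 := hG₂ ρ x
  rw [e1, hKeval, hB, hVx, hVρ]
  field_simp
  linear_combination (p.eval ρ * H.eval x) * (S.eval x * h1 - Q.eval x * h2)

theorem agrees_ladderCol (n a : ℕ) : AgreesWithPolynomial X fun x => 𝔅.ladderCol n x a := by
  simp only [ladderCol, div_eq_mul_inv]
  exact ((AgreesWithPolynomial.id.mul (const _)).sub (const _)).mul (const _)

theorem agrees_inv_ladder (hc : MomentsConverge X Y κ) {n : ℕ} (hn : 1 ≤ n)
    (a b : Fin (Y.d + 1)) : AgreesWithPolynomial X fun x => (𝔅.ladder n x)⁻¹ a b := by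
  simp only [𝔅.inv_ladder hc hn, ladderInv, Matrix.of_apply, 𝔅.ladderCol_last hc]
  refine Fin.cases ?_ (fun a => ?_) a
  · exact const _
  · exact (const _).sub
      (AgreesWithPolynomial.ite ((𝔅.agrees_ladderCol n a).mul (const _)) (const 0))

theorem agrees_cdMatrix (n : ℕ) (a b : Fin (Y.d + 1)) :
    AgreesWithPolynomial X fun x => 𝔅.cdMatrix n x a b := by
  simp only [cdMatrix, Matrix.of_apply]
  exact AgreesWithPolynomial.ite (const 0)
      (((const _).sub (AgreesWithPolynomial.id.mul (const _))).mul (const _))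

theorem agrees_B_mul_leadMatrix (n : ℕ) (a b : Fin (Y.d + 1)) :
    AgreesWithPolynomial X fun x => X.B.eval x * 𝔅.leadMatrix n x a b := by
  simp only [leadMatrix, Matrix.of_apply, mul_ite]
  exact AgreesWithPolynomial.ite
      (AgreesWithPolynomial.ite agrees_B_mul_dV ((of_eval _).mul (const 0))) ((of_eval _).mul (const _))

theorem agrees_B_mul_coeffMatrix (hc : MomentsConverge X Y κ) {n : ℕ} (hn : 1 ≤ n)
    (a b : Fin (Y.d + 1)) :
    AgreesWithPolynomial X fun x => X.B.eval x * 𝔅.coeffMatrix n x a b := by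
  have hbd : ∀ c, AgreesWithPolynomial X fun x =>
      𝔅.cdMatrix n x a c * (X.B.eval x * 𝔅.boundary n x c b) := fun c => by
    simp only [boundary_eq]
    exact (𝔅.agrees_cdMatrix n a c).mul (agrees_B_mul_edgeTerm _ _)
  have hpot : ∀ c, AgreesWithPolynomial X fun x =>
      𝔅.cdMatrix n x a c * (X.B.eval x * 𝔅.potMatrix n x c b) := fun c => by
    simp only [potMatrix, Matrix.of_apply]
    exact (𝔅.agrees_cdMatrix n a c).mul (agrees_B_mul_pairing hc _ _)
  have hlad := ((of_eval (X := X) X.B).mul (𝔅.agrees_inv_ladder hc hn a b)).mul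
    (const (𝔅.P (n + Y.d) (n - 1 + b)))
  refine ((((𝔅.agrees_B_mul_leadMatrix n a b).add hlad).add
    (AgreesWithPolynomial.sum (t := Finset.univ) fun c _ => hbd c)).sub
    (AgreesWithPolynomial.sum (t := Finset.univ) fun c _ => hpot c)).congr fun x _ _ => ?_
  rw [coeffMatrix, Matrix.sub_apply, Matrix.add_apply, Matrix.add_apply, Matrix.mul_diagonal,
    Matrix.mul_apply, Matrix.mul_apply, mul_sub, mul_add, mul_add, Finset.mul_sum, Finset.mul_sum]
  congr 1
  · congr 1
    · ring
    · exact Finset.sum_congr rfl fun c _ => by ring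
  · exact Finset.sum_congr rfl fun c _ => by ring

theorem exists_polynomial_matrix (hc : MomentsConverge X Y κ) {n : ℕ} (hn : 1 ≤ n) :
    ∃ N : Matrix (Fin (Y.d + 1)) (Fin (Y.d + 1)) ℂ[X],
      ∀ x : ℂ, X.B.eval x ≠ 0 → x ∉ X.support →
        X.B.eval x • 𝔅.coeffMatrix n x = N.map (Polynomial.eval x) := by
  choose N hN using fun a b => 𝔅.agrees_B_mul_coeffMatrix hc hn a b
  exact ⟨Matrix.of N, fun x hx hxs => Matrix.ext fun a b => hN a b x hx hxs⟩

/-! ### The matrix of multiplication by `y` -/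

/-- Pairing the relation with p_k picks out one coefficient on each side; above the Hessenberg band
the right-hand sum has no such term and B_{ik} is zero. -/
theorem P_eq_of_lower_triangular (hc : MomentsConverge X Y κ) {M B : ℕ → ℕ → ℂ}
    (hB : ∀ i k, i + 1 < k → B i k = 0)
    (h : ∀ i, Polynomial.X * (𝔅.s i + ∑ k ∈ Finset.range i, C (M i k) * 𝔅.s k) =
      ∑ k ∈ Finset.range (i + 2), C (B i k) * 𝔅.s k) (i k : ℕ) :
    𝔅.P k i + ∑ j ∈ Finset.range i, M i j * 𝔅.P k j = B i k := by
  have hi := congrArg (bimomentBilin hc (𝔅.p k)) (h i)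
  have hL : bimomentBilin hc (𝔅.p k)
      (Polynomial.X * (𝔅.s i + ∑ j ∈ Finset.range i, C (M i j) * 𝔅.s j)) =
      𝔅.P k i + ∑ j ∈ Finset.range i, M i j * 𝔅.P k j := by
    rw [mul_add, Finset.mul_sum, map_add, map_sum]
    congr 1
    refine Finset.sum_congr rfl fun j _ => ?_
    rw [mul_left_comm, ← smul_eq_C_mul, map_smul, smul_eq_mul]
    rfl
  rw [← hL, hi, map_sum]
  have hterm : ∀ j ∈ Finset.range (i + 2), bimomentBilin hc (𝔅.p k) (C (B i j) * 𝔅.s j) =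
      if k = j then B i j else 0 := fun j _ => by
    have := (𝔅.isBiorthonormal hc).orthonormal k j
    rw [← smul_eq_C_mul, map_smul, this, smul_eq_mul, mul_ite, mul_one, mul_zero]
  rw [Finset.sum_congr rfl hterm, Finset.sum_ite_eq]
  split_ifs with hk
  · rfl
  · rw [hB i k (by rw [Finset.mem_range] at hk; omega)]

end BOPs

end SemiBOP

end

theorem theorem4p3 (X Y : SemiBOP.ContourSystem) (κ : Fin X.d → Fin Y.d → ℂ)
    (hconv : X.A.natDegree = X.B.natDegree + 1 → Y.A.natDegree = Y.B.natDegree + 1 →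
      SemiBOP.MomentsConverge X Y κ)
    (𝔅 : SemiBOP.BOPs X Y κ) (n : ℕ) (hn : 1 ≤ n) :
    (∀ x : ℂ, IsUnit (𝔅.ladder n x)) ∧
    (∀ x ∈ X.D, x ∉ X.support → 𝔅.Phi n x = 𝔅.Phi (n + 1) x * 𝔅.ladder n x) ∧
    (∀ x ∈ X.D, x ∉ X.support →
      ∀ i j, HasDerivAt (fun z => 𝔅.Phi n z i j) ((𝔅.Phi n x * 𝔅.coeffMatrix n x) i j) x) ∧
    (LinearIndependent ℂ (fun (ν : Fin Y.d) (x : ℂ) => Y.integral ν fun y => Complex.exp (x * y)) →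
      ∀ x ∈ X.D, x ∉ X.support →
        IsUnit (𝔅.Phi n x) ∧ (𝔅.Phi n x)⁻¹ * 𝔅.dPhi n x = 𝔅.coeffMatrix n x) ∧
    (∃ N : Matrix (Fin (Y.d + 1)) (Fin (Y.d + 1)) (Polynomial ℂ),
      ∀ x : ℂ, X.B.eval x ≠ 0 → x ∉ X.support →
        X.B.eval x • 𝔅.coeffMatrix n x = N.map (Polynomial.eval x)) ∧
    (∀ M B : ℕ → ℕ → ℂ, (∀ i k, i + 1 < k → B i k = 0) →
      (∀ i, Polynomial.X * (𝔅.s i + ∑ k ∈ Finset.range i, Polynomial.C (M i k) * 𝔅.s k) =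
        ∑ k ∈ Finset.range (i + 2), Polynomial.C (B i k) * 𝔅.s k) →
      ∀ i k, 𝔅.P k i + ∑ j ∈ Finset.range i, M i j * 𝔅.P k j = B i k) := by
  have hc : SemiBOP.MomentsConverge X Y κ := SemiBOP.momentsConverge_of_degree hconv
  refine ⟨𝔅.isUnit_ladder hc hn, fun x _ hx => 𝔅.Phi_eq_mul_ladder hc hx hn,
    fun x hxD hx => 𝔅.hasDerivAt_Phi hc hxD hx hn, fun hli x hxD hx => ?_,
    𝔅.exists_polynomial_matrix hc hn, fun M B hB h => 𝔅.P_eq_of_lower_triangular hc hB h⟩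
  have hu := 𝔅.isUnit_Phi hc hli hxD hx n
  have hd : 𝔅.dPhi n x = 𝔅.Phi n x * 𝔅.coeffMatrix n x :=
    Matrix.ext fun r b => (𝔅.hasDerivAt_Phi hc hxD hx hn r b).deriv
  refine ⟨hu, ?_⟩
  rw [hd, Matrix.nonsing_inv_mul_cancel_left _ _ ((Matrix.isUnit_iff_isUnit_det _).1 hu)]
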